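/- Let $(M,g)$ be a compact, connected, smooth Riemannian manifold without boundary, with Riemannian distance $d$. Let $H:T^*M\to\mathbb{R}$ be a Tonelli Hamiltonian: $H$ is of class $C^2$, $H_{pp}(x,p)$ is positive definite for every $(x,p)\in T^*M$, and for every $K$ there is $C_K$ with $H(x,p)\ge K|p|_x-C_K$ on $T^*M$. Let $L(x,v)=\sup_{p\in T^*_xM}\{p(v)-H(x,p)\}$ be the associated Lagrangian, and for $t>0$, $x,y\in M$ put $$A_t(x,y)=\inf_\xi\int_0^tL(\xi(s),\dot\xi(s))\,ds,\qquad T^+_t\phi(x)=\sup_{y\in M}\{\phi(y)-A_t(x,y)\},$$ where $\xi$ runs over the absolutely continuous curves $[0,t]\to M$ with $\xi(0)=x$, $\xi(t)=y$. Let $\phi:M\to\mathbb{R}$ be semiconcave with linear modulus: $\phi$ is continuous and there is $C\ge0$ such that $(1-\lambda)\phi(\gamma(0))+\lambda\phi(\gamma(1))-\phi(\gamma(\lambda))\le\frac C2\lambda(1-\lambda)d^2(\gamma(0),\gamma(1))$ for every constant-speed minimizing geodesic $\gamma:[0,1]\to M$ and every $\lambda\in[0,1]$. Denote by $D^+\phi(y)\subset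 T^*_yM$ the superdifferential of $\phi$ at $y$. Fix $x\in M$. For $\tau>0$ let $W_\tau(t,y)=H_p(y,DT^+_{\tau-t}\phi(y))$ for $t\in[0,\tau)$, extended $\tau$-periodically in $t$ to $[0,\infty)$, and let $\mathbf{x}^\tau_+:[0,\infty)\to M$ denote a solution of $\dot{\mathbf{x}}^\tau_+(t)=W_\tau(t,\mathbf{x}^\tau_+(t))$, $\mathbf{x}^\tau_+(0)=x$, i.e. a continuous curve along which the field is defined (the function $T^+_{\tau-t}\phi$, with $t$ replaced by its representative in $[0,\tau)$ modulo $\tau$, is differentiable at $\mathbf{x}^\tau_+(t)$) and which solves the equation on each interval $[k\tau,(k+1)\tau)$, $k=0,1,\dots$ (with the right derivative at $k\tau$). A minimizing movement of $(\phi,H)$ from $x$ in positive direction is a curve $\mathbf{z}:[0,\infty)\to M$ which is the limit, uniformly on compact subsets of $[0,\infty)$ and along some sequence $\tau_j\downarrow0^+$, of piecewise constant curves $\mathbf{z}^{\tau}(t)=z^\tau_{\lfloor t/\tau\rfloor}$, where $z^\tau_0=x$ and $z^\tau_{k+1}\in\arg\max\{\phi(y)-A_\tau(z^\tau_k,y):y\in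 M\}$ for $k=0,1,\dots$. Then: (1) every curve $\mathbf{x}_+:[0,\infty)\to M$ which is the limit of $\mathbf{x}^{\tau_j}_+$, uniformly on compact subsets of $[0,\infty)$, along some sequence $\tau_j\to0^+$, is a minimizing movement of $(\phi,H)$ from $x$ in positive direction; (2) every minimizing movement $\mathbf{z}$ of $(\phi,H)$ from $x$ in positive direction is a generalized characteristic from $x$: it is Lipschitz on $[0,\infty)$, $\mathbf{z}(0)=x$, and for a.e. $t\ge0$ the derivative $\dot{\mathbf{z}}(t)$ exists and belongs to $\mathrm{co}\,H_p(\mathbf{z}(t),D^+\phi(\mathbf{z}(t)))$. -/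

import Mathlib

open Set Filter Topology MeasureTheory Manifold Bundle
open scoped ContDiff

noncomputable section

section GHGF

variable {E : Type*} [NormedAddCommGroup E] [NormedSpace ℝ E] [FiniteDimensional ℝ E]
  {M : Type*} [MetricSpace M] [ChartedSpace E M]

/-- The cotangent space `T*_x M`. -/
abbrev CotSpace (E : Type*) [NormedAddCommGroup E] [NormedSpace ℝ E]
    {M : Type*} [TopologicalSpace M] [ChartedSpace E M] (x : M) : Type _ :=
  TangentSpace 𝓘(ℝ, E) x →L[ℝ] ℝ

instance tangentSpace_finiteDimensional (x : M) :
    FiniteDimensional ℝ (TangentSpace 𝓘(ℝ, E) x) :=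
  inferInstanceAs (FiniteDimensional ℝ E)

/-! ### Hamiltonians and Lagrangians -/

section Hamiltonian

variable [RiemannianBundle (fun x : M ↦ TangentSpace 𝓘(ℝ, E) x)]

/-- Tonelli Hamiltonians `H : T*M → ℝ`: of class `C²` on the cotangent bundle, with positive
definite second derivative along the fibres, and uniformly superlinear in the fibres. -/
structure IsTonelli [IsManifold 𝓘(ℝ, E) ∞ M] (H : ∀ x : M, CotSpace E x → ℝ) : Prop where
  contMDiff : ContMDiff (𝓘(ℝ, E).prod 𝓘(ℝ, E →L[ℝ] ℝ)) 𝓘(ℝ, ℝ) 2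
    (fun q : TotalSpace (E →L[ℝ] ℝ)
      (fun x : M ↦ TangentSpace 𝓘(ℝ, E) x →L[ℝ] Bundle.Trivial M ℝ x) ↦ H q.1 q.2)
  pos : ∀ (x : M) (p q : CotSpace E x), q ≠ 0 → 0 < fderiv ℝ (fderiv ℝ (H x)) p q q
  superlinear : ∀ K : ℝ, ∃ C : ℝ, ∀ (x : M) (p : CotSpace E x), K * ‖p‖ - C ≤ H x p

/-- The fibre derivative `H_p(x,p)`, an element of the bidual of `T_x M`, seen as a tangent vector
through the canonical isomorphism. -/
def fibreDeriv (H : ∀ x : M, CotSpace E x → ℝ) (x : M) (p : CotSpace E x) :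
    TangentSpace 𝓘(ℝ, E) x :=
  (Module.evalEquiv ℝ (TangentSpace 𝓘(ℝ, E) x)).symm
    ((fderiv ℝ (H x) p).toLinearMap ∘ₗ
      (LinearMap.toContinuousLinearMap :
        (TangentSpace 𝓘(ℝ, E) x →ₗ[ℝ] ℝ) ≃ₗ[ℝ] CotSpace E x).toLinearMap)

theorem apply_fibreDeriv (H : ∀ x : M, CotSpace E x → ℝ) (x : M) (p q : CotSpace E x) :
    q (fibreDeriv H x p) = fderiv ℝ (H x) p q := by
  have h := Module.apply_evalEquiv_symm_apply ℝ (TangentSpace 𝓘(ℝ, E) x) q.toLinearMap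
    ((fderiv ℝ (H x) p).toLinearMap ∘ₗ
      (LinearMap.toContinuousLinearMap :
        (TangentSpace 𝓘(ℝ, E) x →ₗ[ℝ] ℝ) ≃ₗ[ℝ] CotSpace E x).toLinearMap)
  exact h

end Hamiltonian

/-- The Lagrangian associated with `H`, by the Fenchel transform. -/
def lagrangian (H : ∀ x : M, CotSpace E x → ℝ) (x : M) (v : TangentSpace 𝓘(ℝ, E) x) : ℝ :=
  ⨆ p : CotSpace E x, (p v - H x p)

/-- `L(ξ(s), ξ'(s))`. -/
def lagrangianAlong (H : ∀ x : M, CotSpace E x → ℝ) (ξ : ℝ → M) (s : ℝ) : ℝ :=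
  lagrangian H (ξ s) (mfderiv 𝓘(ℝ, ℝ) 𝓘(ℝ, E) ξ s (1 : ℝ))

/-- The fundamental solution `A_t(x,y)`: the infimum of the action over the absolutely continuous
curves `ξ : [0,t] → M` from `x` to `y`. As `L` is bounded below, a curve along which `L` is not
integrable has action `+∞`; such curves are left out of the infimum. -/
def fundamentalSolution (H : ∀ x : M, CotSpace E x → ℝ) (t : ℝ) (x y : M) : ℝ :=
  sInf {a : ℝ | ∃ ξ : ℝ → M, AbsolutelyContinuousOnInterval ξ 0 t ∧ ξ 0 = x ∧ ξ t = y ∧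
    IntervalIntegrable (lagrangianAlong H ξ) volume 0 t ∧
    a = ∫ s in (0 : ℝ)..t, lagrangianAlong H ξ s}

/-- The positive Lax-Oleinik operator `T⁺_t`, for `t > 0`. -/
def laxOleinikPos (H : ∀ x : M, CotSpace E x → ℝ) (φ : M → ℝ) (t : ℝ) (x : M) : ℝ :=
  ⨆ y : M, (φ y - fundamentalSolution H t x y)

/-! ### Semiconcave functions -/

/-- `γ : [0,1] → M` is a minimizing geodesic, parametrized with constant speed. -/
def IsMinGeodesic {X : Type*} [MetricSpace X] (γ : ℝ → X) : Prop :=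
  ∀ s ∈ Icc (0 : ℝ) 1, ∀ t ∈ Icc (0 : ℝ) 1, dist (γ s) (γ t) = |s - t| * dist (γ 0) (γ 1)

/-- Semiconcavity with linear modulus. -/
def IsSemiconcave {X : Type*} [MetricSpace X] (φ : X → ℝ) : Prop :=
  Continuous φ ∧ ∃ C : ℝ, 0 ≤ C ∧ ∀ γ : ℝ → X, IsMinGeodesic γ → ∀ s ∈ Icc (0 : ℝ) 1,
    (1 - s) * φ (γ 0) + s * φ (γ 1) - φ (γ s) ≤ C / 2 * (s * (1 - s)) * dist (γ 0) (γ 1) ^ 2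

/-- The superdifferential `D⁺φ(x) ⊆ T*_x M`. It is computed in the preferred chart at `x`, the one
through which Mathlib identifies `T_x M` with the model space `E`. -/
def superdifferential (E : Type*) [NormedAddCommGroup E] [NormedSpace ℝ E]
    {M : Type*} [TopologicalSpace M] [ChartedSpace E M] (φ : M → ℝ) (x : M) :
    Set (CotSpace E x) :=
  {p | ∀ ε > (0 : ℝ), ∀ᶠ y in 𝓝 x,
    φ y - φ x - p (extChartAt 𝓘(ℝ, E) x y - extChartAt 𝓘(ℝ, E) x x : E) ≤
      ε * ‖extChartAt 𝓘(ℝ, E) x y - extChartAt 𝓘(ℝ, E) x x‖}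

/-! ### Curves

Curves `[0,∞) → M` are functions `ℝ → M` of which only the values on `[0,∞)` matter. -/

/-- The curves `u j` converge to `w` uniformly on the compact subsets of `[0,∞)`. -/
def TendstoOnCompacts {X : Type*} [MetricSpace X] (u : ℕ → ℝ → X) (w : ℝ → X) : Prop :=
  ∀ K ⊆ Ici (0 : ℝ), IsCompact K → TendstoUniformlyOn u w atTop K

section Characteristics

variable [RiemannianBundle (fun x : M ↦ TangentSpace 𝓘(ℝ, E) x)]

/-- `γ` is a generalized characteristic of `(φ,H)` from `x`: a Lipschitz curve `[0,∞) → M` with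
`γ(0) = x` and `γ'(t) ∈ co H_p(γ(t), D⁺φ(γ(t)))` for a.e. `t ≥ 0`. -/
def IsGeneralizedCharacteristic (φ : M → ℝ) (H : ∀ x : M, CotSpace E x → ℝ) (x : M)
    (γ : ℝ → M) : Prop :=
  (∃ K, LipschitzOnWith K γ (Ici 0)) ∧ γ 0 = x ∧
    ∀ᵐ t ∂(volume.restrict (Ici (0 : ℝ))),
      ∃ v ∈ convexHull ℝ (fibreDeriv H (γ t) '' superdifferential E φ (γ t)),
        HasMFDerivAt 𝓘(ℝ, ℝ) 𝓘(ℝ, E) γ t ((1 : ℝ →L[ℝ] ℝ).smulRight v)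

/-- The vector field `W_τ`: `W_τ(t,x) = H_p(x, DT⁺_{τ-t}φ(x))` for `t ∈ [0,τ)`, extended
`τ`-periodically in `t` (`τ * Int.fract (t / τ)` is the representative of `t` in `[0,τ)`). -/
def periodicField (φ : M → ℝ) (H : ∀ x : M, CotSpace E x → ℝ) (τ t : ℝ) (x : M) :
    TangentSpace 𝓘(ℝ, E) x :=
  fibreDeriv H x
    (mfderiv 𝓘(ℝ, E) 𝓘(ℝ, ℝ) (laxOleinikPos H φ (τ - τ * Int.fract (t / τ))) x : CotSpace E x)

/-- `γ` is a solution `x^τ₊` on `[0,∞)` of `γ'(t) = W_τ(t,γ(t))`, `γ(0) = x`: it is continuous and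
solves the equation on each interval `[kτ,(k+1)τ)` (with the right derivative at `kτ`); the
field has to be defined along `γ`, i.e. `T⁺_{τ-⟨t/τ⟩τ}φ` is differentiable at `γ(t)`. -/
structure IsPeriodicFieldSolution (φ : M → ℝ) (H : ∀ x : M, CotSpace E x → ℝ) (τ : ℝ) (x : M)
    (γ : ℝ → M) : Prop where
  continuousOn : ContinuousOn γ (Ici 0)
  init : γ 0 = x
  mdifferentiableAt : ∀ t, 0 ≤ t →
    MDifferentiableAt 𝓘(ℝ, E) 𝓘(ℝ, ℝ) (laxOleinikPos H φ (τ - τ * Int.fract (t / τ))) (γ t)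
  ode : ∀ k : ℕ, ∀ t ∈ Ico (k * τ) ((k + 1) * τ),
    HasMFDerivWithinAt 𝓘(ℝ, ℝ) 𝓘(ℝ, E) γ (Ico (k * τ) ((k + 1) * τ)) t
      ((1 : ℝ →L[ℝ] ℝ).smulRight (periodicField φ H τ t (γ t)))

/-- `γ` is a limiting curve `x₊` of the family `x^τ₊`, along some sequence `τ → 0⁺`. -/
def IsPeriodicFieldLimit (φ : M → ℝ) (H : ∀ x : M, CotSpace E x → ℝ) (x : M) (γ : ℝ → M) : Prop :=
  ∃ (τ : ℕ → ℝ) (u : ℕ → ℝ → M), (∀ j, 0 < τ j) ∧ Tendsto τ atTop (𝓝 0) ∧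
    (∀ j, IsPeriodicFieldSolution φ H (τ j) x (u j)) ∧ TendstoOnCompacts u γ

end Characteristics

/-! ### Minimizing movements -/

/-- The scheme with time step `τ`: `z 0 = x`, and `z (k+1)` is a maximizer of
`y ↦ φ y - A_τ(z k, y)`. -/
def IsArgmaxScheme (φ : M → ℝ) (H : ∀ x : M, CotSpace E x → ℝ) (τ : ℝ) (x : M)
    (z : ℕ → M) : Prop :=
  z 0 = x ∧ ∀ k, IsMaxOn (fun y ↦ φ y - fundamentalSolution H τ (z k) y) univ (z (k + 1))

/-- `γ` is a minimizing movement of `(φ,H)` from `x` in the positive direction: a limit, along some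
sequence `τ → 0⁺`, of the piecewise constant curves `z^τ(t) = z_⌊t/τ⌋`. -/
def IsMinimizingMovement (φ : M → ℝ) (H : ∀ x : M, CotSpace E x → ℝ) (x : M) (γ : ℝ → M) : Prop :=
  ∃ (τ : ℕ → ℝ) (z : ℕ → ℕ → M), (∀ j, 0 < τ j) ∧ Tendsto τ atTop (𝓝 0) ∧
    (∀ j, IsArgmaxScheme φ H (τ j) x (z j)) ∧
    TendstoOnCompacts (fun j t ↦ z j ⌊t / τ j⌋₊) γ

end GHGF

end

/-! ### The Legendre transform on a finite dimensional space -/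

section Legendre

variable {V : Type*} [NormedAddCommGroup V] [NormedSpace ℝ V]

/-! Everything reduces to short times. If y, z tend to x₀ and (z - y)/τ tends to w in the chart at
x₀, then A_τ(y,z) = τ L(x₀,w) + o(τ). The upper bound is the action of a chart segment
(`exists_fundamentalSolution_le_lagrangian`). The lower bound integrates the Fenchel inequality with
a fixed covector, curves that leave a small ball being too expensive
(`exists_fundamentalSolution_ge_hamiltonian`). Almost optimal points are used throughout, never
minimizers of the action or Euler-Lagrange equations.

Minimizing movements are characteristics. Superlinearity bounds the steps by Rτ, so limits are
Lipschitz. Suppose step velocities converge to w at x₀. Comparing the maximizer z with z + τq gives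
φ(z + τq) - φ(z) ≤ τ(L(w + q) - L(w)) + o(τ). Semiconcavity propagates this from scale τ to a fixed
scale r: φ(x₀ + rq) - φ(x₀) ≤ r(L(w + q) - L(w)) + O(|rq|^(3/2)) (`exists_step_limit_le`). Hence p =
L_v(x₀,w) lies in D⁺φ(x₀) and w = H_p(x₀,p) (`mem_velocitySet_of_tendsto`). By compactness, all
short steps near x₀ have velocity within ε of H_p(x₀,D⁺φ(x₀)). A difference quotient of the limit
curve is a limit of averages of such velocities, hence lies in the closed ε-neighbourhood of the
convex hull; let ε → 0 (`velocity_mem_convexHull`).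

Semiconcavity is assumed along metric geodesics but used along chart segments. The bridge is
`geodesic_deviation`: a minimizing geodesic of length D deviates at time t from its chart segment by
O(t D^(3/2)), by Stewart's identity applied at dyadic scales. The same estimate shows that φ is
Lipschitz.

Limits of periodic solutions are minimizing movements. Where T⁺_σφ is differentiable, almost optimal
first steps must have velocity H_p(x₀,DT⁺_σφ(x₀)); therefore a curve leaving x₀ with this velocity
is calibrated up to o(h) (`eventually_le_laxOleinikPos`). Continuous induction adds up these
infinitesimal calibrations over one period (`nonpos_of_subadditive_of_eventually`), so the solution
reaches at time (k+1)τ a maximizer for its position at time kτ (`laxOleinikPos_le_of_solution`). Its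
samples at multiples of τ thus form the discrete scheme, with the same limit. -/

theorem add_fderiv_lt_of_fderiv_fderiv_pos {W : Type*} [NormedAddCommGroup W] [NormedSpace ℝ W]
    {h : W → ℝ} (hh : ContDiff ℝ 2 h) (hpos : ∀ p q : W, q ≠ 0 → 0 < fderiv ℝ (fderiv ℝ h) p q q)
    {p q : W} (hpq : q ≠ p) :
    h p + fderiv ℝ h p (q - p) < h q := by
  set r := q - p with hr
  have hr0 : r ≠ 0 := sub_ne_zero.2 hpq
  have hl (t : ℝ) : HasDerivAt (fun t : ℝ ↦ p + t • r) r t := by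
    simpa using ((hasDerivAt_id t).smul_const r).const_add p
  have hd1 (t : ℝ) : HasDerivAt (fun t : ℝ ↦ h (p + t • r)) (fderiv ℝ h (p + t • r) r) t :=
    (hh.differentiable (by norm_num) (p + t • r)).hasFDerivAt.comp_hasDerivAt t (hl t)
  have hd2 (t : ℝ) : HasDerivAt (fun t : ℝ ↦ fderiv ℝ h (p + t • r) r)
      (fderiv ℝ (fderiv ℝ h) (p + t • r) r r) t := by
    have h1 : DifferentiableAt ℝ (fderiv ℝ h) (p + t • r) :=
      (hh.fderiv_right (m := 1) (by norm_num)).differentiable (by norm_num) _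
    have h2 : HasDerivAt (fun t : ℝ ↦ fderiv ℝ h (p + t • r))
        (fderiv ℝ (fderiv ℝ h) (p + t • r) r) t := h1.hasFDerivAt.comp_hasDerivAt t (hl t)
    simpa using h2.clm_apply (hasDerivAt_const t r)
  -- The slope along the segment from p to q is strictly increasing, so the mean slope h q - h p
  -- exceeds the slope at p.
  have hmono : StrictMono fun t : ℝ ↦ fderiv ℝ h (p + t • r) r :=
    strictMono_of_hasDerivAt_pos hd2 fun t ↦ hpos _ _ hr0
  obtain ⟨c, hc, hc'⟩ := exists_hasDerivAt_eq_slope (fun t : ℝ ↦ h (p + t • r)) _ zero_lt_one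
    (fun t _ ↦ (hd1 t).continuousAt.continuousWithinAt) (fun t _ ↦ hd1 t)
  have h3 := hmono hc.1
  simp only [zero_smul, add_zero, one_smul, sub_zero, div_one] at hc' h3
  rw [hc'] at h3
  have : p + r = q := by rw [hr]; abel
  rw [this] at h3
  linarith

/-- Tonelli functions on the dual of a normed space. -/
structure IsTonelliFun (h : (V →L[ℝ] ℝ) → ℝ) : Prop where
  contDiff : ContDiff ℝ 2 h
  pos : ∀ p q : V →L[ℝ] ℝ, q ≠ 0 → 0 < fderiv ℝ (fderiv ℝ h) p q q
  superlinear : ∀ K : ℝ, ∃ C : ℝ, ∀ p, K * ‖p‖ - C ≤ h p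

/-- The Legendre transform of a function on the dual space. -/
noncomputable def legendre (h : (V →L[ℝ] ℝ) → ℝ) (v : V) : ℝ := ⨆ p : V →L[ℝ] ℝ, (p v - h p)

variable {h : (V →L[ℝ] ℝ) → ℝ}

theorem apply_sub_le_of_superlinear {K C : ℝ} {v : V} (hv : ‖v‖ ≤ K)
    (hC : ∀ p, K * ‖p‖ - C ≤ h p) (p : V →L[ℝ] ℝ) : p v - h p ≤ C := by
  have h1 : p v ≤ ‖p‖ * ‖v‖ := (le_abs_self _).trans (p.le_opNorm v)
  have h2 : ‖p‖ * ‖v‖ ≤ ‖p‖ * K := mul_le_mul_of_nonneg_left hv (norm_nonneg _)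
  have := hC p
  linarith [mul_comm K ‖p‖]

theorem legendre_le_of_superlinear {K C : ℝ} {v : V} (hv : ‖v‖ ≤ K)
    (hC : ∀ p, K * ‖p‖ - C ≤ h p) : legendre h v ≤ C :=
  ciSup_le (apply_sub_le_of_superlinear hv hC)

theorem le_legendre (hs : ∀ K : ℝ, ∃ C : ℝ, ∀ p, K * ‖p‖ - C ≤ h p) (p : V →L[ℝ] ℝ) (v : V) :
    p v - h p ≤ legendre h v := by
  obtain ⟨C, hC⟩ := hs ‖v‖
  exact le_ciSup (f := fun p : V →L[ℝ] ℝ ↦ p v - h p)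
    ⟨C, by rintro _ ⟨q, rfl⟩; exact apply_sub_le_of_superlinear le_rfl hC q⟩ p

/-- Test the supremum at K times a norming functional of v. This turns bounds of H on balls of
covectors into superlinearity of L. -/
theorem legendre_ge_of_bound (hs : ∀ K : ℝ, ∃ C : ℝ, ∀ p, K * ‖p‖ - C ≤ h p) {K C : ℝ}
    (hK : 0 ≤ K) (hC : ∀ p : V →L[ℝ] ℝ, ‖p‖ ≤ K → h p ≤ C) (v : V) :
    K * ‖v‖ - C ≤ legendre h v := by
  obtain ⟨p, hp, hpv⟩ := exists_dual_vector'' ℝ v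
  have h1 := le_legendre hs (K • p) v
  have h2 := hC (K • p) (by
    rw [norm_smul, Real.norm_of_nonneg hK]
    exact mul_le_of_le_one_right hK hp)
  have h3 : (K • p) v = K * ‖v‖ := by simp [hpv]
  linarith

namespace IsTonelliFun

theorem differentiable (hh : IsTonelliFun h) : Differentiable ℝ h :=
  hh.contDiff.differentiable (by norm_num)

theorem exists_legendre_eq [FiniteDimensional ℝ V] (hh : IsTonelliFun h) (v : V) :
    ∃ p : V →L[ℝ] ℝ, legendre h v = p v - h p := by
  -- One unit of slope beyond ‖v‖ leaves p v - h p ≤ C - ‖p‖, which is coercive.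
  obtain ⟨C, hC⟩ := hh.superlinear (‖v‖ + 1)
  have hcont : Continuous fun p : V →L[ℝ] ℝ ↦ p v - h p :=
    (by fun_prop : Continuous fun p : V →L[ℝ] ℝ ↦ p v).sub hh.contDiff.continuous
  have hlim : Tendsto (fun p : V →L[ℝ] ℝ ↦ p v - h p) (cocompact _) atBot := by
    refine tendsto_atBot_mono (f := fun p : V →L[ℝ] ℝ ↦ C - ‖p‖) (fun p ↦ ?_) ?_
    · have h1 : p v ≤ ‖p‖ * ‖v‖ := (le_abs_self _).trans (p.le_opNorm v)
      have := hC p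
      linarith
    · exact tendsto_atBot_add_const_left _ C
        (tendsto_neg_atTop_atBot.comp (tendsto_norm_cocompact_atTop (E := V →L[ℝ] ℝ)))
  obtain ⟨p, hp⟩ := hcont.exists_forall_ge hlim
  exact ⟨p, le_antisymm (ciSup_le hp) (le_legendre hh.superlinear p v)⟩

theorem lt_of_ne (hh : IsTonelliFun h) {p q : V →L[ℝ] ℝ} (hpq : q ≠ p) :
    h p + fderiv ℝ h p (q - p) < h q :=
  add_fderiv_lt_of_fderiv_fderiv_pos hh.contDiff hh.pos hpq

theorem le (hh : IsTonelliFun h) (p q : V →L[ℝ] ℝ) : h p + fderiv ℝ h p (q - p) ≤ h q := by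
  rcases eq_or_ne q p with rfl | hne
  · simp
  · exact (hh.lt_of_ne hne).le

theorem fderiv_eq_of_legendre_eq (hh : IsTonelliFun h) {p : V →L[ℝ] ℝ} {v : V}
    (hp : legendre h v = p v - h p) (q : V →L[ℝ] ℝ) : fderiv ℝ h p q = q v := by
  have hmax : IsLocalMax (fun q : V →L[ℝ] ℝ ↦ q v - h q) p :=
    Eventually.of_forall fun q ↦ (le_legendre hh.superlinear q v).trans hp.le
  have hev : HasFDerivAt (fun q : V →L[ℝ] ℝ ↦ q v)
      (ContinuousLinearMap.apply ℝ ℝ v) p := (ContinuousLinearMap.apply ℝ ℝ v).hasFDerivAt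
  have := hmax.hasFDerivAt_eq_zero (hev.sub (hh.differentiable p).hasFDerivAt)
  have := DFunLike.congr_fun this q
  simp at this
  linarith

theorem legendre_eq_of_fderiv_eq (hh : IsTonelliFun h) {p : V →L[ℝ] ℝ} {v : V}
    (hp : ∀ q : V →L[ℝ] ℝ, q v = fderiv ℝ h p q) : legendre h v = p v - h p := by
  refine le_antisymm (ciSup_le fun q ↦ ?_) (le_legendre hh.superlinear p v)
  have := hh.le p q
  rw [map_sub, ← hp, ← hp] at this
  linarith

/-- If `p` is a subgradient at `w` of the Legendre transform, and `v` is dual to `p`, then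
`v = w`. -/
theorem eq_of_subgradient (hh : IsTonelliFun h) {p : V →L[ℝ] ℝ} {v w : V}
    (hp : ∀ q : V →L[ℝ] ℝ, q v = fderiv ℝ h p q)
    (hw : ∀ u, legendre h w - p u ≤ legendre h (w - u)) : w = v := by
  -- With u = w - v the right side is the transform at v, explicit because v is dual to p. It
  -- follows that p is optimal for w as well, so v and w both represent the differential of h at p.
  have h1 := hw (w - v)
  rw [sub_sub_cancel, hh.legendre_eq_of_fderiv_eq hp, map_sub] at h1
  have h2 : legendre h w = p w - h p :=
    le_antisymm (by linarith) (le_legendre hh.superlinear p w)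
  have h3 := hh.fderiv_eq_of_legendre_eq h2
  refine (SeparatingDual.eq_iff_forall_dual_eq (R := ℝ)).2 fun q ↦ ?_
  rw [hp, h3]

theorem legendre_maximizer_unique (hh : IsTonelliFun h) {p q : V →L[ℝ] ℝ} {v : V}
    (hp : legendre h v = p v - h p) (hq : legendre h v = q v - h q) : q = p := by
  by_contra hne
  have := hh.lt_of_ne hne
  rw [map_sub, hh.fderiv_eq_of_legendre_eq hp, hh.fderiv_eq_of_legendre_eq hp] at this
  linarith

/-- The Legendre transform is differentiable from above. -/
theorem exists_legendre_add_le [FiniteDimensional ℝ V] (hh : IsTonelliFun h) {p : V →L[ℝ] ℝ}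
    {w : V} (hp : legendre h w = p w - h p) {ε : ℝ} (hε : 0 < ε) :
    ∃ η > 0, ∀ u : V, ‖u‖ ≤ η → legendre h (w + u) ≤ legendre h w + p u + ε * ‖u‖ := by
  choose m hm using hh.exists_legendre_eq
  -- The maximizer at w + u, tested at w, gives L(w + u) ≤ L(w) + m(w + u) u, so only continuity of
  -- m at w is missing. It follows from local boundedness of m and uniqueness of the maximizer at w.
  suffices hlim : Tendsto m (𝓝 w) (𝓝 p) by
    obtain ⟨η, hη, hη'⟩ := Metric.tendsto_nhds_nhds.1 hlim ε hε
    refine ⟨η / 2, by positivity, fun u hu ↦ ?_⟩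
    have h1 := hη' (x := w + u) (by simpa [dist_eq_norm] using by linarith)
    rw [dist_eq_norm] at h1
    have h2 := le_legendre hh.superlinear (m (w + u)) w
    have h3 : (m (w + u) - p) u ≤ ε * ‖u‖ :=
      (le_abs_self _).trans (((m (w + u) - p).le_opNorm u).trans (by gcongr))
    rw [hm (w + u), map_add]
    simp only [sub_apply] at h3
    linarith
  obtain ⟨C, hC⟩ := hh.superlinear (‖w‖ + 2)
  have hbound : ∀ᶠ v in 𝓝 w, m v ∈ Metric.closedBall (0 : V →L[ℝ] ℝ) (C + h 0) := by
    filter_upwards [Metric.ball_mem_nhds w one_pos] with v hv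
    rw [mem_closedBall_zero_iff]
    have h0 : ‖v‖ ≤ ‖w‖ + 1 := by
      have := norm_le_norm_add_norm_sub' v w
      rw [Metric.mem_ball, dist_eq_norm] at hv
      linarith
    have h1 := le_legendre hh.superlinear 0 v
    rw [hm v] at h1
    have h2 := hC (m v)
    have h3 : m v v ≤ ‖m v‖ * ‖v‖ := (le_abs_self _).trans ((m v).le_opNorm v)
    have h4 : ‖m v‖ * ‖v‖ ≤ ‖m v‖ * (‖w‖ + 1) := by gcongr
    simp only [zero_apply, zero_sub] at h1
    linarith
  refine (isCompact_closedBall (0 : V →L[ℝ] ℝ) (C + h 0)).tendsto_nhds_of_unique_mapClusterPt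
    hbound fun q _ hq ↦ ?_
  obtain ⟨U, hU, hUq⟩ := mapClusterPt_iff_ultrafilter.1 hq
  refine hh.legendre_maximizer_unique hp ?_
  refine le_antisymm (ciSup_le fun r ↦ ?_) (le_legendre hh.superlinear q w)
  have hid : Tendsto (fun v : V ↦ v) U (𝓝 w) := hU
  have hcont : Continuous fun z : V × (V →L[ℝ] ℝ) ↦ z.2 z.1 - h z.2 :=
    (by fun_prop : Continuous fun z : V × (V →L[ℝ] ℝ) ↦ z.2 z.1).sub
      (hh.contDiff.continuous.comp continuous_snd)
  have hl := (hcont.tendsto (w, q)).comp (hid.prodMk_nhds hUq)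
  have hr : Tendsto (fun v ↦ r v - h r) U (𝓝 (r w - h r)) :=
    ((r.continuous.tendsto w).comp hid).sub_const _
  refine le_of_tendsto_of_tendsto' hr hl fun v ↦ ?_
  have := le_legendre hh.superlinear r v
  rw [hm v] at this
  exact this

/-- For a norming functional q of v, convexity gives ‖v‖ = Dh(p) q ≤ h(p + q) - h p. Thus H_p is
controlled by values of H alone, uniformly over M. -/
theorem norm_le_of_bound (hh : IsTonelliFun h) {p : V →L[ℝ] ℝ} {v : V} {B C : ℝ}
    (hB : ∀ q : V →L[ℝ] ℝ, ‖q‖ ≤ ‖p‖ + 1 → h q ≤ B) (hC : ∀ q, -C ≤ h q)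
    (hp : ∀ q : V →L[ℝ] ℝ, q v = fderiv ℝ h p q) : ‖v‖ ≤ B + C := by
  obtain ⟨q, hq, hqv⟩ := exists_dual_vector'' ℝ v
  have h1 := hh.le p (p + q)
  rw [add_sub_cancel_left, ← hp, hqv] at h1
  have h2 := hB (p + q) ((norm_add_le _ _).trans (by gcongr))
  have h3 := hC p
  simp only [RCLike.ofReal_real_eq_id, id_eq] at h1
  linarith

end IsTonelliFun

end Legendre

/-! ### Hamiltonians in coordinates -/

section Coordinates

variable {E : Type*} [NormedAddCommGroup E] [NormedSpace ℝ E] [FiniteDimensional ℝ E]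
  {M : Type*} [MetricSpace M] [ChartedSpace E M]
  [IsManifold 𝓘(ℝ, E) ∞ M]

set_option linter.unusedSectionVars false

/-- The differential at `y` of the preferred chart at `x₀`. -/
noncomputable def chartD (x₀ y : M) : TangentSpace 𝓘(ℝ, E) y →L[ℝ] E :=
  (trivializationAt E (TangentSpace 𝓘(ℝ, E)) x₀).continuousLinearMapAt ℝ y

/-- The inverse of the differential at `y` of the preferred chart at `x₀`. -/
noncomputable def chartDSymm (x₀ y : M) : E →L[ℝ] TangentSpace 𝓘(ℝ, E) y :=
  (trivializationAt E (TangentSpace 𝓘(ℝ, E)) x₀).symmL ℝ y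

theorem chartD_eq_mfderiv {x₀ y : M} (hy : y ∈ (chartAt E x₀).source) :
    chartD x₀ y = (mfderiv 𝓘(ℝ, E) 𝓘(ℝ, E) (extChartAt 𝓘(ℝ, E) x₀) y) :=
  TangentBundle.continuousLinearMapAt_trivializationAt hy

theorem chartD_chartDSymm {x₀ y : M} (hy : y ∈ (chartAt E x₀).source) (u : E) :
    chartD x₀ y (chartDSymm x₀ y u) = u :=
  (trivializationAt E (TangentSpace 𝓘(ℝ, E)) x₀).continuousLinearMapAt_symmL (by simpa using hy) u

theorem chartDSymm_chartD {x₀ y : M} (hy : y ∈ (chartAt E x₀).source)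
    (v : TangentSpace 𝓘(ℝ, E) y) : chartDSymm x₀ y (chartD x₀ y v) = v :=
  (trivializationAt E (TangentSpace 𝓘(ℝ, E)) x₀).symmL_continuousLinearMapAt (by simpa using hy) v

theorem chartD_self (x₀ : M) (v : TangentSpace 𝓘(ℝ, E) x₀) : chartD x₀ x₀ v = v := by
  unfold chartD
  rw [TangentBundle.continuousLinearMapAt_trivializationAt_eq_core (mem_chart_source E x₀)]
  exact (tangentBundleCore 𝓘(ℝ, E) M).coordChange_self _ _ (mem_chart_source E x₀) _

theorem chartDSymm_self (x₀ : M) (u : E) : chartDSymm x₀ x₀ u = (u : E) := by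
  unfold chartDSymm
  rw [TangentBundle.symmL_trivializationAt_eq_core (mem_chart_source E x₀)]
  exact (tangentBundleCore 𝓘(ℝ, E) M).coordChange_self _ _ (mem_chart_source E x₀) _


theorem continuousOn_mk_chartDSymm (x₀ : M) :
    ContinuousOn (fun q : M × E ↦ (⟨q.1, chartDSymm x₀ q.1 q.2⟩ : TangentBundle 𝓘(ℝ, E) M))
      ((chartAt E x₀).source ×ˢ univ) := by
  have h := (trivializationAt E (TangentSpace 𝓘(ℝ, E)) x₀).continuousOn_symm
  rw [TangentBundle.trivializationAt_baseSet] at h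
  refine h.congr fun q hq ↦ ?_
  have hq' : q.1 ∈ (trivializationAt E (TangentSpace 𝓘(ℝ, E)) x₀).baseSet := by
    simpa using hq.1
  rw [chartDSymm, Trivialization.symmL_apply _ hq']

/-- Continuity of L is first proved at chart centres; this joint continuity of the change of
trivialization carries it to the rest of the chart. -/
theorem continuousAt_chartD_chartDSymm {x₀ y : M} (hy : y ∈ (chartAt E x₀).source) (u : E) :
    ContinuousAt (fun q : M × E ↦ chartD y q.1 (chartDSymm x₀ q.1 q.2)) (y, u) := by
  have h1 : ContinuousAt
      (fun q : M × E ↦ (⟨q.1, chartDSymm x₀ q.1 q.2⟩ : TangentBundle 𝓘(ℝ, E) M)) (y, u) :=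
    (continuousOn_mk_chartDSymm x₀).continuousAt
      (prod_mem_nhds ((chartAt E x₀).open_source.mem_nhds hy) univ_mem)
  have h2 := ((FiberBundle.continuousAt_totalSpace _ _).1 h1).2
  refine h2.congr ?_
  filter_upwards [continuousAt_fst.preimage_mem_nhds (chart_source_mem_nhds E y)] with q hq
  rw [chartD, Trivialization.continuousLinearMapAt_apply_of_mem]
  simpa using hq

/-- Smoothness of H is read on the dual of E, whereas the fibre carries its Riemannian norm; the
left inverse A of D transports `ContDiff` between the two. -/
theorem contDiff_of_comp_clm {V W : Type*} [NormedAddCommGroup V] [NormedSpace ℝ V]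
    [NormedAddCommGroup W] [NormedSpace ℝ W] {h : (V →L[ℝ] ℝ) → ℝ} {A : W →L[ℝ] V}
    {D : V →L[ℝ] W} (hAD : ∀ v, A (D v) = v) {n : ℕ∞ω}
    (hh : ContDiff ℝ n fun p : W →L[ℝ] ℝ ↦ h (p ∘L D)) : ContDiff ℝ n h := by
  convert hh.comp ((ContinuousLinearMap.compL ℝ W V ℝ).flip A).contDiff using 1
  ext p
  simp only [Function.comp_apply]
  congr 1
  ext v
  simp [hAD]

/-! ### Continuity and bounds of H and L in coordinates -/

section Hamiltonian

variable [RiemannianBundle (fun x : M ↦ TangentSpace 𝓘(ℝ, E) x)]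
  {H : ∀ x : M, CotSpace E x → ℝ}

theorem IsTonelli.contMDiffOn_coord (hH : IsTonelli H) (x₀ : M) :
    ContMDiffOn (𝓘(ℝ, E).prod 𝓘(ℝ, E →L[ℝ] ℝ)) 𝓘(ℝ, ℝ) 2
      (fun q : M × (E →L[ℝ] ℝ) ↦ H q.1 (q.2 ∘L chartD x₀ q.1))
      ((chartAt E x₀).source ×ˢ univ) := by
  have h1 := (trivializationAt (E →L[ℝ] ℝ)
    (fun x : M ↦ TangentSpace 𝓘(ℝ, E) x →L[ℝ] Bundle.Trivial M ℝ x) x₀).contMDiffOn_symm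
      (n := 2) (IB := 𝓘(ℝ, E))
  refine (hH.contMDiff.comp_contMDiffOn (h1.mono ?_)).congr fun q hq ↦ ?_
  · rw [hom_trivializationAt_target]
    simp
  · refine congrArg (H q.1) ?_
    ext v
    change _ = ((trivializationAt ℝ (Bundle.Trivial M ℝ) x₀).symmL ℝ q.1 (q.2 (chartD x₀ q.1 v)))
    simp

theorem IsTonelli.continuousOn_coord (hH : IsTonelli H) (x₀ : M) :
    ContinuousOn (fun q : M × (E →L[ℝ] ℝ) ↦ H q.1 (q.2 ∘L chartD x₀ q.1))
      ((chartAt E x₀).source ×ˢ univ) :=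
  (hH.contMDiffOn_coord x₀).continuousOn

theorem IsTonelli.isTonelliFun (hH : IsTonelli H) (x : M) : IsTonelliFun (H x) := by
  refine ⟨?_, hH.pos x, fun K ↦ ?_⟩
  · have h1 : ContMDiff 𝓘(ℝ, E →L[ℝ] ℝ) (𝓘(ℝ, E).prod 𝓘(ℝ, E →L[ℝ] ℝ)) 2
        (fun p : E →L[ℝ] ℝ ↦ (x, p)) := contMDiff_const.prodMk contMDiff_id
    have h2 : ContMDiff 𝓘(ℝ, E →L[ℝ] ℝ) 𝓘(ℝ, ℝ) 2
        (fun p : E →L[ℝ] ℝ ↦ H x (p ∘L chartD x x)) := by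
      have := (hH.contMDiffOn_coord x).comp (h1.contMDiffOn (s := univ))
        (fun p _ ↦ ⟨mem_chart_source E x, mem_univ _⟩)
      exact contMDiffOn_univ.1 this
    have h3 : ContDiff ℝ 2 (fun p : E →L[ℝ] ℝ ↦ H x (p ∘L chartD x x)) :=
      contMDiff_iff_contDiff.1 h2
    exact contDiff_of_comp_clm (V := TangentSpace 𝓘(ℝ, E) x) (W := E)
      (chartDSymm_chartD (mem_chart_source E x)) h3
  · obtain ⟨C, hC⟩ := hH.superlinear K
    exact ⟨C, hC x⟩

theorem lagrangian_eq_legendre (H : ∀ x : M, CotSpace E x → ℝ) (x : M)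
    (v : TangentSpace 𝓘(ℝ, E) x) : lagrangian H x v = legendre (H x) v := rfl

theorem comp_chartD_self (x₀ : M) (p : CotSpace E x₀) :
    (show E →L[ℝ] ℝ from p) ∘L chartD x₀ x₀ = p := by
  ext v
  exact congrArg p (chartD_self x₀ v)

/-- Joint continuity and compactness of the ball of covectors make the estimate uniform in p. -/
theorem IsTonelli.eventually_forall_coord_lt (hH : IsTonelli H) (x₀ : M) (R : ℝ) {ε : ℝ}
    (hε : 0 < ε) : ∀ᶠ y in 𝓝 x₀, ∀ p ∈ Metric.closedBall (0 : E →L[ℝ] ℝ) R,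
      |H y (p ∘L chartD x₀ y) - H x₀ (p ∘L chartD x₀ x₀)| < ε := by
  refine (isCompact_closedBall (0 : E →L[ℝ] ℝ) R).eventually_forall_of_forall_eventually
    fun p _ ↦ ?_
  have h1 : ContinuousAt (fun q : M × (E →L[ℝ] ℝ) ↦ H q.1 (q.2 ∘L chartD x₀ q.1)) (x₀, p) :=
    (hH.continuousOn_coord x₀).continuousAt
      (prod_mem_nhds (chart_source_mem_nhds E x₀) univ_mem)
  have h2 : ContinuousAt (fun q : M × (E →L[ℝ] ℝ) ↦ H x₀ (q.2 ∘L chartD x₀ x₀)) (x₀, p) :=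
    ContinuousAt.comp (f := fun q : M × (E →L[ℝ] ℝ) ↦ (x₀, q.2)) (x := (x₀, p)) h1
      (by fun_prop)
  have h3 := (h1.sub h2).abs
  exact h3.eventually_lt_const (by simpa using hε)

variable [IsContMDiffRiemannianBundle 𝓘(ℝ, E) ∞ E (fun x : M ↦ TangentSpace 𝓘(ℝ, E) x)]

theorem eventually_norm_chartD_le (x₀ : M) : ∃ C > 0, ∀ᶠ y in 𝓝 x₀,
    ‖chartD (E := E) x₀ y‖ ≤ C ∧ ‖chartDSymm (E := E) x₀ y‖ ≤ C := by
  have : IsContinuousRiemannianBundle E (fun x : M ↦ TangentSpace 𝓘(ℝ, E) x) := by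
    obtain ⟨g, hg, hg'⟩ := IsContMDiffRiemannianBundle.exists_contMDiff (IB := 𝓘(ℝ, E)) (n := ∞)
      (F := E) (E := fun x : M ↦ TangentSpace 𝓘(ℝ, E) x)
    exact ⟨g, hg.continuous, hg'⟩
  obtain ⟨C, hC, h1⟩ := eventually_norm_trivializationAt_lt E
    (fun x : M ↦ TangentSpace 𝓘(ℝ, E) x) x₀
  obtain ⟨C', hC', h2⟩ := eventually_norm_symmL_trivializationAt_lt E
    (fun x : M ↦ TangentSpace 𝓘(ℝ, E) x) x₀
  refine ⟨max C C', by positivity, ?_⟩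
  filter_upwards [h1, h2] with y hy hy'
  exact ⟨hy.le.trans (le_max_left _ _), hy'.le.trans (le_max_right _ _)⟩

theorem IsTonelli.exists_bound [CompactSpace M] (hH : IsTonelli H) (K : ℝ) :
    ∃ B : ℝ, ∀ (x : M) (p : CotSpace E x), ‖p‖ ≤ K → H x p ≤ B := by
  suffices h : ∃ B : ℝ, ∀ x ∈ (univ : Set M), ∀ p : CotSpace E x, ‖p‖ ≤ K → H x p ≤ B by
    obtain ⟨B, hB⟩ := h
    exact ⟨B, fun x ↦ hB x (mem_univ x)⟩
  refine isCompact_univ.induction_on (p := fun s : Set M ↦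
    ∃ B : ℝ, ∀ x ∈ s, ∀ p : CotSpace E x, ‖p‖ ≤ K → H x p ≤ B) ⟨0, by simp⟩ ?_ ?_ ?_
  · rintro s t hst ⟨B, hB⟩
    exact ⟨B, fun x hx ↦ hB x (hst hx)⟩
  · rintro s t ⟨B, hB⟩ ⟨B', hB'⟩
    refine ⟨max B B', fun x hx p hp ↦ ?_⟩
    rcases hx with hx | hx
    · exact (hB x hx p hp).trans (le_max_left _ _)
    · exact (hB' x hx p hp).trans (le_max_right _ _)
  · intro x₀ _
    obtain ⟨C, hC, hCy⟩ := eventually_norm_chartD_le (E := E) x₀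
    have h1 := hH.eventually_forall_coord_lt x₀ (K * C) one_pos
    have hcont : ContinuousOn (fun p : E →L[ℝ] ℝ ↦ H x₀ (p ∘L chartD x₀ x₀))
        (Metric.closedBall 0 (K * C)) :=
      (hH.continuousOn_coord x₀).comp (f := fun p : E →L[ℝ] ℝ ↦ (x₀, p)) (by fun_prop)
        fun p _ ↦ ⟨mem_chart_source E x₀, mem_univ _⟩
    obtain ⟨B, hB⟩ := (isCompact_closedBall (0 : E →L[ℝ] ℝ) (K * C)).bddAbove_image hcont
    refine ⟨_, mem_nhdsWithin_of_mem_nhds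
      (inter_mem (inter_mem hCy h1) (chart_source_mem_nhds E x₀)), B + 1, ?_⟩
    rintro y ⟨⟨hy1, hy2⟩, hy3⟩ p hp
    have hp' : p ∘L chartDSymm x₀ y ∈ Metric.closedBall (0 : E →L[ℝ] ℝ) (K * C) := by
      rw [mem_closedBall_zero_iff]
      refine (ContinuousLinearMap.opNorm_comp_le _ _).trans ?_
      exact mul_le_mul hp hy1.2 (norm_nonneg _) (p.opNorm_nonneg.trans hp)
    have h2 := hy2 _ hp'
    have h3 : (p ∘L chartDSymm x₀ y) ∘L chartD x₀ y = p := by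
      ext v
      simp [chartDSymm_chartD hy3]
    have h4 := hB (mem_image_of_mem _ hp')
    rw [h3] at h2
    linarith [(abs_lt.1 h2).2]

/-- Lower semicontinuity: freeze a maximizing covector at x₀. Upper semicontinuity: by
superlinearity only covectors in a fixed ball compete, and on that ball H varies uniformly little.
-/
theorem IsTonelli.continuousAt_lagrangian_coord (hH : IsTonelli H) (x₀ : M) (w : E) :
    ContinuousAt (fun q : M × E ↦ lagrangian H q.1 (chartDSymm x₀ q.1 q.2)) (x₀, w) := by
  obtain ⟨C, hC, hCy⟩ := eventually_norm_chartD_le (E := E) x₀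
  have hself : lagrangian H x₀ (chartDSymm x₀ x₀ w) = lagrangian H x₀ w := by
    rw [chartDSymm_self]
  have hsrc := chart_source_mem_nhds E x₀
  rw [ContinuousAt, tendsto_order]
  constructor
  · intro a ha
    obtain ⟨p, hp⟩ := (hH.isTonelliFun x₀).exists_legendre_eq (chartDSymm x₀ x₀ w)
    rw [← lagrangian_eq_legendre] at hp
    set p' : E →L[ℝ] ℝ := p ∘L chartDSymm x₀ x₀
    have h1 : ContinuousAt (fun q : M × E ↦ p' q.2 - H q.1 (p' ∘L chartD x₀ q.1)) (x₀, w) := by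
      refine ContinuousAt.sub (by fun_prop) ?_
      exact ContinuousAt.comp (f := fun q : M × E ↦ (q.1, p')) (x := (x₀, w))
        (g := fun q : M × (E →L[ℝ] ℝ) ↦ H q.1 (q.2 ∘L chartD x₀ q.1))
        ((hH.continuousOn_coord x₀).continuousAt (prod_mem_nhds hsrc univ_mem)) (by fun_prop)
    have h2 : p' ∘L chartD x₀ x₀ = p := by
      ext v
      simp [p', chartDSymm_chartD (mem_chart_source E x₀)]
    have h3 := h1.eventually_const_lt (u := a) (by
      simp only [h2]
      exact ha.trans_eq hp)
    filter_upwards [h3, continuousAt_fst.preimage_mem_nhds hsrc] with q hq hq'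
    refine hq.trans_le ?_
    have h4 := le_legendre (hH.isTonelliFun q.1).superlinear (p' ∘L chartD x₀ q.1)
      (chartDSymm x₀ q.1 q.2)
    simp only [ContinuousLinearMap.comp_apply, chartD_chartDSymm hq'] at h4
    exact h4
  · intro a ha
    simp only [hself] at ha
    obtain ⟨ε, hε, hεa⟩ : ∃ ε > 0, lagrangian H x₀ w + 3 * ε < a :=
      ⟨(a - lagrangian H x₀ w) / 6, by linarith, by linarith⟩
    -- This slope beats the pairing with any vector within 1 of w and leaves at most `B - ‖p'‖`;
    -- once `‖p'‖ > R` that is below the value at x₀.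
    obtain ⟨B, hB⟩ := hH.superlinear (C * (‖w‖ + 2))
    set R := max 0 (B - lagrangian H x₀ w)
    have h1 := hH.eventually_forall_coord_lt x₀ R hε
    have hR1 : 0 < R + 1 := by linarith [le_max_left 0 (B - lagrangian H x₀ w)]
    have h2 : ∀ᶠ u in 𝓝 w, ‖u - w‖ < min 1 (ε / (R + 1)) := by
      filter_upwards [Metric.ball_mem_nhds w (lt_min one_pos (div_pos hε hR1))] with u hu
      rwa [← dist_eq_norm]
    filter_upwards [continuousAt_fst.eventually (h1.and (hCy.and hsrc)),
      continuousAt_snd.eventually h2] with q hq hq'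
    obtain ⟨hq1, hq2, hq3⟩ := hq
    have hu1 := hq'.trans_le (min_le_left _ _)
    have hu2 := hq'.trans_le (min_le_right _ _)
    refine lt_of_le_of_lt (ciSup_le fun p ↦ ?_) hεa
    set p' : E →L[ℝ] ℝ := p ∘L chartDSymm x₀ q.1
    have hp' : p' ∘L chartD x₀ q.1 = p := by
      ext v
      simp [p', chartDSymm_chartD hq3]
    change p' q.2 - H q.1 p ≤ _
    by_cases hR : ‖p'‖ ≤ R
    · have h3 := hq1 p' (by simpa using hR)
      rw [hp', abs_lt] at h3
      have h4 := le_legendre (hH.isTonelliFun x₀).superlinear (p' ∘L chartD x₀ x₀)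
        (chartDSymm x₀ x₀ w)
      rw [← lagrangian_eq_legendre, hself, ContinuousLinearMap.comp_apply,
        chartD_chartDSymm (mem_chart_source E x₀)] at h4
      have h5 : p' (q.2 - w) ≤ ε := by
        refine (le_abs_self _).trans ((p'.le_opNorm _).trans ?_)
        calc ‖p'‖ * ‖q.2 - w‖ ≤ (R + 1) * (ε / (R + 1)) := by
              gcongr
              linarith
          _ = ε := mul_div_cancel₀ ε hR1.ne'
      rw [map_sub] at h5
      linarith
    · push Not at hR
      have h3 : ‖p'‖ ≤ ‖p‖ * C :=
        (ContinuousLinearMap.opNorm_comp_le _ _).trans (by gcongr; exact hq2.2)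
      have h4 := hB q.1 p
      have h5 : p' q.2 ≤ ‖p'‖ * (‖w‖ + 1) := by
        refine (le_abs_self _).trans ((p'.le_opNorm _).trans ?_)
        gcongr
        have := norm_le_norm_add_norm_sub' q.2 w
        linarith
      have h6 : (‖w‖ + 2) * ‖p'‖ ≤ C * (‖w‖ + 2) * ‖p‖ := by
        calc (‖w‖ + 2) * ‖p'‖ ≤ (‖w‖ + 2) * (‖p‖ * C) := by gcongr
          _ = _ := by ring
      have h7 : B - lagrangian H x₀ w ≤ R := le_max_right _ _
      linarith

theorem IsTonelli.continuousOn_lagrangian_coord (hH : IsTonelli H) (x₀ : M) :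
    ContinuousOn (fun q : M × E ↦ lagrangian H q.1 (chartDSymm x₀ q.1 q.2))
      ((chartAt E x₀).source ×ˢ univ) := by
  rintro ⟨y, u⟩ ⟨hy, -⟩
  refine ContinuousAt.continuousWithinAt ?_
  have h1 : ContinuousAt (fun q : M × E ↦ (q.1, chartD y q.1 (chartDSymm x₀ q.1 q.2))) (y, u) :=
    continuousAt_fst.prodMk (continuousAt_chartD_chartDSymm hy u)
  have h2 := hH.continuousAt_lagrangian_coord y (chartD y y (chartDSymm x₀ y u))
  refine (ContinuousAt.comp (x := (y, u)) h2 h1).congr ?_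
  filter_upwards [continuousAt_fst.preimage_mem_nhds (chart_source_mem_nhds E y)] with q hq
  simp only [Function.comp_apply]
  rw [chartDSymm_chartD hq]

end Hamiltonian

end Coordinates

/-! ### Curves in charts -/

section Curves

set_option linter.unusedSectionVars false

variable {E : Type*} [NormedAddCommGroup E] [NormedSpace ℝ E] [FiniteDimensional ℝ E]
  {M : Type*} [MetricSpace M] [ChartedSpace E M] [IsManifold 𝓘(ℝ, E) ∞ M]

theorem extChart_source_eq (x₀ : M) :
    (extChartAt 𝓘(ℝ, E) x₀).source = (chartAt E x₀).source := extChartAt_source _ _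

theorem extChart_symm_mem_source {x₀ : M} {a : E} (ha : a ∈ (extChartAt 𝓘(ℝ, E) x₀).target) :
    (extChartAt 𝓘(ℝ, E) x₀).symm a ∈ (chartAt E x₀).source := by
  rw [← extChart_source_eq]
  exact (extChartAt 𝓘(ℝ, E) x₀).map_target ha

/-- A curve in `M` has velocity `v` at time `s`. -/
abbrev HasVelocityAt (ξ : ℝ → M) (s : ℝ) (v : TangentSpace 𝓘(ℝ, E) (ξ s)) : Prop :=
  HasMFDerivAt 𝓘(ℝ, ℝ) 𝓘(ℝ, E) ξ s ((1 : ℝ →L[ℝ] ℝ).smulRight v)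

theorem hasMFDerivAt_extChart_symm {x₀ : M} {a : E} (ha : a ∈ (extChartAt 𝓘(ℝ, E) x₀).target) :
    HasMFDerivAt 𝓘(ℝ, E) 𝓘(ℝ, E) (extChartAt 𝓘(ℝ, E) x₀).symm a
      (show TangentSpace 𝓘(ℝ, E) a →L[ℝ] TangentSpace 𝓘(ℝ, E) ((extChartAt 𝓘(ℝ, E) x₀).symm a)
        from chartDSymm (E := E) x₀ ((extChartAt 𝓘(ℝ, E) x₀).symm a)) := by
  have h1 : MDifferentiableAt 𝓘(ℝ, E) 𝓘(ℝ, E) (extChartAt 𝓘(ℝ, E) x₀).symm a := by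
    have := mdifferentiableWithinAt_extChartAt_symm ha
    rwa [modelWithCornersSelf_coe, range_id, mdifferentiableWithinAt_univ] at this
  have h2 := TangentBundle.symmL_trivializationAt (I := 𝓘(ℝ, E)) (𝕜 := ℝ)
    (extChart_symm_mem_source ha)
  rw [(extChartAt 𝓘(ℝ, E) x₀).right_inv ha, modelWithCornersSelf_coe, range_id,
    mfderivWithin_univ] at h2
  have h3 := h1.hasMFDerivAt
  rw [← h2] at h3
  exact h3

theorem hasVelocityAt_extChart_symm_comp {x₀ : M} {c : ℝ → E} {c' : E} {s : ℝ}
    (hs : c s ∈ (extChartAt 𝓘(ℝ, E) x₀).target) (hc : HasDerivAt c c' s) :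
    HasVelocityAt (fun t ↦ (extChartAt 𝓘(ℝ, E) x₀).symm (c t)) s
      (chartDSymm x₀ ((extChartAt 𝓘(ℝ, E) x₀).symm (c s)) c') := by
  have h1 := (hasMFDerivAt_extChart_symm hs).comp s hc.hasFDerivAt.hasMFDerivAt
  refine h1.congr_mfderiv ?_
  refine ContinuousLinearMap.ext fun t ↦ ?_
  exact (chartDSymm x₀ ((extChartAt 𝓘(ℝ, E) x₀).symm (c s))).map_smul (t : ℝ) c'

theorem HasVelocityAt.hasDerivAt_extChart {x₀ : M} {ξ : ℝ → M} {s : ℝ}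
    {v : TangentSpace 𝓘(ℝ, E) (ξ s)} (hξ : HasVelocityAt ξ s v)
    (hs : ξ s ∈ (chartAt E x₀).source) :
    HasDerivAt (fun t ↦ extChartAt 𝓘(ℝ, E) x₀ (ξ t)) (chartD x₀ (ξ s) v) s := by
  have h1 := (mdifferentiableAt_extChartAt (I := 𝓘(ℝ, E)) hs).hasMFDerivAt
  rw [← chartD_eq_mfderiv hs] at h1
  have h2 : HasFDerivAt (fun t ↦ extChartAt 𝓘(ℝ, E) x₀ (ξ t))
    ((1 : ℝ →L[ℝ] ℝ).smulRight (chartD x₀ (ξ s) v)) s := by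
    refine ((h1.comp s hξ).congr_mfderiv ?_).hasFDerivAt
    refine ContinuousLinearMap.ext fun t ↦ ?_
    exact (chartD x₀ (ξ s)).map_smul (t : ℝ) v
  simpa using h2.hasDerivAt

theorem hasVelocityAt_of_hasDerivAt_extChart {x₀ : M} {ξ : ℝ → M} {s : ℝ} {u : E}
    (hξ : ContinuousAt ξ s) (hs : ξ s ∈ (chartAt E x₀).source)
    (hu : HasDerivAt (fun t ↦ extChartAt 𝓘(ℝ, E) x₀ (ξ t)) u s) :
    HasVelocityAt ξ s (chartDSymm x₀ (ξ s) u) := by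
  have hs' : ξ s ∈ (extChartAt 𝓘(ℝ, E) x₀).source := by rwa [extChart_source_eq]
  have h1 := hasVelocityAt_extChart_symm_comp ((extChartAt 𝓘(ℝ, E) x₀).map_source hs') hu
  have h2 : ξ =ᶠ[𝓝 s] fun t ↦ (extChartAt 𝓘(ℝ, E) x₀).symm (extChartAt 𝓘(ℝ, E) x₀ (ξ t)) := by
    filter_upwards [hξ.preimage_mem_nhds ((isOpen_extChartAt_source x₀).mem_nhds hs')] with t ht
    exact ((extChartAt 𝓘(ℝ, E) x₀).left_inv ht).symm
  have h3 := h1.congr_of_eventuallyEq h2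
  rw [(extChartAt 𝓘(ℝ, E) x₀).left_inv hs'] at h3
  exact h3

theorem HasVelocityAt.mfderiv_apply_one {ξ : ℝ → M} {s : ℝ}
    {v : TangentSpace 𝓘(ℝ, E) (ξ s)} (hξ : HasVelocityAt ξ s v) :
    mfderiv 𝓘(ℝ, ℝ) 𝓘(ℝ, E) ξ s (1 : ℝ) = v := by
  rw [hξ.mfderiv]
  exact one_smul ℝ v

theorem hasVelocityAt_mfderiv {ξ : ℝ → M} {s : ℝ}
    (hξ : MDifferentiableAt 𝓘(ℝ, ℝ) 𝓘(ℝ, E) ξ s) :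
    HasVelocityAt ξ s (mfderiv 𝓘(ℝ, ℝ) 𝓘(ℝ, E) ξ s (1 : ℝ)) := by
  refine hξ.hasMFDerivAt.congr_mfderiv (ContinuousLinearMap.ext fun t ↦ ?_)
  have h : ∀ r : ℝ, mfderiv 𝓘(ℝ, ℝ) 𝓘(ℝ, E) ξ s r =
      r • mfderiv 𝓘(ℝ, ℝ) 𝓘(ℝ, E) ξ s (1 : ℝ) := fun r ↦
    (congrArg (mfderiv 𝓘(ℝ, ℝ) 𝓘(ℝ, E) ξ s) (mul_one r).symm).trans
      ((mfderiv 𝓘(ℝ, ℝ) 𝓘(ℝ, E) ξ s).map_smul r (1 : ℝ))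
  exact h t

variable {H : ∀ x : M, CotSpace E x → ℝ}

theorem HasVelocityAt.lagrangianAlong_eq {ξ : ℝ → M} {s : ℝ}
    {v : TangentSpace 𝓘(ℝ, E) (ξ s)} (hξ : HasVelocityAt ξ s v) :
    lagrangianAlong H ξ s = lagrangian H (ξ s) v := by
  rw [lagrangianAlong, hξ.mfderiv_apply_one]

end Curves

/-! ### The Riemannian distance in charts -/

section Distance

set_option linter.unusedSectionVars false

open scoped NNReal ENNReal

variable {E : Type*} [NormedAddCommGroup E] [NormedSpace ℝ E] [FiniteDimensional ℝ E]
  {M : Type*} [MetricSpace M] [ChartedSpace E M] [IsManifold 𝓘(ℝ, E) ∞ M]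
  [RiemannianBundle (fun x : M ↦ TangentSpace 𝓘(ℝ, E) x)]

theorem enorm_le_coe_mul_enorm {V W : Type*} [NormedAddCommGroup V] [NormedAddCommGroup W]
    {v : V} {w : W} {K : ℝ≥0} (h : ‖v‖ ≤ K * ‖w‖) : ‖v‖ₑ ≤ K * ‖w‖ₑ := by
  rw [← ofReal_norm, ← ofReal_norm, ← ENNReal.ofReal_coe_nnreal,
    ← ENNReal.ofReal_mul K.coe_nonneg]
  exact ENNReal.ofReal_le_ofReal h

/-- Integrates the derivative of A composed with the chart along a path. The map A is general
because two choices matter: the identity for coarse bounds, and `chartDSymm x₀ y` to measure in the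
metric frozen at y. -/
theorem enorm_sub_le_mul_pathELength {x₀ : M} {F : Type*} [NormedAddCommGroup F] [NormedSpace ℝ F]
    (A : E →L[ℝ] F) {γ : ℝ → M} (hγ : ContMDiffOn 𝓘(ℝ, ℝ) 𝓘(ℝ, E) 1 γ (Icc 0 1))
    (hsrc : ∀ t ∈ Icc (0 : ℝ) 1, γ t ∈ (chartAt E x₀).source) {K : ℝ≥0}
    (hK : ∀ t ∈ Icc (0 : ℝ) 1, ∀ v, ‖A (chartD x₀ (γ t) v)‖ ≤ K * ‖v‖) :
    ‖A (extChartAt 𝓘(ℝ, E) x₀ (γ 1)) - A (extChartAt 𝓘(ℝ, E) x₀ (γ 0))‖ₑ ≤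
      K * pathELength 𝓘(ℝ, E) γ 0 1 := by
  have h1 : ContDiffOn ℝ 1 (fun t ↦ A (extChartAt 𝓘(ℝ, E) x₀ (γ t))) (Icc 0 1) := by
    refine A.contDiff.comp_contDiffOn ?_
    exact contMDiffOn_iff_contDiffOn.1
      ((contMDiffOn_extChartAt (I := 𝓘(ℝ, E)) (x := x₀)).comp hγ hsrc)
  refine (enorm_sub_le_lintegral_derivWithin_Icc_of_contDiffOn_Icc h1 zero_le_one).trans ?_
  rw [pathELength_eq_lintegral_mfderiv_Ioo, ← restrict_Ioo_eq_restrict_Icc,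
    ← lintegral_const_mul' _ _ ENNReal.coe_ne_top]
  refine setLIntegral_mono' measurableSet_Ioo fun t ht ↦ ?_
  have ht' : t ∈ Icc (0 : ℝ) 1 := Ioo_subset_Icc_self ht
  have h2 : MDifferentiableAt 𝓘(ℝ, ℝ) 𝓘(ℝ, E) γ t :=
    ((hγ.mdifferentiableOn one_ne_zero) t ht').mdifferentiableAt (Icc_mem_nhds ht.1 ht.2)
  have h3 := (hasVelocityAt_mfderiv h2).hasDerivAt_extChart (x₀ := x₀) (hsrc t ht')
  have h4 := A.hasFDerivAt.comp_hasDerivAt t h3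
  have h5 : derivWithin (fun t ↦ A (extChartAt 𝓘(ℝ, E) x₀ (γ t))) (Icc 0 1) t =
      A (chartD x₀ (γ t) (mfderiv 𝓘(ℝ, ℝ) 𝓘(ℝ, E) γ t (1 : ℝ))) := by
    rw [derivWithin_of_mem_nhds (Icc_mem_nhds ht.1 ht.2)]
    exact h4.deriv
  rw [h5]
  have h6 := hK t ht' (mfderiv 𝓘(ℝ, ℝ) 𝓘(ℝ, E) γ t (1 : ℝ))
  exact enorm_le_coe_mul_enorm h6

variable [IsRiemannianManifold 𝓘(ℝ, E) M]

theorem dist_lt_of_pathELength_lt {γ : ℝ → M}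
    (hγ : ContMDiffOn 𝓘(ℝ, ℝ) 𝓘(ℝ, E) 1 γ (Icc 0 1)) {r : ℝ}
    (hr : pathELength 𝓘(ℝ, E) γ 0 1 < ENNReal.ofReal r) {s t : ℝ} (hs : 0 ≤ s) (hst : s ≤ t)
    (ht : t ≤ 1) : dist (γ s) (γ t) < r := by
  have h1 : edist (γ s) (γ t) ≤ pathELength 𝓘(ℝ, E) γ s t := by
    rw [IsRiemannianManifold.out (I := 𝓘(ℝ, E)) (γ s) (γ t)]
    exact riemannianEDist_le_pathELength (hγ.mono (Icc_subset_Icc hs ht)) rfl rfl hst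
  have h2 := (h1.trans (pathELength_mono hs ht)).trans_lt hr
  rw [edist_dist] at h2
  exact (ENNReal.ofReal_lt_ofReal_iff_of_nonneg dist_nonneg).1 h2

/-- A path from y of length less than ℓ < r stays in the ball where the bound K is valid; let ℓ
decrease to the distance. -/
theorem norm_sub_le_mul_dist {x₀ y z : M} {F : Type*} [NormedAddCommGroup F] [NormedSpace ℝ F]
    (A : E →L[ℝ] F) {r K : ℝ} (hK0 : 0 ≤ K) (hsrc : Metric.ball y r ⊆ (chartAt E x₀).source)
    (hK : ∀ w ∈ Metric.ball y r, ∀ v, ‖A (chartD x₀ w v)‖ ≤ K * ‖v‖) (hz : dist y z < r) :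
    ‖A (extChartAt 𝓘(ℝ, E) x₀ z) - A (extChartAt 𝓘(ℝ, E) x₀ y)‖ ≤ K * dist y z := by
  lift K to ℝ≥0 using hK0
  suffices h : ∀ ℓ, dist y z < ℓ → ℓ < r →
      ‖A (extChartAt 𝓘(ℝ, E) x₀ z) - A (extChartAt 𝓘(ℝ, E) x₀ y)‖ ≤ K * ℓ by
    have hlim : Tendsto (fun ℓ : ℝ ↦ (K : ℝ) * ℓ) (𝓝[>] (dist y z)) (𝓝 (K * dist y z)) :=
      ((continuous_const.mul continuous_id).tendsto _).mono_left nhdsWithin_le_nhds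
    refine ge_of_tendsto hlim ?_
    filter_upwards [Ioo_mem_nhdsGT hz] with ℓ hℓ using h ℓ hℓ.1 hℓ.2
  intro ℓ hℓ hℓr
  have h1 : riemannianEDist 𝓘(ℝ, E) y z < ENNReal.ofReal ℓ := by
    rw [← IsRiemannianManifold.out, edist_dist]
    exact (ENNReal.ofReal_lt_ofReal_iff_of_nonneg dist_nonneg).2 hℓ
  obtain ⟨γ, h0, h1, hγ, hlen⟩ := exists_lt_of_riemannianEDist_lt h1
  have hball : ∀ t ∈ Icc (0 : ℝ) 1, γ t ∈ Metric.ball y r := fun t ht ↦ by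
    rw [Metric.mem_ball, dist_comm, ← h0]
    exact (dist_lt_of_pathELength_lt hγ hlen le_rfl ht.1 ht.2).trans hℓr
  have h2 := enorm_sub_le_mul_pathELength (x₀ := x₀) A hγ (fun t ht ↦ hsrc (hball t ht))
    (fun t ht ↦ hK _ (hball t ht))
  rw [h0, h1] at h2
  have h3 := h2.trans (mul_le_mul_right hlen.le (K : ℝ≥0∞))
  rw [← ENNReal.ofReal_coe_nnreal, ← ENNReal.ofReal_mul K.coe_nonneg, ← ofReal_norm] at h3
  exact (ENNReal.ofReal_le_ofReal_iff (mul_nonneg K.coe_nonneg (dist_nonneg.trans hℓ.le))).1 h3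

theorem dist_extChart_symm_le {x₀ : M} {a b : E} {K : ℝ} (hK0 : 0 ≤ K)
    (hseg : segment ℝ a b ⊆ (extChartAt 𝓘(ℝ, E) x₀).target)
    (hK : ∀ c ∈ segment ℝ a b,
      ‖chartDSymm x₀ ((extChartAt 𝓘(ℝ, E) x₀).symm c) (b - a)‖ ≤ K) :
    dist ((extChartAt 𝓘(ℝ, E) x₀).symm a) ((extChartAt 𝓘(ℝ, E) x₀).symm b) ≤ K := by
  set c : ℝ → E := fun t ↦ a + t • (b - a) with hc
  have hcd : ContDiff ℝ 1 c := by fun_prop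
  have hcs : ∀ t ∈ Icc (0 : ℝ) 1, c t ∈ segment ℝ a b := fun t ht ↦ by
    rw [segment_eq_image']
    exact ⟨t, ht, rfl⟩
  have hder : ∀ t, HasDerivAt c (b - a) t := fun t ↦ by
    simpa [hc] using ((hasDerivAt_id t).smul_const (b - a)).const_add a
  have hsm : ContMDiffOn 𝓘(ℝ, ℝ) 𝓘(ℝ, E) 1
      (fun t ↦ (extChartAt 𝓘(ℝ, E) x₀).symm (c t)) (Icc 0 1) :=
    (contMDiffOn_extChartAt_symm x₀).comp hcd.contMDiff.contMDiffOn
      fun t ht ↦ hseg (hcs t ht)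
  have h1 := riemannianEDist_le_pathELength hsm rfl rfl zero_le_one
  rw [← IsRiemannianManifold.out, edist_dist] at h1
  simp only [hc, zero_smul, add_zero, one_smul, add_sub_cancel] at h1
  have h2 : pathELength 𝓘(ℝ, E) (fun t ↦ (extChartAt 𝓘(ℝ, E) x₀).symm (c t)) 0 1 ≤
      ENNReal.ofReal K := by
    rw [pathELength_eq_lintegral_mfderiv_Icc]
    calc _ ≤ ∫⁻ _ in Icc (0 : ℝ) 1, ENNReal.ofReal K := by
          refine setLIntegral_mono' measurableSet_Icc fun t ht ↦ ?_
          refine le_of_eq_of_le (congrArg enorm (hasVelocityAt_extChart_symm_comp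
            (hseg (hcs t ht)) (hder t)).mfderiv_apply_one) ?_
          rw [← ofReal_norm]
          exact ENNReal.ofReal_le_ofReal (hK _ (hcs t ht))
      _ = _ := by simp
  exact (ENNReal.ofReal_le_ofReal_iff hK0).1 (h1.trans h2)

end Distance

/-! ### Comparison of the metric and the distance with a chart, up to factors 1 + O(distance) -/

section ChartEstimates

set_option linter.unusedSectionVars false

open scoped NNReal ENNReal

variable {E : Type*} [NormedAddCommGroup E] [NormedSpace ℝ E] [FiniteDimensional ℝ E]
  {M : Type*} [MetricSpace M] [ChartedSpace E M] [IsManifold 𝓘(ℝ, E) ∞ M]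
  [RiemannianBundle (fun x : M ↦ TangentSpace 𝓘(ℝ, E) x)]
  [IsContMDiffRiemannianBundle 𝓘(ℝ, E) ∞ E (fun x : M ↦ TangentSpace 𝓘(ℝ, E) x)]

theorem norm_chartD_apply_le (x₀ y : M) (v : TangentSpace 𝓘(ℝ, E) y) :
    ‖chartD x₀ y v‖ ≤ ‖chartD (E := E) x₀ y‖ * ‖v‖ :=
  ContinuousLinearMap.le_opNorm (E := TangentSpace 𝓘(ℝ, E) y) (F := E) _ v

theorem norm_chartDSymm_apply_le (x₀ y : M) (u : E) :
    ‖chartDSymm x₀ y u‖ ≤ ‖chartDSymm (E := E) x₀ y‖ * ‖u‖ :=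
  ContinuousLinearMap.le_opNorm (E := E) (F := TangentSpace 𝓘(ℝ, E) y) _ u

-- The coefficients of the metric are C¹ in the chart, hence Lipschitz near x₀. This is the source
-- of the factors 1 + C d in `ChartBounds`.
set_option synthInstance.maxHeartbeats 200000 in
theorem exists_lipschitz_metric_coord (x₀ : M) :
    ∃ G : M → E →L[ℝ] E →L[ℝ] ℝ, ∃ K > 0, ∃ U ∈ 𝓝 x₀,
      (∀ y ∈ U, ∀ u, ‖chartDSymm x₀ y u‖ ^ 2 = G y u u) ∧
      ∀ y ∈ U, ∀ z ∈ U,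
        ‖G y - G z‖ ≤ K * ‖extChartAt 𝓘(ℝ, E) x₀ y - extChartAt 𝓘(ℝ, E) x₀ z‖ := by
  obtain ⟨g, hg, hg'⟩ := IsContMDiffRiemannianBundle.exists_contMDiff (IB := 𝓘(ℝ, E)) (n := 1)
      (F := E) (E := fun x : M ↦ TangentSpace 𝓘(ℝ, E) x)
  set e := extChartAt 𝓘(ℝ, E) x₀
  set G : M → E →L[ℝ] E →L[ℝ] ℝ := fun y ↦ ContinuousLinearMap.inCoordinates E
    (fun x : M ↦ TangentSpace 𝓘(ℝ, E) x) (E →L[ℝ] ℝ)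
    (fun x : M ↦ TangentSpace 𝓘(ℝ, E) x →L[ℝ] ℝ) x₀ y x₀ y (g y) with hG
  have h1 : ContMDiffAt 𝓘(ℝ, E) 𝓘(ℝ, E →L[ℝ] E →L[ℝ] ℝ) 1 G x₀ :=
    ((contMDiffAt_hom_bundle _).1 (hg x₀)).2
  have h2 : ContDiffAt ℝ 1 (fun a ↦ G (e.symm a)) (e x₀) := by
    rw [← contMDiffAt_iff_contDiffAt]
    refine ContMDiffAt.comp_of_eq (y := x₀) h1 ?_ (by simp [e])
    exact (contMDiffOn_extChartAt_symm x₀).contMDiffAt (extChartAt_target_mem_nhds x₀)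
  obtain ⟨K, t, ht, hKt⟩ := h2.exists_lipschitzOnWith
  refine ⟨G, K + 1, by positivity, e ⁻¹' t ∩ (chartAt E x₀).source,
    inter_mem ((continuousAt_extChartAt x₀).preimage_mem_nhds ht) (chart_source_mem_nhds E x₀),
    ?_, ?_⟩
  · rintro y ⟨-, hy⟩ u
    have hy' : y ∈ (trivializationAt E (TangentSpace 𝓘(ℝ, E)) x₀).baseSet := by
      simpa using hy
    have h3 : G y u u = g y (chartDSymm x₀ y u) (chartDSymm x₀ y u) := by
      have h4 := inCoordinates_apply_eq₂ (F₁ := E) (F₂ := E) (F₃ := ℝ)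
        (E₁ := fun x : M ↦ TangentSpace 𝓘(ℝ, E) x)
        (E₂ := fun x : M ↦ TangentSpace 𝓘(ℝ, E) x) (E₃ := Bundle.Trivial M ℝ)
        (ϕ := g y) (v := u) (w := u) hy' hy' (mem_univ _)
      rw [chartDSymm, Trivialization.symmL_apply _ hy']
      refine h4.trans ?_
      simp
    rw [h3, ← hg', real_inner_self_eq_norm_sq]
  · rintro y ⟨hy, hys⟩ z ⟨hz, hzs⟩
    have h3 := hKt.dist_le_mul _ hy _ hz
    rw [← extChart_source_eq (E := E)] at hys hzs
    simp only [dist_eq_norm] at h3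
    rw [e.left_inv hys, e.left_inv hzs] at h3
    refine h3.trans ?_
    gcongr
    linarith

/-- Bounds for the distance and the metric in the preferred chart at `x₀`, valid on the ball of
radius `ρ`. -/
structure ChartBounds (E : Type*) [NormedAddCommGroup E] [NormedSpace ℝ E]
    {M : Type*} [MetricSpace M] [ChartedSpace E M] [IsManifold 𝓘(ℝ, E) ∞ M]
    [RiemannianBundle (fun x : M ↦ TangentSpace 𝓘(ℝ, E) x)] (x₀ : M) (ρ C : ℝ) : Prop where
  pos : 0 < ρ
  one_le : 1 ≤ C
  subset_source : Metric.ball x₀ ρ ⊆ (chartAt E x₀).source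
  norm_chartD : ∀ y ∈ Metric.ball x₀ ρ, ‖chartD (E := E) x₀ y‖ ≤ C
  norm_chartDSymm : ∀ y ∈ Metric.ball x₀ ρ, ‖chartDSymm (E := E) x₀ y‖ ≤ C
  norm_sub_le : ∀ y ∈ Metric.ball x₀ ρ, ∀ z ∈ Metric.ball x₀ ρ,
    ‖extChartAt 𝓘(ℝ, E) x₀ z - extChartAt 𝓘(ℝ, E) x₀ y‖ ≤ C * dist y z
  dist_le : ∀ y ∈ Metric.ball x₀ ρ, ∀ z ∈ Metric.ball x₀ ρ,
    dist y z ≤ C * ‖extChartAt 𝓘(ℝ, E) x₀ z - extChartAt 𝓘(ℝ, E) x₀ y‖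
  norm_chartDSymm_sub_le : ∀ y ∈ Metric.ball x₀ ρ, ∀ z ∈ Metric.ball x₀ ρ,
    ‖chartDSymm x₀ y (extChartAt 𝓘(ℝ, E) x₀ z - extChartAt 𝓘(ℝ, E) x₀ y)‖ ≤
      (1 + C * dist y z) * dist y z
  dist_le_norm_chartDSymm : ∀ y ∈ Metric.ball x₀ ρ, ∀ z ∈ Metric.ball x₀ ρ,
    dist y z ≤ (1 + C * dist y z) *
      ‖chartDSymm x₀ y (extChartAt 𝓘(ℝ, E) x₀ z - extChartAt 𝓘(ℝ, E) x₀ y)‖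
  norm_chartDSymm_le : ∀ y ∈ Metric.ball x₀ ρ, ∀ z ∈ Metric.ball x₀ ρ, ∀ u : E,
    ‖chartDSymm x₀ y u‖ ≤ (1 + C * dist y z) * ‖chartDSymm x₀ z u‖

theorem exists_norm_chartDSymm_le (x₀ : M) : ∃ K > 0, ∃ C > 0, ∃ ρ > 0,
    Metric.ball x₀ ρ ⊆ (chartAt E x₀).source ∧
    (∀ y ∈ Metric.ball x₀ ρ, ‖chartD (E := E) x₀ y‖ ≤ C ∧ ‖chartDSymm (E := E) x₀ y‖ ≤ C) ∧
    ∀ y ∈ Metric.ball x₀ ρ, ∀ z ∈ Metric.ball x₀ ρ, ∀ u : E,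
      ‖chartDSymm x₀ y u‖ ≤
        (1 + K * ‖extChartAt 𝓘(ℝ, E) x₀ y - extChartAt 𝓘(ℝ, E) x₀ z‖) * ‖chartDSymm x₀ z u‖ := by
  obtain ⟨G, K, hK, U, hU, hG, hGK⟩ := exists_lipschitz_metric_coord (E := E) x₀
  obtain ⟨C, hC, hCy⟩ := eventually_norm_chartD_le (E := E) x₀
  obtain ⟨ρ, hρ, hball⟩ := Metric.mem_nhds_iff.1
    (inter_mem (inter_mem hU hCy) (chart_source_mem_nhds E x₀))
  refine ⟨K * C ^ 2, by positivity, C, hC, ρ, hρ, fun y hy ↦ (hball hy).2,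
    fun y hy ↦ (hball hy).1.2, fun y hy z hz u ↦ ?_⟩
  obtain ⟨⟨hyU, -⟩, -⟩ := hball hy
  obtain ⟨⟨hzU, hzC⟩, hzs⟩ := hball hz
  set δ := ‖extChartAt 𝓘(ℝ, E) x₀ y - extChartAt 𝓘(ℝ, E) x₀ z‖
  have h1 : ‖u‖ ≤ C * ‖chartDSymm x₀ z u‖ := by
    have := norm_chartD_apply_le x₀ z (chartDSymm x₀ z u)
    rw [chartD_chartDSymm hzs] at this
    exact this.trans (by gcongr; exact hzC.1)
  have h2 : ‖chartDSymm x₀ y u‖ ^ 2 ≤ (1 + K * C ^ 2 * δ) * ‖chartDSymm x₀ z u‖ ^ 2 := by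
    have h3 : (G y - G z) u u ≤ K * δ * ‖u‖ * ‖u‖ :=
      (le_abs_self _).trans (((G y - G z).le_opNorm₂ u u).trans
        (by gcongr; exact hGK y hyU z hzU))
    have h4 : K * δ * ‖u‖ * ‖u‖ ≤
        K * δ * (C * ‖chartDSymm x₀ z u‖) * (C * ‖chartDSymm x₀ z u‖) := by gcongr
    rw [hG y hyU, hG z hzU] at *
    rw [sub_apply, sub_apply] at h3
    rw [← hG z hzU] at *
    nlinarith
  have h5 : 0 ≤ K * C ^ 2 * δ := by positivity
  -- A factor 1 + a on squares is enough, since 1 + a ≤ (1 + a)² for a ≥ 0.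
  refine le_of_sq_le_sq (h2.trans ?_) (by positivity)
  rw [mul_pow]
  gcongr
  nlinarith

variable [IsRiemannianManifold 𝓘(ℝ, E) M]

theorem exists_chartBounds (x₀ : M) : ∃ ρ C : ℝ, ChartBounds E x₀ ρ C := by
  obtain ⟨K, hK, C, hC, ρ, hρ, hsrc, hCy, hKy⟩ := exists_norm_chartDSymm_le (E := E) x₀
  set e := extChartAt 𝓘(ℝ, E) x₀ with he
  have hcoarse : ∀ y ∈ Metric.ball x₀ (ρ / 3), ∀ z ∈ Metric.ball x₀ (ρ / 3),
      ‖e z - e y‖ ≤ C * dist y z := by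
    intro y hy z hz
    rw [Metric.mem_ball] at hy hz
    have hsub : Metric.ball y (2 * ρ / 3) ⊆ Metric.ball x₀ ρ :=
      Metric.ball_subset_ball' (by linarith)
    refine norm_sub_le_mul_dist (ContinuousLinearMap.id ℝ E) hC.le (hsub.trans hsrc)
      (fun w hw v ↦ ?_) (r := 2 * ρ / 3) ?_
    · exact (norm_chartD_apply_le x₀ w v).trans (by gcongr; exact (hCy w (hsub hw)).1)
    · have := dist_triangle_right y z x₀
      linarith
  obtain ⟨r, hr, hrt⟩ : ∃ r > 0, Metric.ball (e x₀) r ⊆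
      e.target ∩ e.symm ⁻¹' (Metric.ball x₀ ρ) := by
    refine Metric.mem_nhds_iff.1 (inter_mem (extChartAt_target_mem_nhds x₀) ?_)
    refine (continuousAt_extChartAt_symm x₀).preimage_mem_nhds ?_
    simpa [he] using Metric.ball_mem_nhds x₀ hρ
  obtain ⟨ρ', hρ', hρ'r⟩ := Metric.mem_nhds_iff.1
    ((continuousAt_extChartAt (I := 𝓘(ℝ, E)) x₀).preimage_mem_nhds (Metric.ball_mem_nhds _ hr))
  -- Two points of the R-ball are at distance d < 2R, and the ball of radius 2d around either lies
  -- within 5R ≤ ρ / 3 of x₀, where the coarse bound holds. The bound by ρ' keeps chart segments in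
  -- the target.
  set R := min ρ' (ρ / 15) with hR
  have hR1 : R ≤ ρ' := min_le_left _ _
  have hR2 : R ≤ ρ / 15 := min_le_right _ _
  have hR0 : 0 < R := lt_min hρ' (by positivity)
  have hsmall : Metric.ball x₀ R ⊆ Metric.ball x₀ (ρ / 3) :=
    Metric.ball_subset_ball (by linarith)
  have hbig : Metric.ball x₀ R ⊆ Metric.ball x₀ ρ := Metric.ball_subset_ball (by linarith)
  have hseg : ∀ y ∈ Metric.ball x₀ R, ∀ z ∈ Metric.ball x₀ R,
      segment ℝ (e y) (e z) ⊆ Metric.ball (e x₀) r := fun y hy z hz ↦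
    (convex_ball _ _).segment_subset (hρ'r (Metric.ball_subset_ball hR1 hy))
      (hρ'r (Metric.ball_subset_ball hR1 hz))
  have hupper : ∀ y ∈ Metric.ball x₀ R, ∀ z ∈ Metric.ball x₀ R, ∀ B ≥ 0,
      (∀ c ∈ segment ℝ (e y) (e z), ‖chartDSymm x₀ (e.symm c) (e z - e y)‖ ≤ B) →
        dist y z ≤ B := by
    intro y hy z hz B hB hc
    have h1 := dist_extChart_symm_le (x₀ := x₀) hB
      ((hseg y hy z hz).trans (hrt.trans inter_subset_left)) hc
    rwa [e.left_inv (by rw [he, extChart_source_eq]; exact hsrc (hbig hy)),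
      e.left_inv (by rw [he, extChart_source_eq]; exact hsrc (hbig hz))] at h1
  have hD : 1 + C + 2 * K * C ≥ 2 * K * C := by linarith
  refine ⟨R, 1 + C + 2 * K * C, hR0, by nlinarith, hbig.trans hsrc,
    fun y hy ↦ (hCy y (hbig hy)).1.trans (by nlinarith),
    fun y hy ↦ (hCy y (hbig hy)).2.trans (by nlinarith),
    fun y hy z hz ↦ ?_, fun y hy z hz ↦ ?_, fun y hy z hz ↦ ?_, fun y hy z hz ↦ ?_,
    fun y hy z hz u ↦ ?_⟩
  · refine (hcoarse y (hsmall hy) z (hsmall hz)).trans ?_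
    gcongr
    nlinarith
  · refine hupper y hy z hz _ (by positivity) fun c hc ↦ ?_
    refine (ContinuousLinearMap.le_opNorm _ _).trans ?_
    gcongr
    exact (hCy _ (hrt (hseg y hy z hz hc)).2).2.trans (by nlinarith)
  · rcases eq_or_ne y z with rfl | hne
    · simp
    have hd : 0 < dist y z := dist_pos.2 hne
    have hd2 : dist y z < 2 * R := by
      have := dist_triangle_right y z x₀
      rw [Metric.mem_ball] at hy hz
      linarith
    have hsub : Metric.ball y (2 * dist y z) ⊆ Metric.ball x₀ (ρ / 3) :=
      Metric.ball_subset_ball' (by rw [Metric.mem_ball] at hy; linarith)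
    have hsub' : Metric.ball x₀ (ρ / 3) ⊆ Metric.ball x₀ ρ :=
      Metric.ball_subset_ball (by linarith)
    rw [map_sub]
    -- The chart difference is measured in the metric frozen at y, which within distance 2d of y
    -- exceeds the actual metric by a factor at most 1 + O(d).
    refine (norm_sub_le_mul_dist (F := TangentSpace 𝓘(ℝ, E) y)
      (K := 1 + K * (C * (2 * dist y z))) (chartDSymm x₀ y)
      (by positivity) ((hsub.trans hsub').trans hsrc) (fun w hw v ↦ ?_)
      (r := 2 * dist y z) (by linarith)).trans ?_
    · refine (hKy y (hbig hy) w (hsub' (hsub hw)) _).trans ?_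
      rw [chartDSymm_chartD (hsrc (hsub' (hsub hw)))]
      gcongr
      refine (hcoarse w (hsub hw) y (hsmall hy)).trans ?_
      gcongr
      exact (Metric.mem_ball.1 hw).le
    · refine mul_le_mul_of_nonneg_right ?_ hd.le
      nlinarith
  · refine hupper y hy z hz _ (by positivity) fun c hc ↦ ?_
    refine (hKy _ (hrt (hseg y hy z hz hc)).2 y (hbig hy) _).trans ?_
    refine mul_le_mul_of_nonneg_right ?_ (norm_nonneg _)
    have h1 : ‖e (e.symm c) - e y‖ ≤ ‖e z - e y‖ := by
      rw [e.right_inv (hrt (hseg y hy z hz hc)).1]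
      rw [segment_eq_image'] at hc
      obtain ⟨t, ht, rfl⟩ := hc
      rw [add_sub_cancel_left, norm_smul, Real.norm_of_nonneg ht.1]
      exact mul_le_of_le_one_left (norm_nonneg _) ht.2
    have h2 := h1.trans (hcoarse y (hsmall hy) z (hsmall hz))
    have h3 : 0 ≤ dist y z := dist_nonneg
    have h4 : K * ‖e (e.symm c) - e y‖ ≤ K * (C * dist y z) := by gcongr
    nlinarith [mul_nonneg hC.le h3, mul_nonneg (mul_nonneg hK.le hC.le) h3]
  · refine (hKy y (hbig hy) z (hbig hz) u).trans ?_
    refine mul_le_mul_of_nonneg_right ?_ (norm_nonneg _)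
    have h2 := hcoarse z (hsmall hz) y (hsmall hy)
    rw [dist_comm] at h2
    have h3 : 0 ≤ dist y z := dist_nonneg
    have h4 : K * ‖e y - e z‖ ≤ K * (C * dist y z) := by gcongr
    nlinarith [mul_nonneg hC.le h3, mul_nonneg (mul_nonneg hK.le hC.le) h3]

end ChartEstimates

/-! ### Minimizing geodesics -/

section Geodesics

set_option linter.unusedSectionVars false

open scoped NNReal ENNReal

variable {E : Type*} [NormedAddCommGroup E] [NormedSpace ℝ E] [FiniteDimensional ℝ E]
  {M : Type*} [MetricSpace M] [ChartedSpace E M] [IsManifold 𝓘(ℝ, E) ∞ M]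
  [RiemannianBundle (fun x : M ↦ TangentSpace 𝓘(ℝ, E) x)]

/-- If no piece exceeds its share of the distance, the triangle inequality through the times 0, s,
t, 1 forces equality. -/
theorem IsMinGeodesic.of_le {γ : ℝ → M}
    (h : ∀ s ∈ Icc (0 : ℝ) 1, ∀ t ∈ Icc (0 : ℝ) 1, s ≤ t →
      dist (γ s) (γ t) ≤ (t - s) * dist (γ 0) (γ 1)) : IsMinGeodesic γ := by
  have key : ∀ s ∈ Icc (0 : ℝ) 1, ∀ t ∈ Icc (0 : ℝ) 1, s ≤ t →
      dist (γ s) (γ t) = (t - s) * dist (γ 0) (γ 1) := by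
    intro s hs t ht hst
    refine le_antisymm (h s hs t ht hst) ?_
    have h1 := h 0 (by simp) s hs hs.1
    have h2 := h t ht 1 (by simp) ht.2
    have h3 := dist_triangle4 (γ 0) (γ s) (γ t) (γ 1)
    nlinarith
  intro s hs t ht
  rcases le_total s t with hst | hst
  · rw [key s hs t ht hst, abs_of_nonpos (by linarith)]
    ring
  · rw [dist_comm, key t ht s hs hst, abs_of_nonneg (by linarith)]

theorem IsMinGeodesic.dist_eq {γ : ℝ → M} (hγ : IsMinGeodesic γ) {s t : ℝ} (hs : 0 ≤ s)
    (hst : s ≤ t) (ht : t ≤ 1) : dist (γ s) (γ t) = (t - s) * dist (γ 0) (γ 1) := by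
  rw [hγ s ⟨hs, hst.trans ht⟩ t ⟨hs.trans hst, ht⟩, abs_of_nonpos (by linarith)]
  ring

variable [IsRiemannianManifold 𝓘(ℝ, E) M]

theorem dist_add_dist_add_dist_lt {γ : ℝ → M}
    (hγ : ContMDiffOn 𝓘(ℝ, ℝ) 𝓘(ℝ, E) 1 γ (Icc 0 1)) {r : ℝ}
    (hr : pathELength 𝓘(ℝ, E) γ 0 1 < ENNReal.ofReal r) {s t : ℝ} (hs : 0 ≤ s) (hst : s ≤ t)
    (ht : t ≤ 1) : dist (γ 0) (γ s) + dist (γ s) (γ t) + dist (γ t) (γ 1) < r := by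
  have h1 : ∀ a b, 0 ≤ a → a ≤ b → b ≤ 1 →
      ENNReal.ofReal (dist (γ a) (γ b)) ≤ pathELength 𝓘(ℝ, E) γ a b := fun a b ha hab hb ↦ by
    rw [← edist_dist, IsRiemannianManifold.out (I := 𝓘(ℝ, E)) (γ a) (γ b)]
    exact riemannianEDist_le_pathELength (hγ.mono (Icc_subset_Icc ha hb)) rfl rfl hab
  rw [← pathELength_add hs (hst.trans ht), ← pathELength_add hst ht, ← add_assoc] at hr
  have h2 := (add_le_add (add_le_add (h1 0 s le_rfl hs (hst.trans ht)) (h1 s t hs hst ht))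
    (h1 t 1 (hs.trans hst) ht le_rfl)).trans_lt hr
  rw [← ENNReal.ofReal_add dist_nonneg dist_nonneg,
    ← ENNReal.ofReal_add (by positivity) dist_nonneg] at h2
  exact (ENNReal.ofReal_lt_ofReal_iff_of_nonneg (by positivity)).1 h2

/-- A nearly shortest path is reparametrized by the first time T s at which the distance from x
reaches s d(x,y). The length has only ε to spare, so the points at T s and T t are at most (t - s)
d(x,y) + ε apart. -/
theorem exists_almost_geodesic (E : Type*) [NormedAddCommGroup E] [NormedSpace ℝ E]
    [FiniteDimensional ℝ E] {M : Type*} [MetricSpace M] [ChartedSpace E M]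
    [IsManifold 𝓘(ℝ, E) ∞ M] [RiemannianBundle (fun x : M ↦ TangentSpace 𝓘(ℝ, E) x)]
    [IsRiemannianManifold 𝓘(ℝ, E) M] (x y : M) {ε : ℝ} (hε : 0 < ε) :
    ∃ γ : ℝ → M, γ 0 = x ∧ dist (γ 1) y ≤ ε ∧ ∀ s ∈ Icc (0 : ℝ) 1, ∀ t ∈ Icc (0 : ℝ) 1, s ≤ t →
      dist (γ s) (γ t) ≤ (t - s) * dist x y + ε := by
  have h1 : riemannianEDist 𝓘(ℝ, E) x y < ENNReal.ofReal (dist x y + ε) := by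
    rw [← IsRiemannianManifold.out, edist_dist]
    exact (ENNReal.ofReal_lt_ofReal_iff_of_nonneg dist_nonneg).2 (by linarith)
  obtain ⟨c, h0, h1, hc, hlen⟩ := exists_lt_of_riemannianEDist_lt h1
  have hcont : ContinuousOn (fun t ↦ dist x (c t)) (Icc 0 1) :=
    (continuous_const.dist continuous_id).comp_continuousOn hc.continuousOn
  have hcpt : ∀ s, IsCompact (Icc (0 : ℝ) 1 ∩ (fun t ↦ dist x (c t)) ⁻¹' Ici (s * dist x y)) :=
    fun s ↦ isCompact_Icc.of_isClosed_subset
      (hcont.preimage_isClosed_of_isClosed isClosed_Icc isClosed_Ici) inter_subset_left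
  have hne : ∀ s ∈ Icc (0 : ℝ) 1,
      (Icc (0 : ℝ) 1 ∩ (fun t ↦ dist x (c t)) ⁻¹' Ici (s * dist x y)).Nonempty := fun s hs ↦
    ⟨1, by simp, by
      simp only [mem_preimage, mem_Ici, h1]
      exact mul_le_of_le_one_left dist_nonneg hs.2⟩
  have hT : ∀ s, ∃ T, s ∈ Icc (0 : ℝ) 1 →
      IsLeast (Icc (0 : ℝ) 1 ∩ (fun t ↦ dist x (c t)) ⁻¹' Ici (s * dist x y)) T := fun s ↦ by
    by_cases hs : s ∈ Icc (0 : ℝ) 1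
    · obtain ⟨T, hT⟩ := (hcpt s).exists_isLeast (hne s hs)
      exact ⟨T, fun _ ↦ hT⟩
    · exact ⟨0, fun h ↦ absurd h hs⟩
  choose T hT using hT
  have hTI : ∀ s ∈ Icc (0 : ℝ) 1, T s ∈ Icc (0 : ℝ) 1 := fun s hs ↦ (hT s hs).1.1
  have hTeq : ∀ s ∈ Icc (0 : ℝ) 1, dist x (c (T s)) = s * dist x y := by
    intro s hs
    refine le_antisymm ?_ (hT s hs).1.2
    obtain ⟨t, ht, hts⟩ := intermediate_value_Icc (hTI s hs).1
      (hcont.mono (Icc_subset_Icc_right (hTI s hs).2))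
      (show s * dist x y ∈ Icc (dist x (c 0)) (dist x (c (T s))) from
        ⟨by simpa [h0] using mul_nonneg hs.1 dist_nonneg, (hT s hs).1.2⟩)
    have h3 := (hT s hs).2 ⟨⟨ht.1, ht.2.trans (hTI s hs).2⟩, hts.ge⟩
    have h4 : t = T s := le_antisymm ht.2 h3
    rw [← h4]
    exact hts.le
  have hmono : ∀ s ∈ Icc (0 : ℝ) 1, ∀ t ∈ Icc (0 : ℝ) 1, s ≤ t → T s ≤ T t := by
    intro s hs t ht hst
    refine (hT s hs).2 ⟨hTI t ht, ?_⟩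
    have : s * dist x y ≤ t * dist x y := by gcongr
    exact this.trans (hT t ht).1.2
  have hmain : ∀ s ∈ Icc (0 : ℝ) 1, ∀ t ∈ Icc (0 : ℝ) 1, s ≤ t →
      dist x (c (T s)) + dist (c (T s)) (c (T t)) + dist (c (T t)) y < dist x y + ε := by
    intro s hs t ht hst
    have := dist_add_dist_add_dist_lt hc hlen (hTI s hs).1 (hmono s hs t ht hst) (hTI t ht).2
    rwa [h0, h1] at this
  refine ⟨fun s ↦ c (T s), ?_, ?_, fun s hs t ht hst ↦ ?_⟩
  · have := hTeq 0 (by simp)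
    rw [zero_mul] at this
    exact (dist_eq_zero.1 this).symm
  · have h2 := hmain 1 (by simp) 1 (by simp) le_rfl
    rw [hTeq 1 (by simp), dist_self] at h2
    simp only
    linarith
  · have h2 := hmain s hs t ht hst
    have h3 := dist_triangle x (c (T t)) y
    rw [hTeq s hs] at h2
    rw [hTeq t ht] at h3
    simp only
    linarith

/-- Pointwise limits of almost geodesics along an ultrafilter exist by compactness and preserve the
distance inequalities, so no equicontinuity argument is needed. -/
theorem exists_isMinGeodesic (E : Type*) [NormedAddCommGroup E] [NormedSpace ℝ E]
    [FiniteDimensional ℝ E] {M : Type*} [MetricSpace M] [ChartedSpace E M]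
    [IsManifold 𝓘(ℝ, E) ∞ M] [RiemannianBundle (fun x : M ↦ TangentSpace 𝓘(ℝ, E) x)]
    [IsRiemannianManifold 𝓘(ℝ, E) M]
    [CompactSpace M] (x y : M) :
    ∃ γ : ℝ → M, IsMinGeodesic γ ∧ γ 0 = x ∧ γ 1 = y := by
  have h : ∀ n : ℕ, (0 : ℝ) < 1 / ((n : ℝ) + 1) := fun n ↦ by positivity
  choose c h0 h1 hc using fun n ↦ exists_almost_geodesic E x y (h n)
  have hlim : ∀ s, ∃ p, Tendsto (fun n ↦ c n s) (hyperfilter ℕ) (𝓝 p) := fun s ↦ by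
    obtain ⟨p, -, hp⟩ := isCompact_univ.ultrafilter_le_nhds
      ((hyperfilter ℕ).map fun n ↦ c n s) (by simp)
    exact ⟨p, hp⟩
  choose γ hγ using hlim
  have hε : Tendsto (fun n : ℕ ↦ 1 / ((n : ℝ) + 1)) (hyperfilter ℕ) (𝓝 0) :=
    tendsto_one_div_add_atTop_nhds_zero_nat.mono_left Nat.hyperfilter_le_atTop
  have hγ0 : γ 0 = x := tendsto_nhds_unique (hγ 0) (by simp [h0])
  have hγ1 : γ 1 = y := by
    have h2 : Tendsto (fun n ↦ dist (c n 1) y) (hyperfilter ℕ) (𝓝 (dist (γ 1) y)) :=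
      (hγ 1).dist tendsto_const_nhds
    exact dist_le_zero.1 (le_of_tendsto_of_tendsto' h2 hε h1)
  refine ⟨γ, IsMinGeodesic.of_le fun s hs t ht hst ↦ ?_, hγ0, hγ1⟩
  rw [hγ0, hγ1]
  have h2 : Tendsto (fun n : ℕ ↦ (t - s) * dist x y + 1 / ((n : ℝ) + 1)) (hyperfilter ℕ)
      (𝓝 ((t - s) * dist x y)) := by simpa using hε.const_add ((t - s) * dist x y)
  exact le_of_tendsto_of_tendsto' ((hγ s).dist (hγ t)) h2 fun n ↦ hc n s hs t ht hst

end Geodesics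

/-! ### Minimizing geodesics are almost straight in charts -/

section Deviation

set_option linter.unusedSectionVars false

variable {E : Type*} [NormedAddCommGroup E] [NormedSpace ℝ E] [FiniteDimensional ℝ E]
  {M : Type*} [MetricSpace M] [ChartedSpace E M] [IsManifold 𝓘(ℝ, E) ∞ M]
  [RiemannianBundle (fun x : M ↦ TangentSpace 𝓘(ℝ, E) x)]
  [IsContMDiffRiemannianBundle 𝓘(ℝ, E) ∞ E (fun x : M ↦ TangentSpace 𝓘(ℝ, E) x)]

/-- Stewart's identity: distances to the two ends of a segment determine the distance to a point
dividing it. -/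
theorem norm_sub_smul_sq {V : Type*} [NormedAddCommGroup V] [InnerProductSpace ℝ V] (u w : V)
    (s : ℝ) : ‖u - s • w‖ ^ 2 = (1 - s) * ‖u‖ ^ 2 + s * ‖u - w‖ ^ 2 - s * (1 - s) * ‖w‖ ^ 2 := by
  rw [norm_sub_sq_real, norm_sub_sq_real, norm_smul, inner_smul_right, mul_pow,
    Real.norm_eq_abs, sq_abs]
  ring

/-- For x = 0 the terms of Stewart's identity cancel. Relative errors of order x leave at most (15 +
2) x s(1 - s) D², and s(1 - s) ≤ 1/4. -/
theorem stewart_error_le {s D x a b c : ℝ} (hs : 0 ≤ s) (hs1 : s ≤ 1) (hD : 0 ≤ D) (hx : 0 ≤ x)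
    (hx1 : x ≤ 1) (ha0 : 0 ≤ a) (ha : a ≤ (1 + x) * (s * D)) (hb0 : 0 ≤ b)
    (hb : b ≤ (1 + x) ^ 2 * ((1 - s) * D)) (hc : D ≤ (1 + x) * c) :
    (1 - s) * a ^ 2 + s * b ^ 2 - s * (1 - s) * c ^ 2 ≤ 5 * x * D ^ 2 := by
  have h1s : 0 ≤ 1 - s := by linarith
  have h4 : (1 + x) ^ 4 ≤ 1 + 15 * x := by nlinarith [pow_nonneg hx 2, pow_nonneg hx 3]
  have h2 : (1 + x) ^ 2 ≤ (1 + x) ^ 4 := pow_le_pow_right₀ (by linarith) (by norm_num)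
  have ha2 : a ^ 2 ≤ (1 + 15 * x) * (s * D) ^ 2 := by
    calc a ^ 2 ≤ ((1 + x) * (s * D)) ^ 2 := by gcongr
      _ = (1 + x) ^ 2 * (s * D) ^ 2 := by ring
      _ ≤ _ := by gcongr; linarith
  have hb2 : b ^ 2 ≤ (1 + 15 * x) * ((1 - s) * D) ^ 2 := by
    calc b ^ 2 ≤ ((1 + x) ^ 2 * ((1 - s) * D)) ^ 2 := by gcongr
      _ = (1 + x) ^ 4 * ((1 - s) * D) ^ 2 := by ring
      _ ≤ _ := by gcongr
  have hc2 : (1 - 2 * x) * D ^ 2 ≤ c ^ 2 := by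
    have h5 : D ^ 2 ≤ (1 + x) ^ 2 * c ^ 2 := by
      rw [← mul_pow]
      gcongr
    by_cases h6 : 1 - 2 * x ≤ 0
    · nlinarith [sq_nonneg D, sq_nonneg c]
    · have h7 : (1 - 2 * x) * (1 + x) ^ 2 ≤ 1 := by nlinarith [pow_nonneg hx 2, pow_nonneg hx 3]
      nlinarith [sq_nonneg c]
  have hss : s * (1 - s) ≤ 1 / 4 := by nlinarith [sq_nonneg (s - 1 / 2)]
  have hss0 : 0 ≤ s * (1 - s) := mul_nonneg hs h1s
  have e1 := mul_le_mul_of_nonneg_left ha2 h1s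
  have e2 := mul_le_mul_of_nonneg_left hb2 hs
  have e3 := mul_le_mul_of_nonneg_left hc2 hss0
  have e4 : s * (1 - s) * (17 * x * D ^ 2) ≤ 1 / 4 * (17 * x * D ^ 2) := by gcongr
  nlinarith [mul_nonneg hx (sq_nonneg D)]

namespace ChartBounds

variable {x₀ : M} {ρ C : ℝ}

theorem norm_le_of_chartDSymm (h : ChartBounds E x₀ ρ C) {y : M} (hy : y ∈ Metric.ball x₀ ρ)
    (u : E) : ‖u‖ ≤ C * ‖chartDSymm x₀ y u‖ := by
  have := norm_chartD_apply_le x₀ y (chartDSymm x₀ y u)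
  rw [chartD_chartDSymm (h.subset_source hy)] at this
  exact this.trans (by gcongr; exact h.norm_chartD y hy)

/-- In the metric frozen at y, chart lengths equal distances up to factors 1 + O(D), so Stewart's
identity leaves a squared deviation of order D³. -/
theorem norm_sub_smul_le (h : ChartBounds E x₀ ρ C) {y m z : M} (hy : y ∈ Metric.ball x₀ ρ)
    (hm : m ∈ Metric.ball x₀ ρ) (hz : z ∈ Metric.ball x₀ ρ) {s : ℝ} (hs : 0 ≤ s) (hs1 : s ≤ 1)
    (hD : C * dist y z ≤ 1) (hym : dist y m = s * dist y z)
    (hmz : dist m z = (1 - s) * dist y z) :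
    ‖extChartAt 𝓘(ℝ, E) x₀ m - extChartAt 𝓘(ℝ, E) x₀ y -
      s • (extChartAt 𝓘(ℝ, E) x₀ z - extChartAt 𝓘(ℝ, E) x₀ y)‖ ≤
      3 * C ^ 2 * (dist y z * √(dist y z)) := by
  set e := extChartAt 𝓘(ℝ, E) x₀
  set D := dist y z
  have hC := h.one_le
  have hC0 : 0 ≤ C := by linarith
  have hD0 : 0 ≤ D := dist_nonneg
  have hx : 0 ≤ C * D := by positivity
  have hsD : s * D ≤ D := mul_le_of_le_one_left hD0 hs1
  have hsD' : (1 - s) * D ≤ D := mul_le_of_le_one_left hD0 (by linarith)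
  have ha := h.norm_chartDSymm_sub_le y hy m hm
  rw [hym] at ha
  replace ha := ha.trans (mul_le_mul_of_nonneg_right
    (by gcongr : 1 + C * (s * D) ≤ 1 + C * D) (by positivity))
  have hb : ‖chartDSymm x₀ y (e m - e y) - chartDSymm x₀ y (e z - e y)‖ ≤
      (1 + C * D) ^ 2 * ((1 - s) * D) := by
    rw [← map_sub, sub_sub_sub_cancel_right, ← neg_sub, map_neg, norm_neg]
    refine (h.norm_chartDSymm_le y hy m hm _).trans ?_
    have h1 := h.norm_chartDSymm_sub_le m hm z hz
    rw [hmz] at h1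
    rw [hym, pow_two, mul_assoc]
    have h2 : 0 ≤ (1 - s) * D := mul_nonneg (by linarith) hD0
    gcongr
    exact h1.trans (by gcongr)
  have hc := h.dist_le_norm_chartDSymm y hy z hz
  have hst := stewart_error_le hs hs1 hD0 hx hD (norm_nonneg _) ha (norm_nonneg _) hb hc
  rw [← norm_sub_smul_sq, ← map_smul, ← map_sub] at hst
  have h1 := h.norm_le_of_chartDSymm hy (e m - e y - s • (e z - e y))
  refine le_of_sq_le_sq ?_ (by positivity)
  calc ‖e m - e y - s • (e z - e y)‖ ^ 2
      ≤ (C * ‖chartDSymm x₀ y (e m - e y - s • (e z - e y))‖) ^ 2 := by gcongr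
    _ = C ^ 2 * ‖chartDSymm x₀ y (e m - e y - s • (e z - e y))‖ ^ 2 := by ring
    _ ≤ C ^ 2 * (5 * (C * D) * D ^ 2) := by gcongr
    _ ≤ 9 * C ^ 4 * D ^ 3 := by
        have h3 : C ^ 3 ≤ C ^ 4 := pow_le_pow_right₀ hC (by norm_num)
        have h4 : 0 ≤ C ^ 3 := by positivity
        have h5 : 0 ≤ D ^ 3 := by positivity
        nlinarith [mul_le_mul_of_nonneg_right h3 h5, mul_nonneg h4 h5]
    _ = (3 * C ^ 2 * (D * √D)) ^ 2 := by
        rw [mul_pow, mul_pow D, Real.sq_sqrt hD0]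
        ring

/-- A single application of Stewart's identity bounds the deviation without the factor t. Descending
from σ to σ / 2 until the scale of t is reached recovers it: each halving multiplies √σ by at most
3/4, and 24 = 24 * 3/4 + 6 closes the induction. The factor t matters because `exists_chart_le` is
later applied with s → 0 and divided by s. -/
theorem geodesic_deviation_aux (h : ChartBounds E x₀ ρ C) {γ : ℝ → M} (hγ : IsMinGeodesic γ)
    (hball : ∀ t ∈ Icc (0 : ℝ) 1, γ t ∈ Metric.ball x₀ ρ)
    (hD : C * dist (γ 0) (γ 1) ≤ 1) (n : ℕ) : ∀ σ t : ℝ, 0 < t → t ≤ σ → σ ≤ 1 → σ ≤ 2 ^ n * t →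
    ‖extChartAt 𝓘(ℝ, E) x₀ (γ t) - extChartAt 𝓘(ℝ, E) x₀ (γ 0) -
      (t / σ) • (extChartAt 𝓘(ℝ, E) x₀ (γ σ) - extChartAt 𝓘(ℝ, E) x₀ (γ 0))‖ ≤
      24 * C ^ 2 * t * √σ * (dist (γ 0) (γ 1) * √(dist (γ 0) (γ 1))) := by
  set e := extChartAt 𝓘(ℝ, E) x₀
  set D := dist (γ 0) (γ 1)
  have hC := h.one_le
  have hD0 : 0 ≤ D := dist_nonneg
  have hbase : ∀ σ t : ℝ, 0 < t → t ≤ σ → σ ≤ 1 →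
      ‖e (γ t) - e (γ 0) - (t / σ) • (e (γ σ) - e (γ 0))‖ ≤
        3 * C ^ 2 * σ * √σ * (D * √D) := by
    intro σ t ht htσ hσ
    have hσ0 : 0 < σ := ht.trans_le htσ
    have h1 : dist (γ 0) (γ σ) = σ * D := by rw [hγ.dist_eq le_rfl hσ0.le hσ, sub_zero]
    have h2 : dist (γ 0) (γ t) = t * D := by
      rw [hγ.dist_eq le_rfl ht.le (htσ.trans hσ), sub_zero]
    have h3 := hγ.dist_eq ht.le htσ hσ
    have h4 := h.norm_sub_smul_le (hball 0 (by simp)) (hball t ⟨ht.le, htσ.trans hσ⟩)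
      (hball σ ⟨hσ0.le, hσ⟩) (s := t / σ) (by positivity) ((div_le_one hσ0).2 htσ) (by
        rw [h1]
        exact (mul_le_mul_of_nonneg_left (mul_le_of_le_one_left hD0 hσ) (by linarith)).trans hD)
      (by rw [h1, h2]; field_simp) (by rw [h1, h3]; field_simp; rfl)
    rw [h1, Real.sqrt_mul hσ0.le] at h4
    refine h4.trans_eq (by ring)
  have hP : 0 ≤ D * √D := by positivity
  have hhalf : ∀ σ t : ℝ, 0 < t → t ≤ σ → σ ≤ 1 → σ ≤ 2 * t →
      ‖e (γ t) - e (γ 0) - (t / σ) • (e (γ σ) - e (γ 0))‖ ≤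
        6 * C ^ 2 * t * √σ * (D * √D) := by
    intro σ t ht htσ hσ h2
    refine (hbase σ t ht htσ hσ).trans ?_
    calc 3 * C ^ 2 * σ * √σ * (D * √D) ≤ 3 * C ^ 2 * (2 * t) * √σ * (D * √D) := by gcongr
      _ = _ := by ring
  induction n with
  | zero =>
    intro σ t ht htσ hσ h2
    refine (hhalf σ t ht htσ hσ (by linarith)).trans ?_
    gcongr
    norm_num
  | succ n ih =>
    intro σ t ht htσ hσ h2
    rcases le_or_gt σ (2 * t) with hle | hgt
    · refine (hhalf σ t ht htσ hσ hle).trans ?_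
      gcongr
      norm_num
    · have hσ0 : 0 < σ := ht.trans_le htσ
      have h3 := ih (σ / 2) t ht (by linarith) (by linarith) (by rw [pow_succ] at h2; linarith)
      have h4 := hhalf σ (σ / 2) (by linarith) (by linarith) hσ (by linarith)
      have hsq : √(σ / 2) ≤ 3 / 4 * √σ := by
        rw [show 3 / 4 * √σ = √((3 / 4) ^ 2 * σ) by
          rw [Real.sqrt_mul (by positivity), Real.sqrt_sq (by norm_num)]]
        exact Real.sqrt_le_sqrt (by linarith)
      have h5 : e (γ t) - e (γ 0) - (t / σ) • (e (γ σ) - e (γ 0)) =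
          (e (γ t) - e (γ 0) - (t / (σ / 2)) • (e (γ (σ / 2)) - e (γ 0))) +
          (t / (σ / 2)) • (e (γ (σ / 2)) - e (γ 0) - (σ / 2 / σ) • (e (γ σ) - e (γ 0))) := by
        have h6 : t / (σ / 2) * (σ / 2 / σ) = t / σ := by field_simp
        rw [smul_sub (t / (σ / 2)) (e (γ (σ / 2)) - e (γ 0)), smul_smul, h6]
        abel
      rw [h5]
      refine (norm_add_le _ _).trans ?_
      rw [norm_smul, Real.norm_of_nonneg (by positivity)]
      have h7 : t / (σ / 2) * ‖e (γ (σ / 2)) - e (γ 0) - (σ / 2 / σ) • (e (γ σ) - e (γ 0))‖ ≤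
          6 * C ^ 2 * t * √σ * (D * √D) := by
        calc _ ≤ t / (σ / 2) * (6 * C ^ 2 * (σ / 2) * √σ * (D * √D)) := by gcongr
          _ = _ := by field_simp
      have h8 : 24 * C ^ 2 * t * √(σ / 2) * (D * √D) ≤
          24 * C ^ 2 * t * (3 / 4 * √σ) * (D * √D) := by gcongr
      linarith

/-- A minimizing geodesic is close to a straight segment in the chart. -/
theorem geodesic_deviation (h : ChartBounds E x₀ ρ C) {γ : ℝ → M} (hγ : IsMinGeodesic γ)
    (hball : ∀ t ∈ Icc (0 : ℝ) 1, γ t ∈ Metric.ball x₀ ρ)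
    (hD : C * dist (γ 0) (γ 1) ≤ 1) {t : ℝ} (ht : t ∈ Icc (0 : ℝ) 1) :
    ‖extChartAt 𝓘(ℝ, E) x₀ (γ t) - extChartAt 𝓘(ℝ, E) x₀ (γ 0) -
      t • (extChartAt 𝓘(ℝ, E) x₀ (γ 1) - extChartAt 𝓘(ℝ, E) x₀ (γ 0))‖ ≤
      24 * C ^ 2 * t * (dist (γ 0) (γ 1) * √(dist (γ 0) (γ 1))) := by
  rcases ht.1.eq_or_lt with rfl | h0
  · simp
  obtain ⟨n, hn⟩ := pow_unbounded_of_one_lt t⁻¹ one_lt_two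
  have h1 : (1 : ℝ) ≤ 2 ^ n * t := by
    have := mul_le_mul_of_nonneg_right hn.le h0.le
    rwa [inv_mul_cancel₀ h0.ne'] at this
  simpa using h.geodesic_deviation_aux hγ hball hD n 1 t h0 ht.2 le_rfl h1

end ChartBounds

end Deviation

/-! ### Semiconcave functions in charts -/

section Semiconcave

set_option linter.unusedSectionVars false

variable {E : Type*} [NormedAddCommGroup E] [NormedSpace ℝ E] [FiniteDimensional ℝ E]
  {M : Type*} [MetricSpace M] [ChartedSpace E M] [IsManifold 𝓘(ℝ, E) ∞ M]
  [RiemannianBundle (fun x : M ↦ TangentSpace 𝓘(ℝ, E) x)]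
  [IsContMDiffRiemannianBundle 𝓘(ℝ, E) ∞ E (fun x : M ↦ TangentSpace 𝓘(ℝ, E) x)]
  [IsRiemannianManifold 𝓘(ℝ, E) M]

theorem exists_ball_extChart_symm_mem (x₀ : M) {s : Set M} (hs : s ∈ 𝓝 x₀) :
    ∃ r > 0, ∀ a ∈ Metric.ball (extChartAt 𝓘(ℝ, E) x₀ x₀) r,
      (extChartAt 𝓘(ℝ, E) x₀).symm a ∈ s ∧ a ∈ (extChartAt 𝓘(ℝ, E) x₀).target ∧
        extChartAt 𝓘(ℝ, E) x₀ ((extChartAt 𝓘(ℝ, E) x₀).symm a) = a := by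
  have h1 : (extChartAt 𝓘(ℝ, E) x₀).symm ⁻¹' s ∈ 𝓝 (extChartAt 𝓘(ℝ, E) x₀ x₀) :=
    (continuousAt_extChartAt_symm x₀).preimage_mem_nhds (by rwa [extChartAt_to_inv])
  obtain ⟨r, hr, h2⟩ := Metric.mem_nhds_iff.1 (inter_mem h1 (extChartAt_target_mem_nhds x₀))
  exact ⟨r, hr, fun a ha ↦ ⟨(h2 ha).1, (h2 ha).2, (extChartAt 𝓘(ℝ, E) x₀).right_inv (h2 ha).2⟩⟩

/-- A function on a compact space is locally Lipschitz from above if, from every point, one can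
halve the distance to a given nearby point while controlling the decrease of the function. -/
theorem sub_le_mul_dist_of_halving {X : Type*} [MetricSpace X] [CompactSpace X] {φ : X → ℝ}
    (hφ : Continuous φ) {b : X} {R K : ℝ} (hK : 0 ≤ K)
    (h : ∀ a, a ≠ b → dist a b ≤ R →
      ∃ c, dist c b ≤ dist a b / 2 ∧ φ a - K * dist a b ≤ φ c) {a : X}
    (ha : dist a b ≤ R) : φ a - φ b ≤ (2 * K + 1) * dist a b := by
  -- A maximizer m ≠ b of the penalized function would be beaten by its halved point c: the penalty
  -- drops by at least (K + 1/2) d(m,b), while φ loses at most K d(m,b).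
  obtain ⟨m, hm, hmax⟩ := (Metric.isClosed_closedBall (x := b) (ε := R)).isCompact.exists_isMaxOn
    ⟨a, ha⟩ (f := fun y ↦ φ y - (2 * K + 1) * dist y b) (by fun_prop)
  have h1 : φ a - (2 * K + 1) * dist a b ≤ φ m - (2 * K + 1) * dist m b := hmax ha
  rcases eq_or_ne m b with rfl | hmb
  · rw [dist_self] at h1
    linarith
  obtain ⟨c, hc, hφc⟩ := h m hmb hm
  have hd : 0 < dist m b := dist_pos.2 hmb
  have h2 : φ c - (2 * K + 1) * dist c b ≤ φ m - (2 * K + 1) * dist m b :=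
    hmax (show dist c b ≤ R by have : dist m b ≤ R := hm; linarith)
  have h3 : (2 * K + 1) * dist c b ≤ (2 * K + 1) * (dist m b / 2) := by gcongr
  nlinarith

theorem IsMinGeodesic.mem_ball {x₀ : M} {γ : ℝ → M} (hγ : IsMinGeodesic γ) {ρ : ℝ}
    (h : dist (γ 0) x₀ + dist (γ 0) (γ 1) < ρ) {t : ℝ} (ht : t ∈ Icc (0 : ℝ) 1) :
    γ t ∈ Metric.ball x₀ ρ := by
  have h1 := hγ.dist_eq le_rfl ht.1 ht.2
  have h2 : (t - 0) * dist (γ 0) (γ 1) ≤ dist (γ 0) (γ 1) :=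
    mul_le_of_le_one_left dist_nonneg (by linarith [ht.2])
  have h3 := dist_triangle_left (γ t) x₀ (γ 0)
  rw [Metric.mem_ball]
  linarith

/-- Prolong the chart segment from a through b to a point c at fixed chart distance r from a. The
geodesic from a to c passes so close to b that the distance to b is halved there, and semiconcavity
bounds φ from below at that point by φ a - K d(a,b). Then `sub_le_mul_dist_of_halving` applies. -/
theorem IsSemiconcave.exists_local_sub_le (E : Type*) [NormedAddCommGroup E] [NormedSpace ℝ E]
    [FiniteDimensional ℝ E] {M : Type*} [MetricSpace M] [ChartedSpace E M]
    [IsManifold 𝓘(ℝ, E) ∞ M] [RiemannianBundle (fun x : M ↦ TangentSpace 𝓘(ℝ, E) x)]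
    [IsContMDiffRiemannianBundle 𝓘(ℝ, E) ∞ E (fun x : M ↦ TangentSpace 𝓘(ℝ, E) x)]
    [IsRiemannianManifold 𝓘(ℝ, E) M] [CompactSpace M] {φ : M → ℝ} (hφ : IsSemiconcave φ)
    (x₀ : M) : ∃ R > 0, ∃ K ≥ 0, ∀ b ∈ Metric.ball x₀ R, ∀ a, dist a b ≤ R →
      φ a - φ b ≤ K * dist a b := by
  obtain ⟨hcont, S, hS, hsc⟩ := hφ
  obtain ⟨B, hB⟩ : ∃ B, ∀ y, |φ y| ≤ B := by
    obtain ⟨B, hB⟩ := isCompact_univ.exists_bound_of_continuousOn hcont.continuousOn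
    exact ⟨B, fun y ↦ hB y (mem_univ y)⟩
  obtain ⟨ρ, C, hC⟩ := exists_chartBounds (E := E) x₀
  set e := extChartAt 𝓘(ℝ, E) x₀ with he
  have hρ := hC.pos
  have h1C := hC.one_le
  have hC0 : 0 < C := by linarith
  obtain ⟨r₁, hr₁, hpt⟩ := exists_ball_extChart_symm_mem (E := E) x₀
    (Metric.ball_mem_nhds x₀ (half_pos hρ))
  -- The last condition is exactly what makes the deviation of the geodesic from b at most half of
  -- d(a,b).
  obtain ⟨r, hr, hrr, hrρ, hrC⟩ : ∃ r > 0, r ≤ r₁ / 3 ∧ C * r ≤ ρ / 2 ∧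
      48 * C ^ 5 * √(C * r) ≤ 1 := by
    have h1 : ∀ᶠ r : ℝ in 𝓝[>] 0, r ≤ r₁ / 3 := by
      refine nhdsWithin_le_nhds (Iic_mem_nhds ?_)
      positivity
    have h2 : ∀ᶠ r : ℝ in 𝓝[>] 0, C * r < ρ / 2 :=
      nhdsWithin_le_nhds ((show ContinuousAt (fun r : ℝ ↦ C * r) 0 by fun_prop).eventually_lt
        continuousAt_const (by simpa using hρ))
    have h3 : ∀ᶠ r : ℝ in 𝓝[>] 0, 48 * C ^ 5 * √(C * r) < 1 :=
      nhdsWithin_le_nhds ((show ContinuousAt (fun r : ℝ ↦ 48 * C ^ 5 * √(C * r)) 0 by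
        fun_prop).eventually_lt continuousAt_const (by simp))
    obtain ⟨r, hr, h1, h2, h3⟩ := (eventually_mem_nhdsWithin.and (h1.and (h2.and h3))).exists
    exact ⟨r, hr, h1, h2.le, h3.le⟩
  have hr2 : C * (C * r) ≤ 1 := by
    have h0 : 0 ≤ C * r := by positivity
    have h1 : (48 * C ^ 5 * √(C * r)) ^ 2 ≤ 1 := pow_le_one₀ (by positivity) hrC
    rw [mul_pow, Real.sq_sqrt h0] at h1
    have h2 : C ≤ (48 * C ^ 5) ^ 2 := by
      calc C = C ^ 1 := (pow_one C).symm
        _ ≤ C ^ 10 := pow_le_pow_right₀ h1C (by norm_num)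
        _ ≤ (48 * C ^ 5) ^ 2 := by nlinarith [pow_pos hC0 10]
    exact (mul_le_mul_of_nonneg_right h2 h0).trans h1
  set R := min (ρ / 4) (r / (2 * C)) with hR
  have hR0 : 0 < R := by positivity
  have hRρ : R ≤ ρ / 4 := min_le_left _ _
  have hRr : C * R ≤ r / 2 := by
    calc C * R ≤ C * (r / (2 * C)) := by gcongr; exact min_le_right _ _
      _ = r / 2 := by field_simp
  set K := C / r * (2 * B + S / 2 * (C * r) ^ 2) with hK
  have hB0 : 0 ≤ B := (abs_nonneg _).trans (hB x₀)
  have hK0 : 0 ≤ K := by positivity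
  refine ⟨R, hR0, 2 * K + 1, by positivity, fun b hb a hab ↦
    sub_le_mul_dist_of_halving hcont hK0 (fun a hne hab ↦ ?_) hab⟩
  have hb' : dist b x₀ < R := hb
  have hax : dist a x₀ < 2 * R := by linarith [dist_triangle a b x₀]
  have haρ : a ∈ Metric.ball x₀ ρ := by rw [Metric.mem_ball]; linarith
  have hbρ : b ∈ Metric.ball x₀ ρ := by rw [Metric.mem_ball]; linarith
  have hd : 0 < dist a b := dist_pos.2 hne
  set δ := ‖e b - e a‖ with hδ
  have hδle : δ ≤ C * dist a b := hC.norm_sub_le a haρ b hbρ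
  have hδ0 : 0 < δ := by
    have := hC.dist_le a haρ b hbρ
    exact pos_of_mul_pos_right (hd.trans_le this) hC0.le
  have hδr : δ ≤ r := by
    have : C * dist a b ≤ C * R := by gcongr
    linarith
  have hc := hpt (e a + (r / δ) • (e b - e a)) (by
    rw [Metric.mem_ball, dist_eq_norm]
    have h1 : ‖e a - e x₀‖ ≤ C * dist x₀ a := hC.norm_sub_le x₀ (Metric.mem_ball_self hρ) a haρ
    have h2 : C * dist x₀ a ≤ C * (2 * R) := by rw [dist_comm]; gcongr
    have h3 : ‖(r / δ) • (e b - e a)‖ = r := by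
      rw [norm_smul, Real.norm_of_nonneg (by positivity), ← hδ]
      field_simp
    have h4 := norm_add_le (e a - e x₀) ((r / δ) • (e b - e a))
    rw [h3] at h4
    rw [← he, add_sub_right_comm]
    linarith)
  set c := e.symm (e a + (r / δ) • (e b - e a)) with hcdef
  obtain ⟨hcρ, -, hec⟩ := hc
  obtain ⟨γ, hγ, h0, h1⟩ := exists_isMinGeodesic E a c
  have hcρ' : dist c x₀ < ρ / 2 := hcρ
  have hD : dist a c ≤ C * r := by
    have := hC.dist_le a haρ c (by rw [Metric.mem_ball]; linarith)
    refine this.trans_eq ?_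
    rw [hec, add_sub_cancel_left, norm_smul, Real.norm_of_nonneg (by positivity), ← hδ]
    field_simp
  have hball : ∀ t ∈ Icc (0 : ℝ) 1, γ t ∈ Metric.ball x₀ ρ := fun t ht ↦
    hγ.mem_ball (by rw [h0, h1]; linarith) ht
  set t := δ / r with ht
  have htI : t ∈ Icc (0 : ℝ) 1 := ⟨by positivity, (div_le_one hr).2 hδr⟩
  have hdev := hC.geodesic_deviation hγ hball (by
    rw [h0, h1]
    exact (mul_le_mul_of_nonneg_left hD hC0.le).trans hr2) htI
  rw [h0, h1, hec, add_sub_cancel_left, smul_smul,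
    show t * (r / δ) = 1 by rw [ht]; field_simp, one_smul, sub_sub_sub_cancel_right] at hdev
  have htd : t ≤ C / r * dist a b := by
    rw [ht, div_mul_eq_mul_div]
    gcongr
  refine ⟨γ t, ?_, ?_⟩
  · have h2 := hC.dist_le b hbρ (γ t) (hball t htI)
    rw [dist_comm]
    calc dist b (γ t) ≤ C * ‖e (γ t) - e b‖ := h2
      _ ≤ C * (24 * C ^ 2 * t * (dist a c * √(dist a c))) := by gcongr
      _ ≤ C * (24 * C ^ 2 * (C / r * dist a b) * (C * r * √(C * r))) := by gcongr
      _ = (48 * C ^ 5 * √(C * r)) * (dist a b / 2) := by field_simp; ring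
      _ ≤ 1 * (dist a b / 2) := by gcongr
      _ = _ := one_mul _
  · have h2 := hsc γ hγ t htI
    rw [h0, h1] at h2
    have h3 : S / 2 * (t * (1 - t)) * dist a c ^ 2 ≤ S / 2 * t * (C * r) ^ 2 := by
      have : t * (1 - t) ≤ t := by nlinarith [htI.1, htI.2]
      gcongr
    have h4 : t * (2 * B + S / 2 * (C * r) ^ 2) ≤
        C / r * dist a b * (2 * B + S / 2 * (C * r) ^ 2) := by gcongr
    have h5 : t * (φ a - φ c) ≤ t * (2 * B) := by
      refine mul_le_mul_of_nonneg_left ?_ htI.1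
      linarith [(abs_le.1 (hB a)).2, (abs_le.1 (hB c)).1]
    rw [hK]
    nlinarith

/-- Semiconcave functions are Lipschitz. -/
theorem IsSemiconcave.exists_abs_sub_le (E : Type*) [NormedAddCommGroup E] [NormedSpace ℝ E]
    [FiniteDimensional ℝ E] {M : Type*} [MetricSpace M] [ChartedSpace E M]
    [IsManifold 𝓘(ℝ, E) ∞ M] [RiemannianBundle (fun x : M ↦ TangentSpace 𝓘(ℝ, E) x)]
    [IsContMDiffRiemannianBundle 𝓘(ℝ, E) ∞ E (fun x : M ↦ TangentSpace 𝓘(ℝ, E) x)]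
    [IsRiemannianManifold 𝓘(ℝ, E) M] [CompactSpace M] {φ : M → ℝ} (hφ : IsSemiconcave φ) :
    ∃ K ≥ 0, ∀ y z, |φ y - φ z| ≤ K * dist y z := by
  have hloc : ∃ R > 0, ∃ K ≥ 0, ∀ b ∈ (univ : Set M), ∀ a, dist a b ≤ R →
      φ a - φ b ≤ K * dist a b := by
    refine isCompact_univ.induction_on (p := fun s : Set M ↦ ∃ R > 0, ∃ K ≥ 0, ∀ b ∈ s, ∀ a,
      dist a b ≤ R → φ a - φ b ≤ K * dist a b) ⟨1, one_pos, 0, le_rfl, by simp⟩ ?_ ?_ ?_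
    · rintro s t hst ⟨R, hR, K, hK, h⟩
      exact ⟨R, hR, K, hK, fun b hb ↦ h b (hst hb)⟩
    · rintro s t ⟨R, hR, K, hK, h⟩ ⟨R', hR', K', hK', h'⟩
      refine ⟨min R R', lt_min hR hR', max K K', le_max_of_le_left hK, ?_⟩
      rintro b (hb | hb) a hab
      · refine (h b hb a (hab.trans (min_le_left _ _))).trans ?_
        gcongr
        exact le_max_left _ _
      · refine (h' b hb a (hab.trans (min_le_right _ _))).trans ?_
        gcongr
        exact le_max_right _ _
    · intro x₀ _
      obtain ⟨R, hR, K, hK, h⟩ := hφ.exists_local_sub_le E x₀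
      exact ⟨_, mem_nhdsWithin_of_mem_nhds (Metric.ball_mem_nhds x₀ hR), R, hR, K, hK, h⟩
  obtain ⟨R, hR, K, hK, h⟩ := hloc
  obtain ⟨B, hB⟩ := isCompact_univ.exists_bound_of_continuousOn hφ.1.continuousOn
  have key : ∀ a b, φ a - φ b ≤ max K (2 * B / R) * dist a b := by
    intro a b
    rcases le_or_gt (dist a b) R with hle | hgt
    · refine (h b (mem_univ b) a hle).trans ?_
      gcongr
      exact le_max_left _ _
    · have h1 := (abs_le.1 (hB a (mem_univ a))).2
      have h2 := (abs_le.1 (hB b (mem_univ b))).1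
      have hB0 : 0 ≤ B := (norm_nonneg _).trans (hB a (mem_univ a))
      calc φ a - φ b ≤ 2 * B / R * R := by field_simp; linarith
        _ ≤ 2 * B / R * dist a b := by gcongr
        _ ≤ _ := by gcongr; exact le_max_right _ _
  refine ⟨max K (2 * B / R), le_max_of_le_left hK, fun y z ↦ abs_le.2 ⟨?_, key y z⟩⟩
  have := key z y
  rw [dist_comm] at this
  linarith

/-- Semiconcave functions are almost semiconcave along the segments of charts. -/
theorem IsSemiconcave.exists_chart_le [CompactSpace M] {φ : M → ℝ} (hφ : IsSemiconcave φ)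
    (x₀ : M) : ∃ r > 0, ∃ K ≥ 0, ∀ y ∈ Metric.ball x₀ r, ∀ z ∈ Metric.ball x₀ r,
      ∀ m ∈ Metric.ball x₀ r, ∀ s ∈ Icc (0 : ℝ) 1,
      extChartAt 𝓘(ℝ, E) x₀ m = extChartAt 𝓘(ℝ, E) x₀ y +
        s • (extChartAt 𝓘(ℝ, E) x₀ z - extChartAt 𝓘(ℝ, E) x₀ y) →
      (1 - s) * φ y + s * φ z - K * s * (dist y z * √(dist y z)) ≤ φ m := by
  obtain ⟨L, hL, hLip⟩ := hφ.exists_abs_sub_le E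
  obtain ⟨hcont, S, hS, hsc⟩ := hφ
  obtain ⟨ρ, C, hC⟩ := exists_chartBounds (E := E) x₀
  set e := extChartAt 𝓘(ℝ, E) x₀ with he
  have hρ := hC.pos
  have h1C := hC.one_le
  have hC0 : 0 < C := by linarith
  refine ⟨min (ρ / 3) (1 / (2 * C)), by positivity, S / 2 + L * (C * (24 * C ^ 2)), by positivity,
    fun y hy z hz m hm s hs hems ↦ ?_⟩
  rw [Metric.mem_ball, lt_min_iff] at hy hz hm
  obtain ⟨γ, hγ, h0, h1⟩ := exists_isMinGeodesic E y z
  have hyz := dist_triangle_right y z x₀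
  have hmρ : m ∈ Metric.ball x₀ ρ := by rw [Metric.mem_ball]; linarith
  have hball : ∀ t ∈ Icc (0 : ℝ) 1, γ t ∈ Metric.ball x₀ ρ := fun t ht ↦
    hγ.mem_ball (by rw [h0, h1]; linarith) ht
  have hD : C * dist y z ≤ 1 := by
    calc C * dist y z ≤ C * (1 / (2 * C) + 1 / (2 * C)) := by
          gcongr; linarith
      _ = 1 := by field_simp; norm_num
  have hD1 : dist y z ≤ 1 := (le_mul_of_one_le_left dist_nonneg h1C).trans hD
  -- The chart point m and the geodesic point γ s are O(s D^(3/2)) apart, which costs as much in φ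
  -- since φ is Lipschitz; the semiconcavity error, of order s D², is absorbed because D ≤ 1.
  have hdev := hC.geodesic_deviation hγ hball (by rwa [h0, h1]) hs
  rw [h0, h1, sub_sub, ← he, ← hems] at hdev
  have h2 := hsc γ hγ s hs
  rw [h0, h1] at h2
  have h3 : φ (γ s) - φ m ≤ L * (C * (24 * C ^ 2 * s * (dist y z * √(dist y z)))) := by
    refine (le_abs_self _).trans ((hLip _ _).trans ?_)
    gcongr
    rw [dist_comm]
    refine (hC.dist_le m hmρ _ (hball s hs)).trans ?_
    gcongr
  have h4 : S / 2 * (s * (1 - s)) * dist y z ^ 2 ≤ S / 2 * s * (dist y z * √(dist y z)) := by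
    have h5 : s * (1 - s) ≤ s := by nlinarith [hs.1, hs.2]
    have h6 : dist y z ≤ √(dist y z) := Real.le_sqrt_of_sq_le (by nlinarith [@dist_nonneg M _ y z])
    rw [pow_two]
    have := hs.1
    gcongr
  nlinarith

end Semiconcave

/-! ### Absolutely continuous curves -/

namespace AbsolutelyContinuousOnInterval

variable {X Y Z : Type*} [PseudoMetricSpace X] [PseudoMetricSpace Y] [PseudoMetricSpace Z]
  {f : ℝ → X} {a b c d : ℝ}

theorem of_dist_le {g : ℝ → Y} {h : ℝ → Z} (hg : AbsolutelyContinuousOnInterval g a b)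
    (hh : AbsolutelyContinuousOnInterval h a b) {K : ℝ}
    (hf : ∀ s ∈ uIcc a b, ∀ t ∈ uIcc a b,
      dist (f s) (f t) ≤ K * dist (g s) (g t) + dist (h s) (h t)) :
    AbsolutelyContinuousOnInterval f a b := by
  have h1 := (Tendsto.const_mul K hg).add hh
  rw [mul_zero, add_zero] at h1
  refine squeeze_zero' (Eventually.of_forall fun E ↦ Finset.sum_nonneg fun _ _ ↦ dist_nonneg) ?_ h1
  filter_upwards [mem_inf_of_right (mem_principal_self _)] with E hE
  rw [Finset.mul_sum, ← Finset.sum_add_distrib]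
  exact Finset.sum_le_sum fun i hi ↦ hf _ (hE.1 i hi).1 _ (hE.1 i hi).2

theorem comp_lipschitzOn {g : X → Y} (hf : AbsolutelyContinuousOnInterval f a b) {K : ℝ}
    (hg : ∀ s ∈ uIcc a b, ∀ t ∈ uIcc a b, dist (g (f s)) (g (f t)) ≤ K * dist (f s) (f t)) :
    AbsolutelyContinuousOnInterval (fun t ↦ g (f t)) a b := by
  have h0 : AbsolutelyContinuousOnInterval (fun _ : ℝ ↦ (0 : ℝ)) a b := by
    simpa [AbsolutelyContinuousOnInterval] using tendsto_const_nhds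
  exact hf.of_dist_le h0 (K := K) (by simpa using hg)

theorem comp_monotone (hf : AbsolutelyContinuousOnInterval f a b) {h : ℝ → ℝ} (hm : Monotone h)
    (hL : ∀ s t, dist (h s) (h t) ≤ dist s t) (hmaps : MapsTo h (uIcc c d) (uIcc a b)) :
    AbsolutelyContinuousOnInterval (fun t ↦ f (h t)) c d := by
  rw [absolutelyContinuousOnInterval_iff] at hf ⊢
  intro ε hε
  obtain ⟨δ, hδ, hE⟩ := hf ε hε
  refine ⟨δ, hδ, fun E hEd hlt ↦ hE (E.1, fun i ↦ (h (E.2 i).1, h (E.2 i).2)) ⟨?_, ?_⟩ ?_⟩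
  · exact fun i hi ↦ ⟨hmaps (hEd.1 i hi).1, hmaps (hEd.1 i hi).2⟩
  · intro i hi j hj hij
    have h1 := hEd.2 hi hj hij
    -- Disjointness of half-open intervals is an inequality between minima and maxima of endpoints,
    -- which a monotone map preserves.
    simp only [Function.onFun, uIoc, Ioc_disjoint_Ioc, ← hm.map_min, ← hm.map_max] at h1 ⊢
    exact hm h1
  · exact (Finset.sum_le_sum fun i _ ↦ hL _ _).trans_lt hlt

theorem comp_add_const (hf : AbsolutelyContinuousOnInterval f (a + c) (b + c)) :
    AbsolutelyContinuousOnInterval (fun t ↦ f (t + c)) a b := by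
  refine hf.comp_monotone (h := fun t ↦ t + c) (fun s t h ↦ by simpa using h) (by simp) ?_
  intro t ht
  rw [mem_uIcc] at ht ⊢
  simpa using ht

/-- Clamping time at b extends each piece by a constant to the whole interval; the triangle
inequality through f b bounds the increments of f by those of the two extensions. -/
theorem trans (hab : a ≤ b) (hbc : b ≤ c) (h₁ : AbsolutelyContinuousOnInterval f a b)
    (h₂ : AbsolutelyContinuousOnInterval f b c) : AbsolutelyContinuousOnInterval f a c := by
  have e₁ := h₁.comp_monotone (h := fun t ↦ min t b) (c := a) (d := c)
    (fun s t h ↦ min_le_min_right b h) (fun s t ↦ by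
      simpa [Real.dist_eq] using abs_min_sub_min_le_max s b t b) (fun t ht ↦ by
      rw [uIcc_of_le (hab.trans hbc)] at ht
      rw [uIcc_of_le hab]
      exact ⟨le_min ht.1 hab, min_le_right _ _⟩)
  have e₂ := h₂.comp_monotone (h := fun t ↦ max t b) (c := a) (d := c)
    (fun s t h ↦ max_le_max_right b h) (fun s t ↦ by
      simpa [Real.dist_eq] using abs_max_sub_max_le_max s b t b) (fun t ht ↦ by
      rw [uIcc_of_le (hab.trans hbc)] at ht
      rw [uIcc_of_le hbc]
      exact ⟨le_max_right _ _, max_le ht.2 hbc⟩)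
  refine e₁.of_dist_le e₂ (K := 1) fun s _ t _ ↦ ?_
  rw [one_mul]
  rcases le_total s b with hs | hs <;> rcases le_total t b with ht | ht <;>
    simp [hs, ht, dist_triangle, add_comm (dist (f b) _)]

theorem continuousOn_uIcc (hf : AbsolutelyContinuousOnInterval f a b) :
    ContinuousOn f (uIcc a b) := by
  rw [absolutelyContinuousOnInterval_iff] at hf
  refine Metric.continuousOn_iff.2 fun s hs ε hε ↦ ?_
  obtain ⟨δ, hδ, hE⟩ := hf ε hε
  refine ⟨δ, hδ, fun t ht hst ↦ ?_⟩
  simpa using hE (1, fun _ ↦ (t, s)) ⟨by simp [hs, ht], by simp⟩ (by simpa using hst)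

theorem congr {g : ℝ → X} (hf : AbsolutelyContinuousOnInterval f a b)
    (h : EqOn g f (uIcc a b)) : AbsolutelyContinuousOnInterval g a b :=
  hf.of_dist_le hf (K := 0) fun s hs t ht ↦ by simp [h hs, h ht]

end AbsolutelyContinuousOnInterval

/-! ### Velocities in charts, and the Lagrangian under time shifts -/

section Velocity

set_option linter.unusedSectionVars false

variable {E : Type*} [NormedAddCommGroup E] [NormedSpace ℝ E] [FiniteDimensional ℝ E]
  {M : Type*} [MetricSpace M] [ChartedSpace E M] [IsManifold 𝓘(ℝ, E) ∞ M]

theorem hasDerivWithinAt_extChart_of_hasMFDerivWithinAt {ξ : ℝ → M} {S : Set ℝ} {s : ℝ}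
    {v : TangentSpace 𝓘(ℝ, E) (ξ s)}
    (h : HasMFDerivWithinAt 𝓘(ℝ, ℝ) 𝓘(ℝ, E) ξ S s ((1 : ℝ →L[ℝ] ℝ).smulRight v)) :
    HasDerivWithinAt (fun t ↦ extChartAt 𝓘(ℝ, E) (ξ s) (ξ t)) (v : E) S s := by
  have h1 : HasFDerivWithinAt (fun t : ℝ ↦ extChartAt 𝓘(ℝ, E) (ξ s) (ξ t))
      ((1 : ℝ →L[ℝ] ℝ).smulRight (v : E)) (id ⁻¹' S ∩ range id) s := h.2
  rw [preimage_id, range_id, inter_univ] at h1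
  exact h1.hasDerivWithinAt.congr_deriv (one_smul ℝ (v : E))

variable {H : ∀ x : M, CotSpace E x → ℝ}

theorem lagrangianAlong_congr {ξ ζ : ℝ → M} {s : ℝ} (h : ζ =ᶠ[𝓝 s] ξ) :
    lagrangianAlong H ζ s = lagrangianAlong H ξ s := by
  have h1 : (mfderiv 𝓘(ℝ, ℝ) 𝓘(ℝ, E) ζ s (1 : ℝ) : E) = mfderiv 𝓘(ℝ, ℝ) 𝓘(ℝ, E) ξ s (1 : ℝ) := by
    rw [h.mfderiv_eq]
    rfl
  exact congrArg₂ (fun (m : M) (v : E) ↦ lagrangian H m (v : TangentSpace 𝓘(ℝ, E) m))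
    h.self_of_nhds h1

theorem HasVelocityAt.comp_add_const {ξ : ℝ → M} {s c : ℝ}
    {v : TangentSpace 𝓘(ℝ, E) (ξ (s + c))} (h : HasVelocityAt ξ (s + c) v) :
    HasVelocityAt (fun r ↦ ξ (r + c)) s v := by
  have h1 : HasMFDerivAt 𝓘(ℝ, ℝ) 𝓘(ℝ, ℝ) (fun r : ℝ ↦ r + c) s (1 : ℝ →L[ℝ] ℝ) :=
    ((hasFDerivAt_id s).add_const c).hasMFDerivAt
  exact HasMFDerivAt.comp s h h1

theorem lagrangianAlong_comp_add_const (ξ : ℝ → M) (c s : ℝ) :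
    lagrangianAlong H (fun r ↦ ξ (r + c)) s = lagrangianAlong H ξ (s + c) := by
  by_cases h : MDifferentiableAt 𝓘(ℝ, ℝ) 𝓘(ℝ, E) ξ (s + c)
  · have h1 := hasVelocityAt_mfderiv h
    exact h1.comp_add_const.lagrangianAlong_eq
  -- Where the curve is not differentiable, both sides use the default derivative 0, so the identity
  -- still holds.
  · have h1 : ¬ MDifferentiableAt 𝓘(ℝ, ℝ) 𝓘(ℝ, E) (fun r ↦ ξ (r + c)) s := by
      intro h2
      apply h
      have h3 : HasMFDerivAt 𝓘(ℝ, ℝ) 𝓘(ℝ, ℝ) (fun r : ℝ ↦ r - c) (s + c) (1 : ℝ →L[ℝ] ℝ) :=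
        ((hasFDerivAt_id (s + c)).sub_const c).hasMFDerivAt
      have h4 : MDifferentiableAt 𝓘(ℝ, ℝ) 𝓘(ℝ, E) ((fun r ↦ ξ (r + c)) ∘ fun r ↦ r - c) (s + c) :=
        MDifferentiableAt.comp (s + c) (by simpa using h2) h3.mdifferentiableAt
      simpa [Function.comp_def] using h4
    rw [lagrangianAlong, lagrangianAlong, mfderiv_zero_of_not_mdifferentiableAt h,
      mfderiv_zero_of_not_mdifferentiableAt h1]
    rfl

end Velocity

/-! ### Speed of curves and lower bounds of the action -/

section Speed

set_option linter.unusedSectionVars false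

variable {E : Type*} [NormedAddCommGroup E] [NormedSpace ℝ E] [FiniteDimensional ℝ E]
  {M : Type*} [MetricSpace M] [ChartedSpace E M] [IsManifold 𝓘(ℝ, E) ∞ M]
  [RiemannianBundle (fun x : M ↦ TangentSpace 𝓘(ℝ, E) x)]
  [IsContMDiffRiemannianBundle 𝓘(ℝ, E) ∞ E (fun x : M ↦ TangentSpace 𝓘(ℝ, E) x)]
  [IsRiemannianManifold 𝓘(ℝ, E) M]

/-- In the chart at ξ s, the distance and the metric frozen at ξ s agree to first order, so the
metric speed is at most ‖v‖. The set S allows one-sided derivatives. -/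
theorem eventually_dist_le_of_velocity {ξ : ℝ → M} {S : Set ℝ} {s : ℝ}
    {v : TangentSpace 𝓘(ℝ, E) (ξ s)}
    (h : HasMFDerivWithinAt 𝓘(ℝ, ℝ) 𝓘(ℝ, E) ξ S s ((1 : ℝ →L[ℝ] ℝ).smulRight v)) {ε : ℝ}
    (hε : 0 < ε) : ∀ᶠ r in 𝓝[S] s, dist (ξ s) (ξ r) ≤ (‖v‖ + ε) * |r - s| := by
  obtain ⟨ρ, C, hC⟩ := exists_chartBounds (E := E) (ξ s)
  have hc : ContinuousWithinAt ξ S s := h.continuousWithinAt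
  have hC0 : 0 < C := by linarith [hC.one_le]
  obtain ⟨u, hu, hd⟩ : ∃ u : E, chartDSymm (ξ s) (ξ s) u = v ∧
      HasDerivWithinAt (fun t ↦ extChartAt 𝓘(ℝ, E) (ξ s) (ξ t)) u S s :=
    ⟨v, chartDSymm_self (E := E) (ξ s) v, hasDerivWithinAt_extChart_of_hasMFDerivWithinAt h⟩
  have hmem := Metric.mem_ball_self hC.pos (x := ξ s)
  set e := extChartAt 𝓘(ℝ, E) (ξ s)
  have hη : 0 < ε / (2 * C) := by positivity
  have h1 := (hasDerivWithinAt_iff_isLittleO.1 hd).bound hη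
  have h2 : ∀ᶠ r in 𝓝[S] s, ξ r ∈ Metric.ball (ξ s) ρ := hc (Metric.ball_mem_nhds _ hC.pos)
  have h3 : ∀ᶠ r in 𝓝[S] s, (1 + C * dist (ξ s) (ξ r)) * (‖v‖ + ε / 2) < ‖v‖ + ε := by
    have : Tendsto (fun r ↦ (1 + C * dist (ξ s) (ξ r)) * (‖v‖ + ε / 2)) (𝓝[S] s)
        (𝓝 ((1 + C * dist (ξ s) (ξ s)) * (‖v‖ + ε / 2))) :=
      (((tendsto_const_nhds.dist hc).const_mul C).const_add 1).mul_const _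
    refine this.eventually_lt_const ?_
    rw [dist_self]
    linarith
  filter_upwards [h1, h2, h3] with r hr1 hr2 hr3
  have h4 := hC.dist_le_norm_chartDSymm (ξ s) hmem (ξ r) hr2
  have h5 : ‖chartDSymm (ξ s) (ξ s) (e (ξ r) - e (ξ s))‖ ≤ (‖v‖ + ε / 2) * |r - s| := by
    have h6 : chartDSymm (ξ s) (ξ s) (e (ξ r) - e (ξ s)) = (r - s) • v +
        chartDSymm (ξ s) (ξ s) (e (ξ r) - e (ξ s) - (r - s) • u) := by
      rw [map_sub _ (e (ξ r) - e (ξ s)), map_smul, hu]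
      abel
    rw [h6]
    refine (norm_add_le _ _).trans ?_
    rw [norm_smul, Real.norm_eq_abs, add_mul, mul_comm]
    gcongr
    refine (norm_chartDSymm_apply_le (ξ s) (ξ s) _).trans ?_
    calc _ ≤ C * (ε / (2 * C) * ‖r - s‖) := by
          gcongr
          exact hC.norm_chartDSymm _ hmem
      _ = ε / 2 * |r - s| := by rw [Real.norm_eq_abs]; field_simp
  calc dist (ξ s) (ξ r) ≤ (1 + C * dist (ξ s) (ξ r)) * ((‖v‖ + ε / 2) * |r - s|) :=
        h4.trans (by gcongr)
    _ = (1 + C * dist (ξ s) (ξ r)) * (‖v‖ + ε / 2) * |r - s| := by ring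
    _ ≤ _ := by gcongr

theorem HasVelocityAt.abs_deriv_dist_le {ξ : ℝ → M} {s : ℝ} {v : TangentSpace 𝓘(ℝ, E) (ξ s)}
    (h : HasVelocityAt ξ s v) (x : M) : |deriv (fun r ↦ dist x (ξ r)) s| ≤ ‖v‖ := by
  by_cases hd : DifferentiableAt ℝ (fun r ↦ dist x (ξ r)) s
  · refine le_of_forall_pos_le_add fun ε hε ↦ ?_
    refine hd.hasDerivAt.le_of_lip' (by positivity) ?_
    have h1 := eventually_dist_le_of_velocity h.hasMFDerivWithinAt (S := univ) hε
    rw [nhdsWithin_univ] at h1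
    filter_upwards [h1] with r hr
    refine le_trans ?_ hr
    rw [Real.norm_eq_abs, dist_comm x (ξ r), dist_comm x (ξ s), dist_comm (ξ s) (ξ r)]
    exact abs_dist_sub_le _ _ _
  · rw [deriv_zero_of_not_differentiableAt hd, abs_zero]
    exact norm_nonneg _

/-- Locally the curve lies in a chart that is Lipschitz for the distance, so its chart expression is
absolutely continuous, of bounded variation, and almost everywhere differentiable. -/
theorem AbsolutelyContinuousOnInterval.exists_nhds_ae_mdifferentiableAt (E : Type*)
    [NormedAddCommGroup E] [NormedSpace ℝ E] [FiniteDimensional ℝ E] {M : Type*} [MetricSpace M]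
    [ChartedSpace E M] [IsManifold 𝓘(ℝ, E) ∞ M]
    [RiemannianBundle (fun x : M ↦ TangentSpace 𝓘(ℝ, E) x)]
    [IsContMDiffRiemannianBundle 𝓘(ℝ, E) ∞ E (fun x : M ↦ TangentSpace 𝓘(ℝ, E) x)]
    [IsRiemannianManifold 𝓘(ℝ, E) M] {ξ : ℝ → M} {a b : ℝ}
    (h : AbsolutelyContinuousOnInterval ξ a b) {s : ℝ} (hs : s ∈ Ioo a b) :
    ∃ U ∈ 𝓝 s, ∀ᵐ r, r ∈ U → MDifferentiableAt 𝓘(ℝ, ℝ) 𝓘(ℝ, E) ξ r := by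
  have hc : ∀ r ∈ Ioo a b, ContinuousAt ξ r := fun r hr ↦ by
    have h0 : uIcc a b ∈ 𝓝 r := mem_of_superset (Icc_mem_nhds hr.1 hr.2) Icc_subset_uIcc
    exact h.continuousOn_uIcc.continuousAt h0
  obtain ⟨ρ, C, hC⟩ := exists_chartBounds (E := E) (ξ s)
  obtain ⟨η, hη, hball⟩ := Metric.mem_nhds_iff.1 (inter_mem (Ioo_mem_nhds hs.1 hs.2)
    ((hc s hs).preimage_mem_nhds (Metric.ball_mem_nhds _ hC.pos)))
  have hsub : uIcc (s - η / 2) (s + η / 2) ⊆ Metric.ball s η := by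
    rw [uIcc_of_le (by linarith), Real.ball_eq_Ioo]
    exact Icc_subset_Ioo (by linarith) (by linarith)
  have h1 : AbsolutelyContinuousOnInterval (fun r ↦ extChartAt 𝓘(ℝ, E) (ξ s) (ξ r))
      (s - η / 2) (s + η / 2) := by
    refine (h.mono (fun r hr ↦ ?_)).comp_lipschitzOn (K := C)
      (g := fun y ↦ extChartAt 𝓘(ℝ, E) (ξ s) y) fun r hr r' hr' ↦ ?_
    · exact Icc_subset_uIcc (Ioo_subset_Icc_self (hball (hsub hr)).1)
    · rw [dist_comm, dist_eq_norm]
      exact hC.norm_sub_le _ (hball (hsub hr)).2 _ (hball (hsub hr')).2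
  refine ⟨uIcc (s - η / 2) (s + η / 2), mem_of_superset (Icc_mem_nhds
    (show s - η / 2 < s by linarith) (show s < s + η / 2 by linarith)) Icc_subset_uIcc, ?_⟩
  filter_upwards [h1.boundedVariationOn.ae_differentiableAt_of_mem_uIcc] with r hr hrU
  have h5 := hball (hsub hrU)
  exact (hasVelocityAt_of_hasDerivAt_extChart (hc r h5.1) (hC.subset_source h5.2)
    (hr hrU).hasDerivAt).mdifferentiableAt

theorem AbsolutelyContinuousOnInterval.ae_mdifferentiableAt (E : Type*)
    [NormedAddCommGroup E] [NormedSpace ℝ E] [FiniteDimensional ℝ E] {M : Type*} [MetricSpace M]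
    [ChartedSpace E M] [IsManifold 𝓘(ℝ, E) ∞ M]
    [RiemannianBundle (fun x : M ↦ TangentSpace 𝓘(ℝ, E) x)]
    [IsContMDiffRiemannianBundle 𝓘(ℝ, E) ∞ E (fun x : M ↦ TangentSpace 𝓘(ℝ, E) x)]
    [IsRiemannianManifold 𝓘(ℝ, E) M] {ξ : ℝ → M} {a b : ℝ}
    (h : AbsolutelyContinuousOnInterval ξ a b) :
    ∀ᵐ s, s ∈ Ioo a b → MDifferentiableAt 𝓘(ℝ, ℝ) 𝓘(ℝ, E) ξ s := by
  have h0 : volume {s | s ∈ Ioo a b ∧ ¬ MDifferentiableAt 𝓘(ℝ, ℝ) 𝓘(ℝ, E) ξ s} = 0 := by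
    refine measure_null_of_locally_null _ fun s hs ↦ ?_
    obtain ⟨U, hU, hae⟩ := h.exists_nhds_ae_mdifferentiableAt E hs.1
    refine ⟨_, inter_mem_nhdsWithin _ hU, ?_⟩
    refine measure_mono_null (fun r hr ↦ ?_) (ae_iff.1 hae)
    exact fun h3 ↦ hr.1.2 (h3 hr.2)
  refine (ae_iff.2 (measure_mono_null (fun s hs ↦ ?_) h0))
  exact Classical.not_imp.1 hs

variable {H : ∀ x : M, CotSpace E x → ℝ}

theorem IsTonelli.exists_lagrangian_ge [CompactSpace M] (hH : IsTonelli H) {K : ℝ} (hK : 0 ≤ K) :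
    ∃ C : ℝ, ∀ (x : M) (v : TangentSpace 𝓘(ℝ, E) x), K * ‖v‖ - C ≤ lagrangian H x v := by
  obtain ⟨B, hB⟩ := hH.exists_bound K
  exact ⟨B, fun x v ↦ legendre_ge_of_bound (hH.isTonelliFun x).superlinear hK (hB x) v⟩

theorem IsTonelli.exists_lagrangian_le (hH : IsTonelli H) (R : ℝ) :
    ∃ B : ℝ, ∀ (x : M) (v : TangentSpace 𝓘(ℝ, E) x), ‖v‖ ≤ R → lagrangian H x v ≤ B := by
  obtain ⟨C, hC⟩ := hH.superlinear R
  exact ⟨C, fun x v hv ↦ legendre_le_of_superlinear hv (hC x)⟩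

/-- Here f acts as a calibration. It is applied to the distance from the starting point and to a
covector evaluated in a chart. -/
theorem intervalIntegral_ge_of_deriv {f g : ℝ → ℝ} {a b K C : ℝ} (hab : a ≤ b)
    (hf : AbsolutelyContinuousOnInterval f a b) (hg : IntervalIntegrable g volume a b)
    (h : ∀ᵐ s, s ∈ Ioo a b → K * deriv f s - C ≤ g s) :
    K * (f b - f a) - C * (b - a) ≤ ∫ s in a..b, g s := by
  have hf' := (hf.intervalIntegrable_deriv.const_mul K).sub
    (intervalIntegrable_const (c := C) (μ := volume) (a := a) (b := b))
  have h1 : ∫ s in a..b, (K * deriv f s - C) = K * (f b - f a) - C * (b - a) := by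
    rw [intervalIntegral.integral_sub (hf.intervalIntegrable_deriv.const_mul K)
      intervalIntegrable_const, intervalIntegral.integral_const_mul, hf.integral_deriv_eq_sub,
      intervalIntegral.integral_const, smul_eq_mul]
    ring
  rw [← h1]
  refine intervalIntegral.integral_mono_ae_restrict hab hf' hg ?_
  rw [EventuallyLE, ← Measure.restrict_congr_set Ioo_ae_eq_Icc, ae_restrict_iff' measurableSet_Ioo]
  exact h

/-- The action of a curve is superlinear in the distance of its end points. -/
theorem IsTonelli.exists_action_ge [CompactSpace M] (hH : IsTonelli H) {K : ℝ} (hK : 0 ≤ K) :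
    ∃ C : ℝ, ∀ (ξ : ℝ → M) (a b : ℝ), a ≤ b → AbsolutelyContinuousOnInterval ξ a b →
      IntervalIntegrable (lagrangianAlong H ξ) volume a b →
      K * dist (ξ a) (ξ b) - C * (b - a) ≤ ∫ s in a..b, lagrangianAlong H ξ s := by
  obtain ⟨C, hC⟩ := hH.exists_lagrangian_ge hK
  refine ⟨C, fun ξ a b hab hξ hi ↦ ?_⟩
  have hf : AbsolutelyContinuousOnInterval (fun s ↦ dist (ξ a) (ξ s)) a b :=
    hξ.comp_lipschitzOn (K := 1) (g := fun y ↦ dist (ξ a) y) fun s _ t _ ↦ by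
      rw [one_mul, Real.dist_eq, dist_comm _ (ξ s), dist_comm _ (ξ t)]
      exact abs_dist_sub_le _ _ _
  have h1 := intervalIntegral_ge_of_deriv (K := K) (C := C) hab hf hi ?_
  · simpa using h1
  filter_upwards [hξ.ae_mdifferentiableAt E] with s hs hsI
  have hv := hasVelocityAt_mfderiv (hs hsI)
  refine le_trans ?_ (hC (ξ s) (mfderiv 𝓘(ℝ, ℝ) 𝓘(ℝ, E) ξ s (1 : ℝ)))
  have := (le_abs_self _).trans (hv.abs_deriv_dist_le (ξ a))
  gcongr

end Speed

/-! ### The fundamental solution -/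

section Action

set_option linter.unusedSectionVars false

variable {E : Type*} [NormedAddCommGroup E] [NormedSpace ℝ E] [FiniteDimensional ℝ E]
  {M : Type*} [MetricSpace M] [ChartedSpace E M] [IsManifold 𝓘(ℝ, E) ∞ M]
  [RiemannianBundle (fun x : M ↦ TangentSpace 𝓘(ℝ, E) x)]
  [IsContMDiffRiemannianBundle 𝓘(ℝ, E) ∞ E (fun x : M ↦ TangentSpace 𝓘(ℝ, E) x)]
  [IsRiemannianManifold 𝓘(ℝ, E) M]
  {H : ∀ x : M, CotSpace E x → ℝ} {s t : ℝ} {x y z : M} {a b : ℝ}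

/-- The values of the action over the curves from `x` to `y` in time `t`. -/
def actionSet (H : ∀ x : M, CotSpace E x → ℝ) (t : ℝ) (x y : M) : Set ℝ :=
  {a : ℝ | ∃ ξ : ℝ → M, AbsolutelyContinuousOnInterval ξ 0 t ∧ ξ 0 = x ∧ ξ t = y ∧
    IntervalIntegrable (lagrangianAlong H ξ) volume 0 t ∧
    a = ∫ s in (0 : ℝ)..t, lagrangianAlong H ξ s}

theorem fundamentalSolution_eq_sInf : fundamentalSolution H t x y = sInf (actionSet H t x y) := rfl

theorem ae_restrict_uIoc_of_eqOn_Ioo {f g : ℝ → ℝ} {a b : ℝ} (hab : a ≤ b)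
    (h : EqOn f g (Ioo a b)) : f =ᵐ[volume.restrict (uIoc a b)] g := by
  rw [uIoc_of_le hab, ← Measure.restrict_congr_set Ioo_ae_eq_Ioc]
  exact ae_restrict_of_forall_mem measurableSet_Ioo h

theorem add_mem_actionSet (hs : 0 ≤ s) (ht : 0 ≤ t) (ha : a ∈ actionSet H s x y)
    (hb : b ∈ actionSet H t y z) : a + b ∈ actionSet H (s + t) x z := by
  obtain ⟨ξ, hξ, hξ0, hξs, hξi, rfl⟩ := ha
  obtain ⟨η, hη, hη0, hηt, hηi, rfl⟩ := hb
  set η' : ℝ → M := fun r ↦ η (r + -s) with hη'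
  set ζ : ℝ → M := fun r ↦ if r ≤ s then ξ r else η' r with hζ
  have hst : s ≤ s + t := by linarith
  have e1 : EqOn ζ ξ (Iic s) := fun r hr ↦ if_pos hr
  have e2 : EqOn ζ η' (Ici s) := fun r hr ↦ by
    rcases (mem_Ici.1 hr).eq_or_lt with rfl | h
    · simp [hζ, hη', hξs, hη0]
    · exact if_neg (not_le.2 h)
  -- Agreement holds on open intervals only: at the junction the glued curve may have no derivative,
  -- but a point is negligible.
  have l1 : EqOn (lagrangianAlong H ξ) (lagrangianAlong H ζ) (Ioo 0 s) := fun r hr ↦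
    (lagrangianAlong_congr (e1.eventuallyEq_of_mem (Iic_mem_nhds hr.2))).symm
  have l2 : EqOn (fun r ↦ lagrangianAlong H η (r + -s)) (lagrangianAlong H ζ) (Ioo s (s + t)) :=
    fun r hr ↦ ((lagrangianAlong_congr (e2.eventuallyEq_of_mem (Ici_mem_nhds hr.1))).trans
      (lagrangianAlong_comp_add_const η (-s) r)).symm
  have a1 := ae_restrict_uIoc_of_eqOn_Ioo hs l1
  have a2 := ae_restrict_uIoc_of_eqOn_Ioo hst l2
  have hηi' : IntervalIntegrable (fun r ↦ lagrangianAlong H η (r + -s)) volume s (s + t) := by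
    simpa [add_comm t s] using hηi.comp_add_right (-s)
  have i1 := hξi.congr_ae a1
  have i2 := hηi'.congr_ae a2
  refine ⟨ζ, ?_, ?_, ?_, i1.trans i2, ?_⟩
  · refine AbsolutelyContinuousOnInterval.trans hs hst (hξ.congr fun r hr ↦ e1 ?_)
      (AbsolutelyContinuousOnInterval.congr (f := η') ?_ fun r hr ↦ e2 ?_)
    · rw [uIcc_of_le hs] at hr
      exact hr.2
    · exact AbsolutelyContinuousOnInterval.comp_add_const (by simpa using hη)
    · rw [uIcc_of_le hst] at hr
      exact hr.1
  · rw [e1 (mem_Iic.2 hs), hξ0]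
  · rw [e2 (mem_Ici.2 hst), hη']
    simpa using hηt
  · rw [← intervalIntegral.integral_add_adjacent_intervals i1 i2,
      ← intervalIntegral.integral_congr_ae_restrict a1,
      ← intervalIntegral.integral_congr_ae_restrict a2, intervalIntegral.integral_comp_add_right]
    simp

theorem exists_mem_actionSet_split (hs : 0 ≤ s) (ht : 0 ≤ t) (ha : a ∈ actionSet H (s + t) x z) :
    ∃ y, ∃ b ∈ actionSet H s x y, ∃ c ∈ actionSet H t y z, a = b + c := by
  obtain ⟨ξ, hξ, hξ0, hξs, hξi, rfl⟩ := ha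
  have hst : s ≤ s + t := by linarith
  have s1 : uIcc 0 s ⊆ uIcc 0 (s + t) := by
    rw [uIcc_of_le hs, uIcc_of_le (by linarith)]
    exact Icc_subset_Icc_right hst
  have s2 : uIcc s (s + t) ⊆ uIcc 0 (s + t) := by
    rw [uIcc_of_le hst, uIcc_of_le (by linarith)]
    exact Icc_subset_Icc_left hs
  have i1 := hξi.mono_set s1
  have i2 := hξi.mono_set s2
  refine ⟨ξ s, _, ⟨ξ, hξ.mono s1, hξ0, rfl, i1, rfl⟩, _, ⟨fun r ↦ ξ (r + s), ?_, ?_, ?_, ?_, rfl⟩,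
    ?_⟩
  · refine AbsolutelyContinuousOnInterval.comp_add_const ?_
    rw [zero_add, add_comm]
    exact hξ.mono s2
  · simp
  · simp only
    rw [add_comm, hξs]
  · simp_rw [funext (lagrangianAlong_comp_add_const (H := H) ξ s)]
    simpa [add_comm t s] using i2.comp_add_right s
  · simp_rw [lagrangianAlong_comp_add_const]
    rw [intervalIntegral.integral_comp_add_right, zero_add, add_comm t s,
      intervalIntegral.integral_add_adjacent_intervals i1 i2]

theorem IsTonelli.exists_actionSet_ge [CompactSpace M] (hH : IsTonelli H) {K : ℝ} (hK : 0 ≤ K) :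
    ∃ C : ℝ, ∀ t, 0 ≤ t → ∀ x y, ∀ a ∈ actionSet H t x y, K * dist x y - C * t ≤ a := by
  obtain ⟨C, hC⟩ := hH.exists_action_ge hK
  refine ⟨C, fun t ht x y a ha ↦ ?_⟩
  obtain ⟨ξ, hξ, rfl, rfl, hξi, rfl⟩ := ha
  simpa using hC ξ 0 t ht hξ hξi

theorem IsTonelli.bddBelow_actionSet [CompactSpace M] (hH : IsTonelli H) (ht : 0 ≤ t) (x y : M) :
    BddBelow (actionSet H t x y) := by
  obtain ⟨C, hC⟩ := hH.exists_actionSet_ge le_rfl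
  exact ⟨_, fun a ha ↦ hC t ht x y a ha⟩

theorem IsTonelli.fundamentalSolution_le [CompactSpace M] (hH : IsTonelli H) (ht : 0 ≤ t)
    (ha : a ∈ actionSet H t x y) : fundamentalSolution H t x y ≤ a :=
  csInf_le (hH.bddBelow_actionSet ht x y) ha

theorem exists_ball_segment_mem (x₀ : M) {U : Set M} (hU : U ∈ 𝓝 x₀) :
    ∃ r > 0, Metric.ball x₀ r ⊆ (chartAt E x₀).source ∧
      ∀ y ∈ Metric.ball x₀ r, ∀ z ∈ Metric.ball x₀ r, ∀ c ∈ Icc (0 : ℝ) 1,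
      extChartAt 𝓘(ℝ, E) x₀ y + c • (extChartAt 𝓘(ℝ, E) x₀ z - extChartAt 𝓘(ℝ, E) x₀ y) ∈
        (extChartAt 𝓘(ℝ, E) x₀).target ∧
      (extChartAt 𝓘(ℝ, E) x₀).symm (extChartAt 𝓘(ℝ, E) x₀ y +
        c • (extChartAt 𝓘(ℝ, E) x₀ z - extChartAt 𝓘(ℝ, E) x₀ y)) ∈ U := by
  obtain ⟨r, hr, h⟩ := exists_ball_extChart_symm_mem (E := E) x₀ hU
  obtain ⟨r', hr', h'⟩ := Metric.mem_nhds_iff.1 (inter_mem (chart_source_mem_nhds E x₀)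
    ((continuousAt_extChartAt (I := 𝓘(ℝ, E)) x₀).preimage_mem_nhds (Metric.ball_mem_nhds _ hr)))
  refine ⟨r', hr', fun y hy ↦ (h' hy).1, fun y hy z hz c hc ↦ ?_⟩
  have hm := h _ ((convex_ball _ r).add_smul_sub_mem (h' hy).2 (h' hz).2 hc)
  exact ⟨hm.2.1, hm.1⟩

/-- The competitor is the chart segment run at constant chart velocity. Its Lagrangian is continuous
in time, hence integrable. -/
theorem IsTonelli.exists_mem_actionSet_segment (hH : IsTonelli H) (x₀ : M) {U : Set M}
    (hU : U ∈ 𝓝 x₀) : ∃ r > 0, ∀ y ∈ Metric.ball x₀ r, ∀ z ∈ Metric.ball x₀ r, ∀ τ > (0 : ℝ),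
      ∀ B : ℝ, (∀ m ∈ U, lagrangian H m (chartDSymm x₀ m
        (τ⁻¹ • (extChartAt 𝓘(ℝ, E) x₀ z - extChartAt 𝓘(ℝ, E) x₀ y))) ≤ B) →
      ∃ a ∈ actionSet H τ y z, a ≤ B * τ := by
  obtain ⟨ρ, C, hC⟩ := exists_chartBounds (E := E) x₀
  obtain ⟨r, hr, hsrc, hseg⟩ := exists_ball_segment_mem (E := E) x₀
    (inter_mem hU (Metric.ball_mem_nhds x₀ hC.pos))
  refine ⟨r, hr, fun y hy z hz τ hτ B hB ↦ ?_⟩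
  set e := extChartAt 𝓘(ℝ, E) x₀ with he
  set w := τ⁻¹ • (e z - e y) with hw
  set c : ℝ → E := fun s ↦ e y + s • w with hc
  have hc' : ∀ s ∈ Icc 0 τ, c s ∈ e.target ∧ e.symm (c s) ∈ U ∩ Metric.ball x₀ ρ := by
    intro s hs
    have h1 : c s = e y + (s / τ) • (e z - e y) := by
      simp only [hc, hw]
      rw [smul_smul, div_eq_mul_inv]
    rw [h1]
    exact hseg y hy z hz (s / τ) ⟨div_nonneg hs.1 hτ.le, (div_le_one hτ).2 hs.2⟩
  have hcd : ∀ s, HasDerivAt c w s := fun s ↦ by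
    have := ((hasDerivAt_id s).smul_const w).const_add (e y)
    rwa [one_smul] at this
  have hcc : Continuous c := continuous_iff_continuousAt.2 fun s ↦ (hcd s).continuousAt
  have hL : ∀ s ∈ Icc 0 τ, lagrangianAlong H (fun s ↦ e.symm (c s)) s =
      lagrangian H (e.symm (c s)) (chartDSymm x₀ (e.symm (c s)) w) := fun s hs ↦
    (hasVelocityAt_extChart_symm_comp (hc' s hs).1 (hcd s)).lagrangianAlong_eq
  have hcont : ContinuousOn (lagrangianAlong H (fun s ↦ e.symm (c s))) (uIcc 0 τ) := by
    rw [uIcc_of_le hτ.le]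
    refine ContinuousOn.congr ?_ hL
    refine (hH.continuousOn_lagrangian_coord x₀).comp (f := fun s ↦ (e.symm (c s), w))
      (ContinuousOn.prodMk ?_ continuousOn_const) fun s hs ↦ ⟨hC.subset_source (hc' s hs).2.2,
        mem_univ _⟩
    exact (continuousOn_extChartAt_symm x₀).comp hcc.continuousOn fun s hs ↦ (hc' s hs).1
  have hinv : ∀ {m : M}, m ∈ Metric.ball x₀ r → e.symm (e m) = m := fun {m} hm ↦
    e.left_inv (by rw [he, extChart_source_eq]; exact hsrc hm)
  refine ⟨_, ⟨fun s ↦ e.symm (c s), ?_, ?_, ?_, hcont.intervalIntegrable, rfl⟩, ?_⟩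
  · have h1 : AbsolutelyContinuousOnInterval c 0 τ := by
      refine ContDiffOn.absolutelyContinuousOnInterval (ContDiff.contDiffOn ?_)
      fun_prop
    refine h1.comp_lipschitzOn (g := fun u ↦ e.symm u) (K := C) fun s hs s' hs' ↦ ?_
    rw [uIcc_of_le hτ.le] at hs hs'
    refine (hC.dist_le _ (hc' s hs).2.2 _ (hc' s' hs').2.2).trans_eq ?_
    rw [← he, e.right_inv (hc' s hs).1, e.right_inv (hc' s' hs').1, dist_comm, dist_eq_norm]
  · simp [hc, hinv hy]
  · simp only [hc, hw]
    rw [smul_inv_smul₀ hτ.ne', add_sub_cancel, hinv hz]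
  · have h1 : ∫ s in (0 : ℝ)..τ, lagrangianAlong H (fun s ↦ e.symm (c s)) s ≤
        ∫ _ in (0 : ℝ)..τ, B := by
      refine intervalIntegral.integral_mono_on hτ.le hcont.intervalIntegrable
        intervalIntegrable_const fun s hs ↦ ?_
      rw [hL s hs]
      exact hB _ (hc' s hs).2.1
    refine h1.trans_eq ?_
    simp [mul_comm]

theorem IsTonelli.exists_local_mem_actionSet (hH : IsTonelli H) (x₀ : M) :
    ∃ r > 0, ∃ C ≥ (0 : ℝ), ∀ y ∈ Metric.ball x₀ r, ∀ z, dist y z ≤ r → ∀ h > 0, ∀ R ≥ 0,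
      dist y z ≤ R * h → ∀ B : ℝ,
      (∀ (m : M) (v : TangentSpace 𝓘(ℝ, E) m), ‖v‖ ≤ C * R → lagrangian H m v ≤ B) →
      ∃ a ∈ actionSet H h y z, a ≤ B * h := by
  obtain ⟨ρ, C, hC⟩ := exists_chartBounds (E := E) x₀
  have hC0 : 0 < C := by linarith [hC.one_le]
  obtain ⟨r, hr, hseg⟩ := hH.exists_mem_actionSet_segment x₀ (Metric.ball_mem_nhds x₀ hC.pos)
  have hρ := hC.pos
  refine ⟨min (r / 2) (ρ / 2), by positivity, C * C, by positivity,
    fun y hy z hyz h hh R hR hd B hB ↦ ?_⟩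
  rw [Metric.mem_ball, lt_min_iff] at hy
  rw [le_min_iff] at hyz
  have hz := dist_triangle_left z x₀ y
  have hyr : y ∈ Metric.ball x₀ r := by rw [Metric.mem_ball]; linarith
  have hzr : z ∈ Metric.ball x₀ r := by rw [Metric.mem_ball]; linarith
  have hyρ : y ∈ Metric.ball x₀ ρ := by rw [Metric.mem_ball]; linarith
  have hzρ : z ∈ Metric.ball x₀ ρ := by rw [Metric.mem_ball]; linarith
  refine hseg y hyr z hzr h hh B fun m hm ↦ hB m _ ?_
  refine (norm_chartDSymm_apply_le x₀ m _).trans ?_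
  rw [norm_smul, norm_inv, Real.norm_of_nonneg hh.le]
  calc _ ≤ C * (h⁻¹ * (C * (R * h))) := by
        gcongr
        · exact hC.norm_chartDSymm m hm
        · exact (hC.norm_sub_le y hyρ z hzρ).trans (by gcongr)
    _ = C * C * R := by field_simp

theorem IsTonelli.exists_mem_actionSet [CompactSpace M] (hH : IsTonelli H) :
    ∃ r > 0, ∃ C ≥ (0 : ℝ), ∀ y z : M, dist y z ≤ r → ∀ h > 0, ∀ R ≥ 0,
      dist y z ≤ R * h → ∀ B : ℝ,
      (∀ (m : M) (v : TangentSpace 𝓘(ℝ, E) m), ‖v‖ ≤ C * R → lagrangian H m v ≤ B) →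
      ∃ a ∈ actionSet H h y z, a ≤ B * h := by
  suffices hs : ∃ r > 0, ∃ C ≥ (0 : ℝ), ∀ y ∈ (univ : Set M), ∀ z : M, dist y z ≤ r → ∀ h > 0,
      ∀ R ≥ 0, dist y z ≤ R * h → ∀ B : ℝ,
      (∀ (m : M) (v : TangentSpace 𝓘(ℝ, E) m), ‖v‖ ≤ C * R → lagrangian H m v ≤ B) →
      ∃ a ∈ actionSet H h y z, a ≤ B * h by
    obtain ⟨r, hr, C, hC, h⟩ := hs
    exact ⟨r, hr, C, hC, fun y ↦ h y (mem_univ y)⟩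
  refine isCompact_univ.induction_on (p := fun S : Set M ↦ ∃ r > 0, ∃ C ≥ (0 : ℝ), ∀ y ∈ S,
      ∀ z : M, dist y z ≤ r → ∀ h > 0, ∀ R ≥ 0, dist y z ≤ R * h → ∀ B : ℝ,
      (∀ (m : M) (v : TangentSpace 𝓘(ℝ, E) m), ‖v‖ ≤ C * R → lagrangian H m v ≤ B) →
      ∃ a ∈ actionSet H h y z, a ≤ B * h) ⟨1, one_pos, 0, le_rfl, by simp⟩ ?_ ?_ ?_
  · rintro s t hst ⟨r, hr, C, hC, h⟩
    exact ⟨r, hr, C, hC, fun y hy ↦ h y (hst hy)⟩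
  · rintro s t ⟨r, hr, C, hC, h⟩ ⟨r', hr', C', hC', h'⟩
    refine ⟨min r r', lt_min hr hr', max C C', le_max_of_le_left hC, ?_⟩
    rintro y (hy | hy) z hyz k hk R hR hd B hB
    · refine h y hy z (hyz.trans (min_le_left _ _)) k hk R hR hd B fun m v hv ↦ hB m v (hv.trans ?_)
      gcongr
      exact le_max_left _ _
    · refine h' y hy z (hyz.trans (min_le_right _ _)) k hk R hR hd B
        fun m v hv ↦ hB m v (hv.trans ?_)
      gcongr
      exact le_max_right _ _
  · intro x₀ _
    obtain ⟨r, hr, C, hC, h⟩ := hH.exists_local_mem_actionSet x₀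
    exact ⟨_, mem_nhdsWithin_of_mem_nhds (Metric.ball_mem_nhds x₀ hr), r, hr, C, hC, h⟩

/-- The points reachable from x in every positive time form a clopen set; asking for every time lets
t be split into two halves. Nonemptiness makes the infimum A_t meaningful, since `sInf` of the empty
set is 0 by default. -/
theorem IsTonelli.nonempty_actionSet [CompactSpace M] [ConnectedSpace M] (hH : IsTonelli H)
    (ht : 0 < t) (x y : M) : (actionSet H t x y).Nonempty := by
  obtain ⟨r, hr, C, hC, h⟩ := hH.exists_mem_actionSet
  have hloc : ∀ y z, dist y z ≤ r → ∀ h > 0, (actionSet H h y z).Nonempty := by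
    intro y z hyz k hk
    obtain ⟨B, hB⟩ := hH.exists_lagrangian_le (C * (r / k))
    obtain ⟨a, ha, -⟩ := h y z hyz k hk (r / k) (by positivity) (by
      rw [div_mul_cancel₀ _ hk.ne']; exact hyz) B hB
    exact ⟨a, ha⟩
  set S : Set M := {y | ∀ t > 0, (actionSet H t x y).Nonempty} with hS
  have hstep : ∀ y z, dist y z < r → y ∈ S → z ∈ S := by
    intro y z hyz hy t ht
    obtain ⟨a, ha⟩ := hy (t / 2) (by positivity)
    obtain ⟨b, hb⟩ := hloc y z hyz.le (t / 2) (by positivity)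
    have := add_mem_actionSet (by positivity) (by positivity) ha hb
    rw [add_halves] at this
    exact ⟨_, this⟩
  have hclopen : IsClopen S := by
    refine ⟨⟨Metric.isOpen_iff.2 fun y hy ↦ ⟨r, hr, fun z hz hzS ↦ hy ?_⟩⟩,
      Metric.isOpen_iff.2 fun y hy ↦ ⟨r, hr, fun z hz ↦ ?_⟩⟩
    · exact hstep z y hz hzS
    · exact hstep y z (by rwa [dist_comm]) hy
  have huniv := hclopen.eq_univ ⟨x, fun t ht ↦ hloc x x (by simp [hr.le]) t ht⟩
  exact (huniv ▸ mem_univ y : y ∈ S) t ht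

variable [CompactSpace M] [ConnectedSpace M]

theorem IsTonelli.exists_fundamentalSolution_ge (hH : IsTonelli H) {K : ℝ} (hK : 0 ≤ K) :
    ∃ C : ℝ, ∀ t, 0 < t → ∀ x y, K * dist x y - C * t ≤ fundamentalSolution H t x y := by
  obtain ⟨C, hC⟩ := hH.exists_actionSet_ge hK
  exact ⟨C, fun t ht x y ↦ le_csInf (hH.nonempty_actionSet ht x y) (hC t ht.le x y)⟩

theorem IsTonelli.exists_fundamentalSolution_le (hH : IsTonelli H) (R : ℝ) :
    ∃ r > 0, ∃ B : ℝ, ∀ y z, dist y z ≤ r → ∀ h > 0, dist y z ≤ R * h →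
      fundamentalSolution H h y z ≤ B * h := by
  obtain ⟨r, hr, C, hC, h⟩ := hH.exists_mem_actionSet
  obtain ⟨B, hB⟩ := hH.exists_lagrangian_le (C * |R|)
  refine ⟨r, hr, B, fun y z hyz k hk hd ↦ ?_⟩
  obtain ⟨a, ha, hle⟩ := h y z hyz k hk |R| (abs_nonneg R)
    (hd.trans (by gcongr; exact le_abs_self R)) B hB
  exact (hH.fundamentalSolution_le hk.le ha).trans hle

theorem IsTonelli.fundamentalSolution_add_le (hH : IsTonelli H) (hs : 0 < s) (ht : 0 < t)
    (x y z : M) : fundamentalSolution H (s + t) x z ≤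
      fundamentalSolution H s x y + fundamentalSolution H t y z := by
  refine le_of_forall_pos_lt_add fun ε hε ↦ ?_
  obtain ⟨a, ha, ha'⟩ := exists_lt_of_csInf_lt (hH.nonempty_actionSet hs x y)
    (show sInf (actionSet H s x y) < fundamentalSolution H s x y + ε / 2 by
      rw [← fundamentalSolution_eq_sInf]; linarith)
  obtain ⟨b, hb, hb'⟩ := exists_lt_of_csInf_lt (hH.nonempty_actionSet ht y z)
    (show sInf (actionSet H t y z) < fundamentalSolution H t y z + ε / 2 by
      rw [← fundamentalSolution_eq_sInf]; linarith)
  have := hH.fundamentalSolution_le (by positivity) (add_mem_actionSet hs.le ht.le ha hb)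
  linarith

theorem IsTonelli.exists_fundamentalSolution_split (hH : IsTonelli H) (hs : 0 < s) (ht : 0 < t)
    (x z : M) {ε : ℝ} (hε : 0 < ε) : ∃ y, fundamentalSolution H s x y +
      fundamentalSolution H t y z < fundamentalSolution H (s + t) x z + ε := by
  obtain ⟨a, ha, ha'⟩ := exists_lt_of_csInf_lt (hH.nonempty_actionSet (add_pos hs ht) x z)
    (show sInf (actionSet H (s + t) x z) < fundamentalSolution H (s + t) x z + ε by
      rw [← fundamentalSolution_eq_sInf]; linarith)
  obtain ⟨y, b, hb, c, hc, rfl⟩ := exists_mem_actionSet_split hs.le ht.le ha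
  have h1 := hH.fundamentalSolution_le hs.le hb
  have h2 := hH.fundamentalSolution_le ht.le hc
  exact ⟨y, by linarith⟩

/-- Local upper bound of the fundamental solution, by the action of a segment. -/
theorem IsTonelli.exists_fundamentalSolution_le_lagrangian (hH : IsTonelli H) (x₀ : M) (w : E)
    {ε : ℝ} (hε : 0 < ε) :
    ∃ δ > 0, ∀ y ∈ Metric.ball x₀ δ, ∀ z ∈ Metric.ball x₀ δ, ∀ τ > (0 : ℝ),
      ‖τ⁻¹ • (extChartAt 𝓘(ℝ, E) x₀ z - extChartAt 𝓘(ℝ, E) x₀ y) - w‖ < δ →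
      fundamentalSolution H τ y z ≤
        (lagrangian H x₀ (w : TangentSpace 𝓘(ℝ, E) x₀) + ε) * τ := by
  have h1 : ∀ᶠ q : M × E in 𝓝 (x₀, w), lagrangian H q.1 (chartDSymm x₀ q.1 q.2) <
      lagrangian H x₀ (w : TangentSpace 𝓘(ℝ, E) x₀) + ε := by
    refine (hH.continuousAt_lagrangian_coord x₀ w).eventually_lt_const ?_
    simp only [chartDSymm_self]
    linarith
  obtain ⟨η, hη, hball⟩ := Metric.eventually_nhds_iff_ball.1 h1
  obtain ⟨r, hr, hseg⟩ := hH.exists_mem_actionSet_segment x₀ (Metric.ball_mem_nhds x₀ hη)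
  refine ⟨min r η, lt_min hr hη, fun y hy z hz τ hτ hw ↦ ?_⟩
  have hr' := Metric.ball_subset_ball (x := x₀) (min_le_left r η)
  obtain ⟨a, ha, hle⟩ := hseg y (hr' hy) z (hr' hz) τ hτ _ fun m hm ↦ by
    refine (hball (m, _) ?_).le
    rw [← ball_prod_same]
    refine ⟨hm, ?_⟩
    rw [Metric.mem_ball, dist_eq_norm]
    exact hw.trans_le (min_le_right _ _)
  exact (hH.fundamentalSolution_le hτ.le ha).trans hle

/-- Integrates L(ξ,ξ') ≥ p(ξ') - H with the covector p constant in the chart, so that the first term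
is an exact derivative. -/
theorem IsTonelli.action_ge_of_mem_ball (hH : IsTonelli H) {x₀ : M} {ρ C : ℝ}
    (hC : ChartBounds E x₀ ρ C) (p : E →L[ℝ] ℝ) {B : ℝ} {U : Set M} (hU : U ⊆ Metric.ball x₀ ρ)
    (hB : ∀ m ∈ U, H m (p ∘L chartD x₀ m) ≤ B) {ξ : ℝ → M} {τ : ℝ} (hτ : 0 ≤ τ)
    (hξ : AbsolutelyContinuousOnInterval ξ 0 τ) (hξU : ∀ s ∈ Icc 0 τ, ξ s ∈ U)
    (hi : IntervalIntegrable (lagrangianAlong H ξ) volume 0 τ) :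
    p (extChartAt 𝓘(ℝ, E) x₀ (ξ τ) - extChartAt 𝓘(ℝ, E) x₀ (ξ 0)) - B * τ ≤
      ∫ s in (0 : ℝ)..τ, lagrangianAlong H ξ s := by
  have hf : AbsolutelyContinuousOnInterval (fun s ↦ p (extChartAt 𝓘(ℝ, E) x₀ (ξ s))) 0 τ := by
    refine hξ.comp_lipschitzOn (g := fun y ↦ p (extChartAt 𝓘(ℝ, E) x₀ y)) (K := ‖p‖ * C)
      fun s hs t ht ↦ ?_
    rw [uIcc_of_le hτ] at hs ht
    rw [dist_comm, dist_eq_norm, ← map_sub, mul_assoc]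
    refine (p.le_opNorm _).trans ?_
    gcongr
    exact hC.norm_sub_le _ (hU (hξU s hs)) _ (hU (hξU t ht))
  have h1 := intervalIntegral_ge_of_deriv (K := 1) (C := B) hτ hf hi ?_
  · simpa using h1
  filter_upwards [hξ.ae_mdifferentiableAt E] with s hs hsI
  have hsU := hξU s (Ioo_subset_Icc_self hsI)
  have hv := hasVelocityAt_mfderiv (hs hsI)
  have hd := p.hasFDerivAt.comp_hasDerivAt s (hv.hasDerivAt_extChart (hC.subset_source (hU hsU)))
  have h2 : deriv (fun s ↦ p (extChartAt 𝓘(ℝ, E) x₀ (ξ s))) s = _ := hd.deriv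
  rw [h2, one_mul]
  have h3 := le_legendre (hH.isTonelliFun (ξ s)).superlinear (p ∘L chartD x₀ (ξ s))
    (mfderiv 𝓘(ℝ, ℝ) 𝓘(ℝ, E) ξ s (1 : ℝ))
  refine le_trans ?_ h3
  exact sub_le_sub_left (hB _ hsU) _

/-- Local lower bound of the fundamental solution. -/
theorem IsTonelli.exists_fundamentalSolution_ge_hamiltonian (hH : IsTonelli H) (x₀ : M)
    (p : E →L[ℝ] ℝ) {ε : ℝ} (hε : 0 < ε) :
    ∃ δ > 0, ∀ y ∈ Metric.ball x₀ δ, ∀ z ∈ Metric.ball x₀ δ, ∀ τ > (0 : ℝ), τ < δ →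
      p (extChartAt 𝓘(ℝ, E) x₀ z - extChartAt 𝓘(ℝ, E) x₀ y) -
        (H x₀ (p ∘L chartD x₀ x₀) + ε) * τ ≤ fundamentalSolution H τ y z := by
  obtain ⟨ρ, C, hC⟩ := exists_chartBounds (E := E) x₀
  have hC0 : 0 < C := by linarith [hC.one_le]
  obtain ⟨C₁, hC₁⟩ := hH.exists_action_ge (K := 1) zero_le_one
  set B := H x₀ (p ∘L chartD x₀ x₀) + ε with hB
  obtain ⟨r, hr, hball⟩ := Metric.mem_nhds_iff.1 (inter_mem
    (hH.eventually_forall_coord_lt x₀ ‖p‖ hε) (Metric.ball_mem_nhds x₀ hC.pos))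
  have hBm : ∀ m ∈ Metric.ball x₀ r, H m (p ∘L chartD x₀ m) ≤ B := fun m hm ↦ by
    have := (abs_lt.1 ((hball hm).1 p (by simp))).2
    rw [hB]
    linarith
  -- A curve from the ball of radius r / N that leaves the r-ball has action at least r - r / N -
  -- |C₁| r / N, by growth with slope 1. The other two terms of N bound the left side, so N * (r /
  -- N) = r pays for everything.
  set N := 1 + |C₁| + ‖p‖ * (2 * C) + |B| with hN
  have hN1 : 1 ≤ N := by
    have : 0 ≤ ‖p‖ * (2 * C) := by positivity
    linarith [abs_nonneg C₁, abs_nonneg B]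
  have hN0 : 0 < N := by linarith
  have hδr : r / N ≤ r := div_le_self hr.le hN1
  refine ⟨r / N, by positivity, fun y hy z hz τ hτ hτδ ↦ ?_⟩
  refine le_csInf (hH.nonempty_actionSet hτ y z) ?_
  rintro _ ⟨ξ, hξ, rfl, rfl, hi, rfl⟩
  by_cases hin : ∀ s ∈ Icc 0 τ, ξ s ∈ Metric.ball x₀ r
  · exact hH.action_ge_of_mem_ball hC p (fun m hm ↦ (hball hm).2) hBm hτ.le hξ hin hi
  push Not at hin
  obtain ⟨s, hs, hsr⟩ := hin
  have s1 : uIcc 0 s ⊆ uIcc 0 τ := by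
    rw [uIcc_of_le hs.1, uIcc_of_le hτ.le]
    exact Icc_subset_Icc_right hs.2
  have s2 : uIcc s τ ⊆ uIcc 0 τ := by
    rw [uIcc_of_le hs.2, uIcc_of_le hτ.le]
    exact Icc_subset_Icc_left hs.1
  have h1 := hC₁ ξ 0 s hs.1 (hξ.mono s1) (hi.mono_set s1)
  have h2 := hC₁ ξ s τ hs.2 (hξ.mono s2) (hi.mono_set s2)
  have h3 := intervalIntegral.integral_add_adjacent_intervals (hi.mono_set s1) (hi.mono_set s2)
  rw [← h3]
  have h4 : r ≤ dist (ξ s) x₀ := not_lt.1 hsr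
  have h5 := dist_triangle_left (ξ s) x₀ (ξ 0)
  have h6 : dist (ξ 0) x₀ < r / N := hy
  have h7 : p (extChartAt 𝓘(ℝ, E) x₀ (ξ τ) - extChartAt 𝓘(ℝ, E) x₀ (ξ 0)) ≤
      ‖p‖ * (2 * C) * (r / N) := by
    refine (le_abs_self _).trans ((p.le_opNorm _).trans ?_)
    rw [mul_assoc]
    gcongr
    refine (hC.norm_sub_le _ (hball (Metric.ball_subset_ball hδr hy)).2 _
      (hball (Metric.ball_subset_ball hδr hz)).2).trans ?_
    have h8 := dist_triangle_right (ξ 0) (ξ τ) x₀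
    have h9 : dist (ξ τ) x₀ < r / N := hz
    have : dist (ξ 0) (ξ τ) ≤ 2 * (r / N) := by linarith
    calc C * dist (ξ 0) (ξ τ) ≤ C * (2 * (r / N)) := by gcongr
      _ = _ := by ring
  have h8 : N * (r / N) = r := by field_simp
  have h9 : -B * τ ≤ |B| * (r / N) := by
    calc -B * τ ≤ |B| * τ := by gcongr; exact neg_le_abs B
      _ ≤ _ := by gcongr
  have h10 : C₁ * τ ≤ |C₁| * (r / N) := by
    calc C₁ * τ ≤ |C₁| * τ := by gcongr; exact le_abs_self C₁
      _ ≤ _ := by gcongr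
  have h11 : 0 ≤ dist (ξ s) (ξ τ) := dist_nonneg
  nlinarith

end Action

/-! ### Velocities of the steps of the scheme -/

section Dual

variable {V : Type*} [NormedAddCommGroup V] [NormedSpace ℝ V]

theorem isClosed_dual_of_approx {S : Set (V →L[ℝ] ℝ)}
    (h : ∀ p, (∀ η > 0, ∃ q ∈ S, ∀ v, |q v - p v| ≤ η * ‖v‖) → p ∈ S) : IsClosed S := by
  refine isClosed_of_closure_subset fun p hp ↦ h p fun η hη ↦ ?_
  obtain ⟨q, hq, hpq⟩ := Metric.mem_closure_iff.1 hp η hη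
  refine ⟨q, hq, fun v ↦ ((q - p).le_opNorm v).trans ?_⟩
  gcongr
  rw [← dist_eq_norm, dist_comm]
  exact hpq.le

theorem isCompact_dual_of_isClosed_of_bound [FiniteDimensional ℝ V] {S : Set (V →L[ℝ] ℝ)}
    (hS : IsClosed S) {K : ℝ} (hK : ∀ p ∈ S, ‖p‖ ≤ K) : IsCompact S := by
  have : ProperSpace (V →L[ℝ] ℝ) := FiniteDimensional.proper ℝ _
  refine (isCompact_closedBall (0 : V →L[ℝ] ℝ) K).of_isClosed_subset hS fun p hp ↦ ?_
  simpa using hK p hp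

theorem continuous_of_apply_eq_fderiv [FiniteDimensional ℝ V] {h : (V →L[ℝ] ℝ) → ℝ}
    (hh : Continuous (fderiv ℝ h)) {f : (V →L[ℝ] ℝ) → V}
    (hf : ∀ p q : V →L[ℝ] ℝ, q (f p) = fderiv ℝ h p q) : Continuous f := by
  set b := Module.finBasis ℝ V
  have h1 : f = fun p ↦ ∑ i, (fderiv ℝ h p (b.coord i).toContinuousLinearMap) • b i := by
    ext p
    conv_lhs => rw [← b.sum_repr (f p)]
    refine Finset.sum_congr rfl fun i _ ↦ ?_
    rw [← hf]
    rfl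
  rw [h1]
  exact continuous_finsetSum _ fun i _ ↦ (hh.clm_apply continuous_const).smul continuous_const

end Dual

section Steps

set_option linter.unusedSectionVars false

variable {E : Type*} [NormedAddCommGroup E] [NormedSpace ℝ E] [FiniteDimensional ℝ E]
  {M : Type*} [MetricSpace M] [ChartedSpace E M] [IsManifold 𝓘(ℝ, E) ∞ M]
  [RiemannianBundle (fun x : M ↦ TangentSpace 𝓘(ℝ, E) x)]
  [IsContMDiffRiemannianBundle 𝓘(ℝ, E) ∞ E (fun x : M ↦ TangentSpace 𝓘(ℝ, E) x)]
  [IsRiemannianManifold 𝓘(ℝ, E) M] [CompactSpace M] [ConnectedSpace M]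
  {H : ∀ x : M, CotSpace E x → ℝ} {φ : M → ℝ}

/-- The tangent space at x₀ is E with another norm. The superdifferential is written with the norm
of E, covectors are measured in the Riemannian one, and this constant mediates. -/
theorem exists_norm_tangent_le (x₀ : M) :
    ∃ C > 0, ∀ u : E, ‖(show TangentSpace 𝓘(ℝ, E) x₀ from u)‖ ≤ C * ‖u‖ := by
  obtain ⟨ρ, C, hC⟩ := exists_chartBounds (E := E) x₀
  refine ⟨C, by linarith [hC.one_le], fun u ↦ ?_⟩
  have h1 := norm_chartDSymm_apply_le x₀ x₀ u
  rw [chartDSymm_self] at h1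
  refine h1.trans ?_
  gcongr
  exact hC.norm_chartDSymm _ (Metric.mem_ball_self hC.pos)

/-- Compare the maximizer with staying at x, which costs O(τ). Growth of A_τ with slope Λ + 1 leaves
one unit of slope after the possible gain Λ d(x,z) in φ. -/
theorem IsTonelli.exists_dist_le_of_isMaxOn (hH : IsTonelli H) {Λ : ℝ} (hΛ : 0 ≤ Λ)
    (hφ : ∀ y z, |φ y - φ z| ≤ Λ * dist y z) : ∃ R ≥ 0, ∀ τ > 0, ∀ x z,
      IsMaxOn (fun y ↦ φ y - fundamentalSolution H τ x y) univ z → dist x z ≤ R * τ := by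
  obtain ⟨C, hC⟩ := hH.exists_fundamentalSolution_ge (K := Λ + 1) (by linarith)
  obtain ⟨r, hr, B, hB⟩ := hH.exists_fundamentalSolution_le 0
  refine ⟨|B + C|, abs_nonneg _, fun τ hτ x z hz ↦ ?_⟩
  have h1 : φ x - fundamentalSolution H τ x x ≤ φ z - fundamentalSolution H τ x z :=
    hz (mem_univ x)
  have h2 := hB x x (by simp [hr.le]) τ hτ (by simp)
  have h3 := hC τ hτ x z
  have h4 := (abs_le.1 (hφ x z)).1
  have h5 : (B + C) * τ ≤ |B + C| * τ := by gcongr; exact le_abs_self _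
  linarith

theorem isClosed_superdifferential (φ : M → ℝ) (x₀ : M) :
    IsClosed (superdifferential E φ x₀) := by
  obtain ⟨C, hC, hCu⟩ := exists_norm_tangent_le (E := E) x₀
  refine isClosed_dual_of_approx (V := TangentSpace 𝓘(ℝ, E) x₀) fun p hp ε hε ↦ ?_
  obtain ⟨p', hp', hpp'⟩ := hp (ε / (2 * C)) (by positivity)
  filter_upwards [hp' (ε / 2) (by positivity)] with y hy
  set v : E := extChartAt 𝓘(ℝ, E) x₀ y - extChartAt 𝓘(ℝ, E) x₀ x₀
  have h1 : p' v - p v ≤ ε / 2 * ‖v‖ := by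
    refine (le_abs_self _).trans ((hpp' v).trans ?_)
    calc _ ≤ ε / (2 * C) * (C * ‖v‖) := by
          gcongr
          exact hCu v
      _ = _ := by field_simp
  linarith

/-- Along a short ray from x₀ the Lipschitz bound limits the decrease of φ, hence bounds p v from
below; v and -v together bound ‖p‖. -/
theorem exists_norm_le_of_mem_superdifferential {Λ : ℝ} (hΛ : 0 ≤ Λ)
    (hφ : ∀ y z, |φ y - φ z| ≤ Λ * dist y z) (x₀ : M) :
    ∃ K, ∀ p ∈ superdifferential E φ x₀, ‖p‖ ≤ K := by
  obtain ⟨ρ, C, hC⟩ := exists_chartBounds (E := E) x₀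
  have hC0 : 0 < C := by linarith [hC.one_le]
  obtain ⟨r, hr, hpt⟩ := exists_ball_extChart_symm_mem (E := E) x₀ (Metric.ball_mem_nhds x₀ hC.pos)
  set e := extChartAt 𝓘(ℝ, E) x₀ with he
  refine ⟨(Λ * C + 1) * C, fun p hp ↦ ?_⟩
  have key : ∀ v : E, -((Λ * C + 1) * ‖v‖) ≤ p v := by
    intro v
    have hc : Tendsto (fun t : ℝ ↦ e x₀ + t • v) (𝓝[>] 0) (𝓝 (e x₀)) := by
      refine Tendsto.mono_left ?_ nhdsWithin_le_nhds
      have : Continuous fun t : ℝ ↦ e x₀ + t • v := by fun_prop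
      simpa using this.tendsto 0
    have hψ : Tendsto (fun t : ℝ ↦ e.symm (e x₀ + t • v)) (𝓝[>] 0) (𝓝 x₀) := by
      have := (continuousAt_extChartAt_symm (I := 𝓘(ℝ, E)) x₀).tendsto.comp hc
      rwa [extChartAt_to_inv] at this
    obtain ⟨t, ht, hball, hsup⟩ := (eventually_mem_nhdsWithin.and
      ((hc.eventually (Metric.ball_mem_nhds _ hr)).and (hψ.eventually (hp 1 one_pos)))).exists
    have ht0 : 0 < t := ht
    obtain ⟨h1, -, h2⟩ := hpt _ hball
    have h3 := (abs_le.1 (hφ (e.symm (e x₀ + t • v)) x₀)).1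
    have h4 := hC.dist_le _ (Metric.mem_ball_self hC.pos) _ h1
    rw [← he] at hsup
    rw [dist_comm, h2] at h4
    rw [h2] at hsup
    rw [add_sub_cancel_left, norm_smul, Real.norm_of_nonneg ht0.le] at h4 hsup
    have h5 : p (t • v : E) = t * p v := p.map_smul t v
    rw [h5] at hsup
    have h6 : Λ * dist (e.symm (e x₀ + t • v)) x₀ ≤ Λ * (C * (t * ‖v‖)) := by gcongr
    refine le_of_mul_le_mul_left ?_ ht0
    linarith
  refine p.opNorm_le_bound (by positivity) fun v ↦ ?_
  have hv : ‖(show E from v)‖ ≤ C * ‖v‖ := by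
    have := norm_chartD_apply_le x₀ x₀ v
    rw [chartD_self] at this
    refine this.trans ?_
    gcongr
    exact hC.norm_chartD _ (Metric.mem_ball_self hC.pos)
  have h1 := key v
  have h2 := key (-(show E from v))
  have h3 : p (-(show E from v) : E) = - p v := p.map_neg v
  rw [norm_neg, h3] at h2
  have h4 : (Λ * C + 1) * ‖(show E from v)‖ ≤ (Λ * C + 1) * (C * ‖v‖) := by gcongr
  rw [Real.norm_eq_abs, abs_le, mul_assoc]
  exact ⟨by linarith [show -((Λ * C + 1) * ‖(show E from v)‖) ≤ p v from h1], by linarith⟩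

theorem isCompact_superdifferential {Λ : ℝ} (hΛ : 0 ≤ Λ)
    (hφ : ∀ y z, |φ y - φ z| ≤ Λ * dist y z) (x₀ : M) : IsCompact (superdifferential E φ x₀) := by
  obtain ⟨K, hK⟩ := exists_norm_le_of_mem_superdifferential (E := E) hΛ hφ x₀
  exact isCompact_dual_of_isClosed_of_bound (V := TangentSpace 𝓘(ℝ, E) x₀)
    (isClosed_superdifferential φ x₀) hK

theorem IsTonelli.continuous_fibreDeriv (hH : IsTonelli H) (x₀ : M) :
    Continuous (fibreDeriv H x₀) := by
  exact continuous_of_apply_eq_fderiv (V := TangentSpace 𝓘(ℝ, E) x₀)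
    ((hH.isTonelliFun x₀).contDiff.continuous_fderiv (by norm_num)) (apply_fibreDeriv H x₀)

/-- The velocities `H_p(x₀, D⁺φ(x₀))`, in the chart at `x₀`. -/
def velocitySet (φ : M → ℝ) (H : ∀ x : M, CotSpace E x → ℝ) (x₀ : M) : Set E :=
  (fibreDeriv H x₀ '' superdifferential E φ x₀ : Set (TangentSpace 𝓘(ℝ, E) x₀))

theorem IsTonelli.isCompact_velocitySet (hH : IsTonelli H) {Λ : ℝ} (hΛ : 0 ≤ Λ)
    (hφ : ∀ y z, |φ y - φ z| ≤ Λ * dist y z) (x₀ : M) : IsCompact (velocitySet φ H x₀) :=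
  (isCompact_superdifferential hΛ hφ x₀).image (hH.continuous_fibreDeriv x₀)

end Steps

/-! ### Blow-up of the steps: limit velocities are reachable -/

section StepLimits

set_option linter.unusedSectionVars false

variable {E : Type*} [NormedAddCommGroup E] [NormedSpace ℝ E] [FiniteDimensional ℝ E]
  {M : Type*} [MetricSpace M] [ChartedSpace E M] [IsManifold 𝓘(ℝ, E) ∞ M]
  [RiemannianBundle (fun x : M ↦ TangentSpace 𝓘(ℝ, E) x)]
  [IsContMDiffRiemannianBundle 𝓘(ℝ, E) ∞ E (fun x : M ↦ TangentSpace 𝓘(ℝ, E) x)]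
  [IsRiemannianManifold 𝓘(ℝ, E) M] [CompactSpace M] [ConnectedSpace M]
  {H : ∀ x : M, CotSpace E x → ℝ} {φ : M → ℝ}

/-- The Lagrangian at `x₀`, on the model space. -/
noncomputable def lagrangianAt (H : ∀ x : M, CotSpace E x → ℝ) (x₀ : M) (w : E) : ℝ :=
  lagrangian H x₀ (w : TangentSpace 𝓘(ℝ, E) x₀)

/-- The covector p is the fibre derivative of L at w. The expansion from above is all that a
superdifferential requires. -/
theorem IsTonelli.exists_dual_lagrangianAt (hH : IsTonelli H) (x₀ : M) (w : E) :
    ∃ p : E →L[ℝ] ℝ, lagrangianAt H x₀ w = p w - H x₀ (p ∘L chartD x₀ x₀) ∧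
      fibreDeriv H x₀ (p ∘L chartD x₀ x₀) = w ∧
      ∀ ε > 0, ∃ η > 0, ∀ u : E, ‖u‖ ≤ η →
        lagrangianAt H x₀ (w + u) ≤ lagrangianAt H x₀ w + p u + ε * ‖u‖ := by
  have hT := hH.isTonelliFun x₀
  obtain ⟨p, hp⟩ := hT.exists_legendre_eq (w : TangentSpace 𝓘(ℝ, E) x₀)
  obtain ⟨C, hC, hCu⟩ := exists_norm_tangent_le (E := E) x₀
  refine ⟨(show E →L[ℝ] ℝ from p), ?_, ?_, fun ε hε ↦ ?_⟩
  · rw [comp_chartD_self]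
    exact hp
  · rw [comp_chartD_self]
    refine (SeparatingDual.eq_iff_forall_dual_eq (R := ℝ)
      (V := TangentSpace 𝓘(ℝ, E) x₀)).2 fun q ↦ ?_
    rw [apply_fibreDeriv]
    exact hT.fderiv_eq_of_legendre_eq hp q
  · obtain ⟨η, hη, h⟩ := hT.exists_legendre_add_le hp (ε := ε / C) (by positivity)
    refine ⟨η / C, by positivity, fun u hu ↦ ?_⟩
    have h1 := hCu u
    have h2 := h u (h1.trans (by
      calc C * ‖u‖ ≤ C * (η / C) := by gcongr
        _ = η := by field_simp))
    have h3 : ε / C * ‖(show TangentSpace 𝓘(ℝ, E) x₀ from u)‖ ≤ ε * ‖u‖ := by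
      calc _ ≤ ε / C * (C * ‖u‖) := by gcongr
        _ = _ := by field_simp
    refine le_trans h2 ?_
    exact add_le_add_right h3 _

/-- Test the maximality of z n against z n + τ n q in the chart. The short-time bounds turn the
difference of the two costs into τ n (L(w + q) - L(w)) up to O(ε τ n), and semiconcavity carries the
resulting bound from scale τ n to the scale r, which stays fixed as n → ∞. -/
theorem IsTonelli.exists_step_limit_le (hH : IsTonelli H) (hφ : IsSemiconcave φ) (x₀ : M) :
    ∃ r₀ > 0, ∃ K ≥ (0 : ℝ), ∀ (τ : ℕ → ℝ) (y z : ℕ → M) (w : E), (∀ n, 0 < τ n) →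
      Tendsto τ atTop (𝓝 0) → Tendsto y atTop (𝓝 x₀) → Tendsto z atTop (𝓝 x₀) →
      (∀ n, IsMaxOn (fun m ↦ φ m - fundamentalSolution H (τ n) (y n) m) univ (z n)) →
      Tendsto (fun n ↦ (τ n)⁻¹ • (extChartAt 𝓘(ℝ, E) x₀ (z n) - extChartAt 𝓘(ℝ, E) x₀ (y n)))
        atTop (𝓝 w) →
      ∀ (q : E) (r : ℝ), 0 < r → ‖r • q‖ < r₀ →
        φ ((extChartAt 𝓘(ℝ, E) x₀).symm (extChartAt 𝓘(ℝ, E) x₀ x₀ + r • q)) - φ x₀ ≤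
          r * (lagrangianAt H x₀ (w + q) - lagrangianAt H x₀ w) +
            K * (‖r • q‖ * √‖r • q‖) := by
  obtain ⟨ρ, C, hC⟩ := exists_chartBounds (E := E) x₀
  have hC0 : 0 < C := by linarith [hC.one_le]
  have hφc := hφ.1
  obtain ⟨rS, hrS, K, hK, hsc⟩ := hφ.exists_chart_le (E := E) x₀
  obtain ⟨r₀, hr₀, hpt⟩ := exists_ball_extChart_symm_mem (E := E) x₀
    (inter_mem (Metric.ball_mem_nhds x₀ hrS) (Metric.ball_mem_nhds x₀ hC.pos))
  set e := extChartAt 𝓘(ℝ, E) x₀ with he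
  refine ⟨r₀, hr₀, K * (C * √C), by positivity, fun τ y z w hτ0 hτ hy hz hmax hw q r hr hrq ↦ ?_⟩
  obtain ⟨p, hpL, -, -⟩ := hH.exists_dual_lagrangianAt x₀ w
  have hez : Tendsto (fun n ↦ e (z n)) atTop (𝓝 (e x₀)) :=
    (continuousAt_extChartAt (I := 𝓘(ℝ, E)) x₀).tendsto.comp hz
  have hbq : e x₀ + r • q ∈ Metric.ball (e x₀) r₀ := by simpa [dist_eq_norm] using hrq
  have hcb : Tendsto (fun n ↦ e (z n) + r • q) atTop (𝓝 (e x₀ + r • q)) := hez.add_const _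
  have hcm : Tendsto (fun n ↦ e (z n) + τ n • q) atTop (𝓝 (e x₀)) := by
    simpa using hez.add (hτ.smul_const q)
  have hψm : Tendsto (fun n ↦ e.symm (e (z n) + τ n • q)) atTop (𝓝 x₀) := by
    have := (continuousAt_extChartAt_symm (I := 𝓘(ℝ, E)) x₀).tendsto.comp hcm
    rwa [extChartAt_to_inv] at this
  have hψb : Tendsto (fun n ↦ e.symm (e (z n) + r • q)) atTop (𝓝 (e.symm (e x₀ + r • q))) :=
    (continuousAt_extChartAt_symm'' (hpt _ hbq).2.1).tendsto.comp hcb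
  set b := e.symm (e x₀ + r • q) with hb
  have hD : dist x₀ b ≤ C * ‖r • q‖ := by
    have := hC.dist_le x₀ (Metric.mem_ball_self hC.pos) b (hpt _ hbq).1.2
    rwa [← he, (hpt _ hbq).2.2, add_sub_cancel_left] at this
  have key : ∀ ε > 0, φ b - φ x₀ - K * (dist x₀ b * √(dist x₀ b)) ≤
      r * (lagrangianAt H x₀ (w + q) - lagrangianAt H x₀ w + 3 * ε) := by
    intro ε hε
    obtain ⟨δ₁, hδ₁, hU⟩ := hH.exists_fundamentalSolution_le_lagrangian x₀ (w + q) hε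
    obtain ⟨δ₂, hδ₂, hLo⟩ := hH.exists_fundamentalSolution_ge_hamiltonian x₀ p hε
    have hlim : Tendsto (fun n ↦ φ (e.symm (e (z n) + r • q)) - φ (z n) -
        K * (dist (z n) (e.symm (e (z n) + r • q)) * √(dist (z n) (e.symm (e (z n) + r • q)))))
        atTop (𝓝 (φ b - φ x₀ - K * (dist x₀ b * √(dist x₀ b)))) := by
      have h1 := hz.dist hψb
      refine (((hφc.tendsto _).comp hψb).sub ((hφc.tendsto _).comp hz)).sub ?_
      exact (h1.mul (Real.continuous_sqrt.continuousAt.tendsto.comp h1)).const_mul K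
    refine le_of_tendsto hlim ?_
    have hwq : Tendsto (fun n ↦ (τ n)⁻¹ • (e (z n) - e (y n)) + q) atTop (𝓝 (w + q)) :=
      hw.add_const q
    have hpw : ∀ᶠ n in atTop, p w - ε < p ((τ n)⁻¹ • (e (z n) - e (y n))) :=
      ((p.continuous.tendsto w).comp hw).eventually_const_lt (by linarith)
    filter_upwards [hz.eventually (Metric.ball_mem_nhds x₀ hrS),
      hcb.eventually (Metric.isOpen_ball.mem_nhds hbq), hcm.eventually (Metric.ball_mem_nhds _ hr₀),
      hτ.eventually_lt_const hr, hy.eventually (Metric.ball_mem_nhds x₀ hδ₁),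
      hψm.eventually (Metric.ball_mem_nhds x₀ hδ₁), hwq.eventually (Metric.ball_mem_nhds _ hδ₁),
      hy.eventually (Metric.ball_mem_nhds x₀ hδ₂), hz.eventually (Metric.ball_mem_nhds x₀ hδ₂),
      hτ.eventually_lt_const hδ₂, hpw] with n h1 h2 h3 h4 h5 h6 h7 h8 h9 h10 h11
    set bn := e.symm (e (z n) + r • q)
    set mn := e.symm (e (z n) + τ n • q)
    set D := dist (z n) bn * √(dist (z n) bn)
    have hτn := hτ0 n
    obtain ⟨hbnS, -, hebn⟩ := hpt _ h2
    obtain ⟨hmnS, -, hemn⟩ := hpt _ h3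
    have hA1 := hU (y n) h5 mn h6 (τ n) hτn (by
      rw [← he, hemn, add_sub_right_comm, smul_add, inv_smul_smul₀ hτn.ne', ← dist_eq_norm]
      exact h7)
    have hA2 := hLo (y n) h8 (z n) h9 (τ n) hτn h10
    have hmx : φ mn - fundamentalSolution H (τ n) (y n) mn ≤
        φ (z n) - fundamentalSolution H (τ n) (y n) (z n) := hmax n (mem_univ mn)
    have hs : τ n / r ∈ Icc (0 : ℝ) 1 := ⟨by positivity, (div_le_one hr).2 h4.le⟩
    -- The competitor divides the chart segment from z n to bn at the fraction τ n / r. The error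
    -- carries this same factor, so it survives the later multiplication by r / τ n as K D, bounded
    -- in n.
    have hsc' := hsc (z n) h1 bn hbnS.1 mn hmnS.1 (τ n / r) hs (by
      rw [hemn, hebn, add_sub_cancel_left, smul_smul, div_mul_cancel₀ _ hr.ne'])
    have hp1 : p (e (z n) - e (y n)) = τ n * p ((τ n)⁻¹ • (e (z n) - e (y n))) := by
      rw [map_smul, smul_eq_mul, mul_inv_cancel_left₀ hτn.ne']
    rw [← he, hp1] at hA2
    have hp2 : τ n * (p w - ε) ≤ τ n * p ((τ n)⁻¹ • (e (z n) - e (y n))) := by gcongr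
    have hmain : τ n / r * (φ bn - φ (z n) - K * D) ≤
        τ n * (lagrangianAt H x₀ (w + q) - lagrangianAt H x₀ w + 3 * ε) := by
      rw [hpL]
      have : lagrangianAt H x₀ (w + q) = lagrangian H x₀ (w + q : E) := rfl
      rw [this]
      linarith
    have h12 := mul_le_mul_of_nonneg_left hmain (show 0 ≤ r / τ n by positivity)
    calc _ = r / τ n * (τ n / r * (φ bn - φ (z n) - K * D)) := by field_simp
      _ ≤ _ := h12
      _ = _ := by field_simp
  have h1 : φ b - φ x₀ - K * (dist x₀ b * √(dist x₀ b)) ≤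
      r * (lagrangianAt H x₀ (w + q) - lagrangianAt H x₀ w) := by
    refine le_of_forall_pos_le_add fun ε hε ↦ ?_
    have := key (ε / (3 * r)) (by positivity)
    refine this.trans_eq ?_
    field_simp
  have h2 : dist x₀ b * √(dist x₀ b) ≤ C * √C * (‖r • q‖ * √‖r • q‖) := by
    calc _ ≤ C * ‖r • q‖ * √(C * ‖r • q‖) := by gcongr
      _ = _ := by rw [Real.sqrt_mul hC0.le]; ring
  have h3 := mul_le_mul_of_nonneg_left h2 hK
  linarith

/-- Limits of the velocities of the steps of the scheme are reachable velocities. -/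
theorem IsTonelli.mem_velocitySet_of_tendsto (hH : IsTonelli H) (hφ : IsSemiconcave φ) {x₀ : M}
    {τ : ℕ → ℝ} {y z : ℕ → M} {w : E} (hτ0 : ∀ n, 0 < τ n) (hτ : Tendsto τ atTop (𝓝 0))
    (hy : Tendsto y atTop (𝓝 x₀)) (hz : Tendsto z atTop (𝓝 x₀))
    (hmax : ∀ n, IsMaxOn (fun m ↦ φ m - fundamentalSolution H (τ n) (y n) m) univ (z n))
    (hw : Tendsto (fun n ↦ (τ n)⁻¹ •
      (extChartAt 𝓘(ℝ, E) x₀ (z n) - extChartAt 𝓘(ℝ, E) x₀ (y n))) atTop (𝓝 w)) :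
    w ∈ velocitySet φ H x₀ := by
  obtain ⟨r₀, hr₀, K, hK, h⟩ := hH.exists_step_limit_le hφ x₀
  replace h := h τ y z w hτ0 hτ hy hz hmax hw
  obtain ⟨p, hpL, hpw, hpη⟩ := hH.exists_dual_lagrangianAt x₀ w
  refine ⟨p ∘L chartD x₀ x₀, fun ε hε ↦ ?_, hpw⟩
  obtain ⟨η, hη, hη'⟩ := hpη (ε / 2) (by positivity)
  set e := extChartAt 𝓘(ℝ, E) x₀ with he
  have hlim : Tendsto (fun m ↦ e m - e x₀) (𝓝 x₀) (𝓝 0) := by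
    have := (continuousAt_extChartAt (I := 𝓘(ℝ, E)) x₀).tendsto.sub_const (e x₀)
    rwa [← he, sub_self] at this
  have hsq : ∀ᶠ m in 𝓝 x₀, K * √‖e m - e x₀‖ < ε / 2 := by
    have h1 : Tendsto (fun v : E ↦ K * √‖v‖) (𝓝 0) (𝓝 (K * √‖(0 : E)‖)) :=
      Continuous.tendsto (by fun_prop) 0
    refine (h1.comp hlim).eventually_lt_const ?_
    simpa using half_pos hε
  filter_upwards [hsq, hlim.eventually (Metric.ball_mem_nhds 0 hr₀),
    extChartAt_source_mem_nhds (I := 𝓘(ℝ, E)) x₀] with m h1 h2 h3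
  set v := e m - e x₀ with hv
  have hpv : (p ∘L chartD x₀ x₀) v = p v := congrArg p (chartD_self (E := E) x₀ v)
  rw [hpv]
  rcases eq_or_ne v 0 with h0 | h0
  · have hm : m = x₀ := e.injOn h3 (mem_extChartAt_source x₀) (sub_eq_zero.1 h0)
    simp [h0, hm]
  have hv0 : 0 < ‖v‖ := norm_pos_iff.2 h0
  -- The increment v is split as r q with ‖q‖ = η fixed and r = ‖v‖ / η. The expansion of L is then
  -- used at one scale η, while the error of order ‖v‖^(3/2) is negligible before ‖v‖.
  have hrq : (‖v‖ / η) • ((η / ‖v‖) • v) = v := by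
    rw [smul_smul, div_mul_div_comm, mul_comm, div_self (by positivity), one_smul]
  have h4 := h ((η / ‖v‖) • v) (‖v‖ / η) (by positivity) (by
    rw [hrq]
    simpa using h2)
  rw [hrq, hv, add_sub_cancel, e.left_inv h3, ← hv] at h4
  have hqn : ‖(η / ‖v‖) • v‖ = η := by
    rw [norm_smul, Real.norm_of_nonneg (by positivity)]
    field_simp
  have h5 := hη' _ hqn.le
  rw [hqn, map_smul, smul_eq_mul] at h5
  have h6 : ‖v‖ / η * (lagrangianAt H x₀ (w + (η / ‖v‖) • v) - lagrangianAt H x₀ w) ≤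
      ‖v‖ / η * (η / ‖v‖ * p v + ε / 2 * η) := by
    gcongr
    linarith
  have h7 : ‖v‖ / η * (η / ‖v‖ * p v + ε / 2 * η) = p v + ε / 2 * ‖v‖ := by field_simp
  have h8 : K * (‖v‖ * √‖v‖) ≤ ε / 2 * ‖v‖ := by
    calc K * (‖v‖ * √‖v‖) = K * √‖v‖ * ‖v‖ := by ring
      _ ≤ _ := by gcongr
  linarith

/-- The velocities of short steps of the scheme are almost reachable velocities. -/
theorem IsTonelli.exists_step_mem_thickening (hH : IsTonelli H) (hφ : IsSemiconcave φ) (x₀ : M)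
    {ε : ℝ} (hε : 0 < ε) : ∃ δ > 0, ∀ τ > 0, τ < δ → ∀ y ∈ Metric.ball x₀ δ,
      ∀ z ∈ Metric.ball x₀ δ,
      IsMaxOn (fun m ↦ φ m - fundamentalSolution H τ y m) univ z →
      τ⁻¹ • (extChartAt 𝓘(ℝ, E) x₀ z - extChartAt 𝓘(ℝ, E) x₀ y) ∈
        Metric.thickening ε (velocitySet φ H x₀) := by
  obtain ⟨Λ, hΛ, hLip⟩ := hφ.exists_abs_sub_le E
  obtain ⟨R, hR, hstep⟩ := hH.exists_dist_le_of_isMaxOn hΛ hLip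
  obtain ⟨ρ, C, hC⟩ := exists_chartBounds (E := E) x₀
  have hC0 : 0 < C := by linarith [hC.one_le]
  set e := extChartAt 𝓘(ℝ, E) x₀ with he
  by_contra hcon
  push Not at hcon
  have hpos : ∀ n : ℕ, 0 < min ρ (1 / ((n : ℝ) + 1)) := fun n ↦ lt_min hC.pos (by positivity)
  choose τ hτ0 hτ y hy z hz hmax hnot using fun n : ℕ ↦ hcon _ (hpos n)
  have hu : Tendsto (fun n : ℕ ↦ 1 / ((n : ℝ) + 1)) atTop (𝓝 0) :=
    tendsto_one_div_add_atTop_nhds_zero_nat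
  have hτ' : Tendsto τ atTop (𝓝 0) :=
    squeeze_zero (fun n ↦ (hτ0 n).le) (fun n ↦ (hτ n).le.trans (min_le_right _ _)) hu
  have hball : ∀ {m : ℕ → M}, (∀ n : ℕ, m n ∈ Metric.ball x₀ (min ρ (1 / ((n : ℝ) + 1)))) →
      Tendsto m atTop (𝓝 x₀) := fun {m} hm ↦ tendsto_iff_dist_tendsto_zero.2
    (squeeze_zero (fun _ ↦ dist_nonneg)
      (fun n ↦ (Metric.mem_ball.1 (hm n)).le.trans (min_le_right _ _)) hu)
  have hbdd : ∀ n, (τ n)⁻¹ • (e (z n) - e (y n)) ∈ Metric.closedBall (0 : E) (C * R) := fun n ↦ by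
    have h1 := hτ0 n
    rw [mem_closedBall_zero_iff, norm_smul, norm_inv, Real.norm_of_nonneg h1.le]
    have h2 := hC.norm_sub_le (y n) (Metric.ball_subset_ball (min_le_left _ _) (hy n)) (z n)
      (Metric.ball_subset_ball (min_le_left _ _) (hz n))
    calc _ ≤ (τ n)⁻¹ * (C * (R * τ n)) := by
          gcongr
          exact h2.trans (by gcongr; exact hstep _ h1 _ _ (hmax n))
      _ = C * R := by field_simp
  have : ProperSpace E := FiniteDimensional.proper ℝ E
  obtain ⟨w, -, k, hk, hw⟩ := (isCompact_closedBall (0 : E) (C * R)).tendsto_subseq hbdd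
  have hwS : w ∈ velocitySet φ H x₀ :=
    hH.mem_velocitySet_of_tendsto hφ (fun n ↦ hτ0 (k n)) (hτ'.comp hk.tendsto_atTop)
      ((hball hy).comp hk.tendsto_atTop) ((hball hz).comp hk.tendsto_atTop)
      (fun n ↦ hmax (k n)) hw
  obtain ⟨n, hn⟩ := (hw.eventually (Metric.isOpen_thickening.mem_nhds
    (Metric.self_subset_thickening hε _ hwS))).exists
  exact hnot (k n) hn

end StepLimits

/-! ### Minimizing movements are generalized characteristics -/

/-- The convex hull of a compact set is compact, in finite dimension. -/
theorem IsCompact.convexHull_of_finiteDimensional {V : Type*} [NormedAddCommGroup V]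
    [NormedSpace ℝ V] [FiniteDimensional ℝ V] {S : Set V} (hS : IsCompact S) :
    IsCompact (convexHull ℝ S) := by
  set K : ℕ → Set V := fun n ↦ (fun q : (Fin n → ℝ) × (Fin n → V) ↦ ∑ i, q.1 i • q.2 i) ''
    (stdSimplex ℝ (Fin n) ×ˢ univ.pi fun _ ↦ S) with hK
  have hKc : ∀ n, IsCompact (K n) := fun n ↦
    ((isCompact_stdSimplex ℝ (Fin n)).prod (isCompact_univ_pi fun _ ↦ hS)).image (by fun_prop)
  -- Carathéodory: at most finrank + 1 affinely independent points are needed, hence the range up to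
  -- finrank + 2.
  have heq : convexHull ℝ S = ⋃ n ∈ Finset.range (Module.finrank ℝ V + 2), K n := by
    refine Subset.antisymm (fun x hx ↦ ?_) (iUnion₂_subset fun n _ ↦ ?_)
    · obtain ⟨ι, _, z, w, hz, hind, hw, hw1, rfl⟩ := eq_pos_convex_span_of_mem_convexHull hx
      refine mem_iUnion₂.2 ⟨Fintype.card ι, ?_, ?_⟩
      · have h1 := hind.card_le_finrank_succ
        have h2 := Submodule.finrank_le (vectorSpan ℝ (range z))
        rw [Finset.mem_range]
        omega
      · set f := (Fintype.equivFin ι).symm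
        refine ⟨(fun i ↦ w (f i), fun i ↦ z (f i)), ⟨⟨fun i ↦ (hw _).le, ?_⟩,
          fun i _ ↦ hz ⟨_, rfl⟩⟩, ?_⟩
        · exact (f.sum_comp w).trans hw1
        · exact f.sum_comp fun i ↦ w i • z i
    · rintro _ ⟨⟨w, z⟩, ⟨hw, hz⟩, rfl⟩
      exact (convex_convexHull ℝ S).sum_mem (fun i _ ↦ hw.1 i) hw.2
        fun i _ ↦ subset_convexHull ℝ S (hz i (mem_univ i))
  rw [heq]
  exact (Finset.range _).isCompact_biUnion fun n _ ↦ hKc n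

section MinimizingMovements

set_option linter.unusedSectionVars false

variable {E : Type*} [NormedAddCommGroup E] [NormedSpace ℝ E] [FiniteDimensional ℝ E]
  {M : Type*} [MetricSpace M] [ChartedSpace E M] [IsManifold 𝓘(ℝ, E) ∞ M]
  [RiemannianBundle (fun x : M ↦ TangentSpace 𝓘(ℝ, E) x)]
  [IsContMDiffRiemannianBundle 𝓘(ℝ, E) ∞ E (fun x : M ↦ TangentSpace 𝓘(ℝ, E) x)]
  [IsRiemannianManifold 𝓘(ℝ, E) M] [CompactSpace M] [ConnectedSpace M]
  {H : ∀ x : M, CotSpace E x → ℝ} {φ : M → ℝ}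

theorem TendstoOnCompacts.tendsto {X : Type*} [MetricSpace X] {u : ℕ → ℝ → X} {w : ℝ → X}
    (h : TendstoOnCompacts u w) {t : ℝ} (ht : 0 ≤ t) :
    Tendsto (fun j ↦ u j t) atTop (𝓝 (w t)) :=
  (h {t} (by simpa using ht) isCompact_singleton).tendsto_at rfl

theorem tendsto_mul_floor_div {τ : ℕ → ℝ} (hτ0 : ∀ j, 0 < τ j) (hτ : Tendsto τ atTop (𝓝 0))
    {s : ℝ} (hs : 0 ≤ s) : Tendsto (fun j ↦ τ j * ⌊s / τ j⌋₊) atTop (𝓝 s) := by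
  have h1 : Tendsto (fun j ↦ s - τ j) atTop (𝓝 s) := by simpa using hτ.const_sub s
  refine tendsto_of_tendsto_of_tendsto_of_le_of_le h1 tendsto_const_nhds (fun j ↦ ?_) fun j ↦ ?_
  · have h2 := (Nat.lt_floor_add_one (s / τ j)).le
    rw [div_le_iff₀ (hτ0 j)] at h2
    simp only
    linarith
  · have h2 := Nat.floor_le (div_nonneg hs (hτ0 j).le)
    rw [le_div_iff₀ (hτ0 j)] at h2
    simp only
    linarith

theorem dist_le_of_tendsto_piecewiseConstant {X : Type*} [MetricSpace X] {τ : ℕ → ℝ}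
    {z : ℕ → ℕ → X} {γ : ℝ → X} {R : ℝ} (hτ0 : ∀ j, 0 < τ j)
    (hτ : Tendsto τ atTop (𝓝 0)) (hz : ∀ j k, dist (z j k) (z j (k + 1)) ≤ R * τ j)
    (hγ : TendstoOnCompacts (fun j t ↦ z j ⌊t / τ j⌋₊) γ) {s t : ℝ} (hs : 0 ≤ s) (hst : s ≤ t) :
    dist (γ s) (γ t) ≤ R * (t - s) := by
  have h1 : Tendsto (fun j ↦ R * (τ j * ⌊t / τ j⌋₊ - τ j * ⌊s / τ j⌋₊)) atTop
      (𝓝 (R * (t - s))) :=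
    ((tendsto_mul_floor_div hτ0 hτ (hs.trans hst)).sub
      (tendsto_mul_floor_div hτ0 hτ hs)).const_mul R
  refine le_of_tendsto_of_tendsto' ((hγ.tendsto hs).dist (hγ.tendsto (hs.trans hst))) h1
    fun j ↦ ?_
  have hle : ⌊s / τ j⌋₊ ≤ ⌊t / τ j⌋₊ :=
    Nat.floor_le_floor (div_le_div_of_nonneg_right hst (hτ0 j).le)
  refine (dist_le_Ico_sum_of_dist_le (f := z j) hle (d := fun _ ↦ R * τ j)
    fun _ _ ↦ hz j _).trans_eq ?_
  rw [Finset.sum_const, Nat.card_Ico, nsmul_eq_mul, Nat.cast_sub hle]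
  ring

/-- The quotient over n steps is the average of the one-step quotients. -/
theorem Convex.inv_smul_sub_mem {Q : Set E} (hQ : Convex ℝ Q) {f : ℕ → E} {n : ℕ} (hn : 0 < n)
    {τ : ℝ} (h : ∀ i < n, τ⁻¹ • (f (i + 1) - f i) ∈ Q) :
    (τ * n)⁻¹ • (f n - f 0) ∈ Q := by
  have hn' : (n : ℝ) ≠ 0 := by positivity
  have h1 : (τ * n)⁻¹ • (f n - f 0) =
      ∑ i ∈ Finset.range n, (n : ℝ)⁻¹ • (τ⁻¹ • (f (i + 1) - f i)) := by
    rw [← Finset.smul_sum, ← Finset.smul_sum, Finset.sum_range_sub, smul_smul, mul_inv, mul_comm]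
  rw [h1]
  refine hQ.sum_mem (fun _ _ ↦ by positivity) ?_ fun i hi ↦ h i (Finset.mem_range.1 hi)
  simp [hn']

/-- In the single chart at γ t, every step between times t and t + h has velocity ε-close to the
velocity set, so the average velocity lies in a closed convex set independent of the step. Pass to
the limit in j, then h → 0, then ε → 0; compactness of the convex hull makes it closed. -/
theorem IsTonelli.velocity_mem_convexHull (hH : IsTonelli H) (hφ : IsSemiconcave φ) {τ : ℕ → ℝ}
    {z : ℕ → ℕ → M} {γ : ℝ → M} (hτ0 : ∀ j, 0 < τ j) (hτ : Tendsto τ atTop (𝓝 0))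
    (hmax : ∀ j k, IsMaxOn (fun y ↦ φ y - fundamentalSolution H (τ j) (z j k) y) univ
      (z j (k + 1)))
    (hγ : TendstoOnCompacts (fun j t ↦ z j ⌊t / τ j⌋₊) γ) {R : ℝ} (hR : 0 ≤ R)
    (hLip : ∀ s t, 0 ≤ s → s ≤ t → dist (γ s) (γ t) ≤ R * (t - s)) {t : ℝ} (ht : 0 ≤ t) {v : E}
    (hv : HasDerivAt (fun s ↦ extChartAt 𝓘(ℝ, E) (γ t) (γ s)) v t) :
    v ∈ convexHull ℝ (velocitySet φ H (γ t)) := by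
  obtain ⟨Λ, hΛ, hφL⟩ := hφ.exists_abs_sub_le E
  have hcpt : IsCompact (convexHull ℝ (velocitySet φ H (γ t))) :=
    (hH.isCompact_velocitySet hΛ hφL (γ t)).convexHull_of_finiteDimensional
  rw [← hcpt.isClosed.closure_eq, Metric.closure_eq_iInter_cthickening, mem_iInter₂]
  intro ε hε
  set Q := Metric.cthickening ε (convexHull ℝ (velocitySet φ H (γ t))) with hQ
  have hQconv : Convex ℝ Q := (convex_convexHull ℝ _).cthickening ε
  obtain ⟨ρ, hρ, hsrc⟩ := Metric.mem_nhds_iff.1 (extChartAt_source_mem_nhds (I := 𝓘(ℝ, E)) (γ t))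
  obtain ⟨δ, hδ, hstep⟩ := hH.exists_step_mem_thickening hφ (γ t) hε
  set e := extChartAt 𝓘(ℝ, E) (γ t) with he
  have key : ∀ h, 0 < h → R * h < min (δ / 2) ρ → h⁻¹ • (e (γ (t + h)) - e (γ t)) ∈ Q := by
    intro h hh hhR
    rw [lt_min_iff] at hhR
    have hth : 0 ≤ t + h := by linarith
    have hce : ContinuousAt e (γ (t + h)) := by
      refine continuousAt_extChartAt' (I := 𝓘(ℝ, E)) ?_
      refine hsrc ?_
      have := hLip t (t + h) ht (by linarith)
      rw [add_sub_cancel_left] at this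
      rw [Metric.mem_ball, dist_comm]
      linarith
    have hce' : ContinuousAt e (γ t) := continuousAt_extChartAt (I := 𝓘(ℝ, E)) (γ t)
    have hn : Tendsto (fun j ↦ τ j * ⌊(t + h) / τ j⌋₊ - τ j * ⌊t / τ j⌋₊) atTop (𝓝 h) := by
      simpa using (tendsto_mul_floor_div hτ0 hτ hth).sub (tendsto_mul_floor_div hτ0 hτ ht)
    have hlim : Tendsto (fun j ↦ (τ j * ⌊(t + h) / τ j⌋₊ - τ j * ⌊t / τ j⌋₊)⁻¹ •
        (e (z j ⌊(t + h) / τ j⌋₊) - e (z j ⌊t / τ j⌋₊))) atTop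
        (𝓝 (h⁻¹ • (e (γ (t + h)) - e (γ t)))) :=
      (hn.inv₀ hh.ne').smul
        ((hce.tendsto.comp (hγ.tendsto hth)).sub (hce'.tendsto.comp (hγ.tendsto ht)))
    refine Metric.isClosed_cthickening.mem_of_tendsto hlim ?_
    have hunif := Metric.tendstoUniformlyOn_iff.1
      (hγ (Icc 0 (t + h)) Icc_subset_Ici_self isCompact_Icc) (δ / 2) (half_pos hδ)
    filter_upwards [hunif, hn.eventually_const_lt hh, hτ.eventually_lt_const hδ] with j h1 h2 h3
    have hτj := hτ0 j
    set a := ⌊t / τ j⌋₊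
    set b := ⌊(t + h) / τ j⌋₊
    have hab : a < b := by
      rw [← mul_sub] at h2
      have := pos_of_mul_pos_right h2 hτj.le
      exact_mod_cast sub_pos.1 this
    have hball : ∀ s ∈ Icc t (t + h), z j ⌊s / τ j⌋₊ ∈ Metric.ball (γ t) δ := by
      intro s hs
      have h4 := h1 s ⟨ht.trans hs.1, hs.2⟩
      have h5 := hLip t s ht hs.1
      have h6 : R * (s - t) ≤ R * h := by gcongr; linarith [hs.2]
      have h7 := dist_triangle (γ t) (γ s) (z j ⌊s / τ j⌋₊)
      rw [Metric.mem_ball, dist_comm]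
      linarith
    -- For a < k ≤ b the index k is the floor at the time k τ, which belongs to [t, t + h]. The
    -- index a corresponds to a time that may precede t, so it is read at t itself.
    have hball' : ∀ k, a ≤ k → k ≤ b → z j k ∈ Metric.ball (γ t) δ := by
      intro k hak hkb
      rcases hak.eq_or_lt with rfl | hlt
      · exact hball t ⟨le_rfl, by linarith⟩
      · have h4 : ⌊(k * τ j) / τ j⌋₊ = k := by
          rw [mul_div_cancel_right₀ _ hτj.ne', Nat.floor_natCast]
        rw [← h4]
        refine hball _ ⟨?_, ?_⟩
        · have h5 := (Nat.lt_of_floor_lt hlt).le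
          rwa [div_le_iff₀ hτj] at h5
        · have h5 : (k : ℝ) ≤ (t + h) / τ j :=
            (Nat.cast_le.2 hkb).trans (Nat.floor_le (by positivity))
          rwa [le_div_iff₀ hτj] at h5
    have hmem := hQconv.inv_smul_sub_mem (f := fun i ↦ e (z j (a + i))) (n := b - a)
      (Nat.sub_pos_of_lt hab) (τ := τ j) fun i hi ↦ by
        refine Metric.thickening_subset_cthickening ε _
          (Metric.thickening_subset_of_subset ε (subset_convexHull ℝ _) ?_)
        exact hstep (τ j) hτj h3 _ (hball' (a + i) (by omega) (by omega)) _
          (hball' (a + (i + 1)) (by omega) (by omega)) (hmax j (a + i))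
    simp only [add_zero, Nat.add_sub_cancel' hab.le, Nat.cast_sub hab.le] at hmem
    rwa [mul_sub] at hmem
  -- Right difference quotients suffice, because the two-sided derivative is assumed to exist.
  have hslope : Tendsto (fun h ↦ h⁻¹ • (e (γ (t + h)) - e (γ t))) (𝓝[>] 0) (𝓝 v) :=
    (hasDerivAt_iff_tendsto_slope_zero.1 hv).mono_left
      (nhdsWithin_mono _ fun h hh ↦ (ne_of_gt hh))
  refine Metric.isClosed_cthickening.mem_of_tendsto hslope ?_
  have hsmall : ∀ᶠ h : ℝ in 𝓝[>] 0, R * h < min (δ / 2) ρ := by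
    have : Tendsto (fun h : ℝ ↦ R * h) (𝓝 0) (𝓝 (R * 0)) := Continuous.tendsto (by fun_prop) 0
    refine (this.mono_left nhdsWithin_le_nhds).eventually_lt_const ?_
    rw [mul_zero]
    positivity
  filter_upwards [hsmall, eventually_mem_nhdsWithin] with h h1 h2
  exact key h h2 h1

theorem IsMinimizingMovement.isGeneralizedCharacteristic (hH : IsTonelli H) (hφ : IsSemiconcave φ)
    {x : M} {γ : ℝ → M} (h : IsMinimizingMovement φ H x γ) :
    IsGeneralizedCharacteristic φ H x γ := by
  obtain ⟨τ, z, hτ0, hτ, hz, hγ⟩ := h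
  obtain ⟨Λ, hΛ, hφL⟩ := hφ.exists_abs_sub_le E
  obtain ⟨R, hR, hstep⟩ := hH.exists_dist_le_of_isMaxOn hΛ hφL
  have hLip : ∀ s t, 0 ≤ s → s ≤ t → dist (γ s) (γ t) ≤ R * (t - s) := fun s t hs hst ↦
    dist_le_of_tendsto_piecewiseConstant hτ0 hτ
      (fun j k ↦ hstep (τ j) (hτ0 j) _ _ ((hz j).2 k)) hγ hs hst
  have hLip' : LipschitzOnWith R.toNNReal γ (Ici 0) := by
    refine LipschitzOnWith.of_dist_le_mul fun s hs t ht ↦ ?_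
    rw [Real.coe_toNNReal R hR, Real.dist_eq]
    rcases le_total s t with hst | hst
    · rw [abs_of_nonpos (by linarith), neg_sub]
      exact hLip s t hs hst
    · rw [abs_of_nonneg (by linarith), dist_comm]
      exact hLip t s ht hst
  refine ⟨⟨_, hLip'⟩, ?_, ?_⟩
  · refine tendsto_nhds_unique (hγ.tendsto le_rfl) ?_
    simp [fun j ↦ (hz j).1]
  · rw [ae_restrict_iff' measurableSet_Ici]
    have hac : ∀ n : ℕ, AbsolutelyContinuousOnInterval γ 0 n := fun n ↦
      (hLip'.mono (by rw [uIcc_of_le n.cast_nonneg]; exact Icc_subset_Ici_self)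
        ).absolutelyContinuousOnInterval
    have hne : ∀ᵐ t : ℝ, t ≠ 0 := by simp [ae_iff, measure_singleton]
    filter_upwards [ae_all_iff.2 fun n ↦ (hac n).ae_mdifferentiableAt E, hne] with t ht ht0 htI
    obtain ⟨n, hn⟩ := exists_nat_gt t
    have hv := hasVelocityAt_mfderiv (ht n ⟨lt_of_le_of_ne htI ht0.symm, hn⟩)
    refine ⟨_, ?_, hv⟩
    have hd := hasDerivWithinAt_extChart_of_hasMFDerivWithinAt (hv.hasMFDerivWithinAt (s := univ))
    exact hH.velocity_mem_convexHull hφ hτ0 hτ (fun j ↦ (hz j).2) hγ hR hLip htI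
      (hasDerivWithinAt_univ.1 hd)

end MinimizingMovements

/-! ### The positive Lax-Oleinik semigroup -/

section LaxOleinik

set_option linter.unusedSectionVars false

variable {E : Type*} [NormedAddCommGroup E] [NormedSpace ℝ E] [FiniteDimensional ℝ E]
  {M : Type*} [MetricSpace M] [ChartedSpace E M] [IsManifold 𝓘(ℝ, E) ∞ M]
  [RiemannianBundle (fun x : M ↦ TangentSpace 𝓘(ℝ, E) x)]
  [IsContMDiffRiemannianBundle 𝓘(ℝ, E) ∞ E (fun x : M ↦ TangentSpace 𝓘(ℝ, E) x)]
  [IsRiemannianManifold 𝓘(ℝ, E) M] [CompactSpace M] [ConnectedSpace M]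
  {H : ∀ x : M, CotSpace E x → ℝ} {φ : M → ℝ} {s h : ℝ}

theorem IsTonelli.le_laxOleinikPos (hH : IsTonelli H) (hφ : Continuous φ) (hs : 0 < s) (x y : M) :
    φ y - fundamentalSolution H s x y ≤ laxOleinikPos H φ s x := by
  obtain ⟨C, hC⟩ := hH.exists_fundamentalSolution_ge le_rfl
  obtain ⟨B, hB⟩ := (isCompact_range hφ).bddAbove
  refine le_ciSup (f := fun y ↦ φ y - fundamentalSolution H s x y) ⟨B + C * s, ?_⟩ y
  rintro _ ⟨z, rfl⟩
  have h1 := hC s hs x z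
  have h2 := hB ⟨z, rfl⟩
  simp only
  linarith

theorem exists_laxOleinikPos_lt (x : M) {ε : ℝ} (hε : 0 < ε) :
    ∃ y, laxOleinikPos H φ s x < φ y - fundamentalSolution H s x y + ε := by
  have : Nonempty M := ⟨x⟩
  obtain ⟨y, hy⟩ := exists_lt_of_lt_ciSup
    (show laxOleinikPos H φ s x - ε < ⨆ y, (φ y - fundamentalSolution H s x y) by
      rw [← laxOleinikPos]; linarith)
  exact ⟨y, by linarith⟩

theorem laxOleinikPos_le {x : M} {B : ℝ} (h : ∀ y, φ y - fundamentalSolution H s x y ≤ B) :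
    laxOleinikPos H φ s x ≤ B := by
  have : Nonempty M := ⟨x⟩
  exact ciSup_le h

/-- One half of the dynamic programming principle, from the triangle inequality for A. The other
half, `exists_laxOleinikPos_add_lt`, is kept up to ε because maximizers are not available. -/
theorem IsTonelli.laxOleinikPos_sub_le (hH : IsTonelli H) (hφ : Continuous φ) (hs : 0 < s)
    (hh : 0 < h) (x y : M) :
    laxOleinikPos H φ s y - fundamentalSolution H h x y ≤ laxOleinikPos H φ (h + s) x := by
  rw [sub_le_iff_le_add]
  refine laxOleinikPos_le fun z ↦ ?_
  have h1 := hH.le_laxOleinikPos hφ (add_pos hh hs) x z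
  have h2 := hH.fundamentalSolution_add_le hh hs x y z
  linarith

theorem IsTonelli.exists_laxOleinikPos_add_lt (hH : IsTonelli H) (hφ : Continuous φ) (hs : 0 < s)
    (hh : 0 < h) (x : M) {ε : ℝ} (hε : 0 < ε) : ∃ y, laxOleinikPos H φ (h + s) x <
      laxOleinikPos H φ s y - fundamentalSolution H h x y + ε := by
  obtain ⟨z, hz⟩ := exists_laxOleinikPos_lt (H := H) (φ := φ) (s := h + s) x (half_pos hε)
  obtain ⟨y, hy⟩ := hH.exists_fundamentalSolution_split hh hs x z (half_pos hε)
  have h1 := hH.le_laxOleinikPos hφ hs y z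
  exact ⟨y, by linarith⟩

theorem IsTonelli.exists_abs_laxOleinikPos_sub_le (hH : IsTonelli H) {Λ : ℝ} (hΛ : 0 ≤ Λ)
    (hφ : ∀ y z, |φ y - φ z| ≤ Λ * dist y z) (hc : Continuous φ) :
    ∃ C ≥ 0, ∀ h > 0, ∀ x, |laxOleinikPos H φ h x - φ x| ≤ C * h := by
  obtain ⟨C, hC⟩ := hH.exists_fundamentalSolution_ge hΛ
  obtain ⟨r, hr, B, hB⟩ := hH.exists_fundamentalSolution_le 0
  refine ⟨max |B| |C|, by positivity, fun h hh x ↦ abs_le.2 ⟨?_, ?_⟩⟩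
  · have h1 := hH.le_laxOleinikPos hc hh x x
    have h2 := hB x x (by simp [hr.le]) h hh (by simp)
    have h3 : B * h ≤ max |B| |C| * h := by
      gcongr
      exact (le_abs_self B).trans (le_max_left _ _)
    linarith
  · rw [sub_le_iff_le_add]
    refine laxOleinikPos_le fun y ↦ ?_
    have h1 := hC h hh x y
    have h2 := (abs_le.1 (hφ x y)).1
    have h3 : C * h ≤ max |B| |C| * h := by
      gcongr
      exact (le_abs_self C).trans (le_max_right _ _)
    linarith

/-- Write T⁺ at time h + s as T⁺_s applied to T⁺_hφ, which is uniformly within C h of φ. -/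
theorem IsTonelli.exists_abs_laxOleinikPos_add_sub_le (hH : IsTonelli H) {Λ : ℝ} (hΛ : 0 ≤ Λ)
    (hφ : ∀ y z, |φ y - φ z| ≤ Λ * dist y z) (hc : Continuous φ) :
    ∃ C ≥ 0, ∀ s > 0, ∀ h > 0, ∀ x,
      |laxOleinikPos H φ (h + s) x - laxOleinikPos H φ s x| ≤ C * h := by
  obtain ⟨C, hC0, hC⟩ := hH.exists_abs_laxOleinikPos_sub_le hΛ hφ hc
  refine ⟨C, hC0, fun s hs h hh x ↦ abs_le.2 ⟨?_, ?_⟩⟩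
  · rw [neg_le, neg_sub, sub_le_iff_le_add]
    refine laxOleinikPos_le fun y ↦ ?_
    have h1 := hH.laxOleinikPos_sub_le hc hh hs x y
    have h2 := (abs_le.1 (hC h hh y)).1
    rw [add_comm s h] at h1
    linarith
  · refine le_of_forall_pos_le_add fun ε hε ↦ ?_
    obtain ⟨y, hy⟩ := hH.exists_laxOleinikPos_add_lt hc hh hs x hε
    have h1 := hH.le_laxOleinikPos hc hs x y
    have h2 := (abs_le.1 (hC h hh y)).2
    rw [add_comm s h] at hy
    linarith

/-- Points at distance d are joined in time d at cost O(d), and the extra time d changes T⁺ by O(d).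
Distant points are handled by comparison with φ, which is where the bound S enters. -/
theorem IsTonelli.exists_laxOleinikPos_lipschitz (hH : IsTonelli H) {Λ : ℝ} (hΛ : 0 ≤ Λ)
    (hφ : ∀ y z, |φ y - φ z| ≤ Λ * dist y z) (hc : Continuous φ) (S : ℝ) :
    ∃ K ≥ 0, ∀ s > 0, s ≤ S → ∀ x y,
      |laxOleinikPos H φ s x - laxOleinikPos H φ s y| ≤ K * dist x y := by
  obtain ⟨C, hC0, hC⟩ := hH.exists_abs_laxOleinikPos_sub_le hΛ hφ hc
  obtain ⟨C', hC0', hC'⟩ := hH.exists_abs_laxOleinikPos_add_sub_le hΛ hφ hc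
  obtain ⟨r, hr, B, hB⟩ := hH.exists_fundamentalSolution_le 1
  set K := |B| + C' + (2 * (C * |S|) / r + Λ) with hK
  have hK0 : 0 ≤ 2 * (C * |S|) / r := by positivity
  have key : ∀ s > 0, s ≤ S → ∀ x y,
      laxOleinikPos H φ s x - laxOleinikPos H φ s y ≤ K * dist x y := by
    intro s hs hsS x y
    rcases eq_or_ne x y with rfl | hne
    · simp
    have hd : 0 < dist x y := dist_pos.2 hne
    have e1 : 0 ≤ |B| * dist x y := by positivity
    have e2 : 0 ≤ C' * dist x y := by positivity
    have e3 : 0 ≤ 2 * (C * |S|) / r * dist x y := by positivity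
    have e4 : 0 ≤ Λ * dist x y := by positivity
    rcases le_or_gt (dist x y) r with hle | hgt
    · have h1 := hH.laxOleinikPos_sub_le hc hs hd y x
      have h2 := hB y x (by rwa [dist_comm]) (dist x y) hd (by rw [dist_comm, one_mul])
      have h3 := (abs_le.1 (hC' s hs _ hd y)).2
      have h4 : B * dist x y ≤ |B| * dist x y := by gcongr; exact le_abs_self B
      rw [hK]
      linarith
    · have h1 := (abs_le.1 (hC s hs x)).2
      have h2 := (abs_le.1 (hC s hs y)).1
      have h3 := (abs_le.1 (hφ x y)).2
      have h4 : C * s ≤ C * |S| := by gcongr; exact hsS.trans (le_abs_self S)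
      have h5 : 2 * (C * |S|) ≤ 2 * (C * |S|) / r * dist x y := by
        calc 2 * (C * |S|) = 2 * (C * |S|) / r * r := by field_simp
          _ ≤ _ := by gcongr
      rw [hK]
      linarith
  refine ⟨K, by positivity, fun s hs hsS x y ↦ abs_le.2 ⟨?_, key s hs hsS x y⟩⟩
  have := key s hs hsS y x
  rw [dist_comm] at this
  linarith

end LaxOleinik

/-! ### Calibration along the field `H_p(x, DT⁺_σφ(x))` -/

section Calibration

set_option linter.unusedSectionVars false

variable {E : Type*} [NormedAddCommGroup E] [NormedSpace ℝ E] [FiniteDimensional ℝ E]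
  {M : Type*} [MetricSpace M] [ChartedSpace E M] [IsManifold 𝓘(ℝ, E) ∞ M]
  [RiemannianBundle (fun x : M ↦ TangentSpace 𝓘(ℝ, E) x)]
  [IsContMDiffRiemannianBundle 𝓘(ℝ, E) ∞ E (fun x : M ↦ TangentSpace 𝓘(ℝ, E) x)]
  [IsRiemannianManifold 𝓘(ℝ, E) M] [CompactSpace M] [ConnectedSpace M]
  {H : ∀ x : M, CotSpace E x → ℝ} {φ : M → ℝ}

theorem IsTonelli.eventually_fundamentalSolution_le (hH : IsTonelli H) {x₀ : M} {ι : Type*}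
    {l : Filter ι} {h : ι → ℝ} {y z : ι → M} {w : E} (h0 : ∀ᶠ n in l, 0 < h n)
    (hy : Tendsto y l (𝓝 x₀)) (hz : Tendsto z l (𝓝 x₀))
    (hw : Tendsto (fun n ↦ (h n)⁻¹ •
      (extChartAt 𝓘(ℝ, E) x₀ (z n) - extChartAt 𝓘(ℝ, E) x₀ (y n))) l (𝓝 w)) {ε : ℝ}
    (hε : 0 < ε) :
    ∀ᶠ n in l, fundamentalSolution H (h n) (y n) (z n) ≤ (lagrangianAt H x₀ w + ε) * h n := by
  obtain ⟨δ, hδ, hU⟩ := hH.exists_fundamentalSolution_le_lagrangian x₀ w hε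
  filter_upwards [h0, hy.eventually (Metric.ball_mem_nhds x₀ hδ),
    hz.eventually (Metric.ball_mem_nhds x₀ hδ), hw.eventually (Metric.ball_mem_nhds w hδ)]
    with n h1 h2 h3 h4
  rw [dist_eq_norm] at h4
  exact hU (y n) h2 (z n) h3 (h n) h1 h4

theorem IsTonelli.eventually_le_fundamentalSolution (hH : IsTonelli H) {x₀ : M} {ι : Type*}
    {l : Filter ι} {h : ι → ℝ} {y z : ι → M} {w : E} (h0 : ∀ᶠ n in l, 0 < h n)
    (hh : Tendsto h l (𝓝 0)) (hy : Tendsto y l (𝓝 x₀)) (hz : Tendsto z l (𝓝 x₀))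
    (hw : Tendsto (fun n ↦ (h n)⁻¹ •
      (extChartAt 𝓘(ℝ, E) x₀ (z n) - extChartAt 𝓘(ℝ, E) x₀ (y n))) l (𝓝 w)) {ε : ℝ}
    (hε : 0 < ε) :
    ∀ᶠ n in l, (lagrangianAt H x₀ w - ε) * h n ≤ fundamentalSolution H (h n) (y n) (z n) := by
  obtain ⟨p, hpL, -, -⟩ := hH.exists_dual_lagrangianAt x₀ w
  obtain ⟨δ, hδ, hLo⟩ := hH.exists_fundamentalSolution_ge_hamiltonian x₀ p (half_pos hε)
  have hpw := ((p.continuous.tendsto w).comp hw).eventually_const_lt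
    (show p w - ε / 2 < p w by linarith)
  filter_upwards [h0, hh.eventually_lt_const hδ, hy.eventually (Metric.ball_mem_nhds x₀ hδ),
    hz.eventually (Metric.ball_mem_nhds x₀ hδ), hpw] with n h1 h2 h3 h4 h5
  have h6 := hLo (y n) h3 (z n) h4 (h n) h1 h2
  rw [Function.comp_apply, map_smul, smul_eq_mul, inv_mul_eq_div, lt_div_iff₀ h1] at h5
  rw [hpL]
  linarith

theorem tendsto_extChart_symm_add_smul (x₀ : M) (q : E) {ι : Type*} {l : Filter ι} {h : ι → ℝ}
    (hh : Tendsto h l (𝓝 0)) :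
    Tendsto (fun n ↦ (extChartAt 𝓘(ℝ, E) x₀).symm (extChartAt 𝓘(ℝ, E) x₀ x₀ + h n • q)) l
      (𝓝 x₀) := by
  have h1 : Tendsto (fun n ↦ extChartAt 𝓘(ℝ, E) x₀ x₀ + h n • q) l
      (𝓝 (extChartAt 𝓘(ℝ, E) x₀ x₀)) := by
    simpa using (hh.smul_const q).const_add (extChartAt 𝓘(ℝ, E) x₀ x₀)
  have h2 := (continuousAt_extChartAt_symm (I := 𝓘(ℝ, E)) x₀).tendsto.comp h1
  rwa [extChartAt_to_inv] at h2

theorem eventually_extChart_symm_add_smul (x₀ : M) (q : E) {ι : Type*} {l : Filter ι} {h : ι → ℝ}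
    (hh : Tendsto h l (𝓝 0)) :
    ∀ᶠ n in l, extChartAt 𝓘(ℝ, E) x₀ ((extChartAt 𝓘(ℝ, E) x₀).symm
      (extChartAt 𝓘(ℝ, E) x₀ x₀ + h n • q)) = extChartAt 𝓘(ℝ, E) x₀ x₀ + h n • q := by
  have h1 : Tendsto (fun n ↦ extChartAt 𝓘(ℝ, E) x₀ x₀ + h n • q) l
      (𝓝 (extChartAt 𝓘(ℝ, E) x₀ x₀)) := by
    simpa using (hh.smul_const q).const_add (extChartAt 𝓘(ℝ, E) x₀ x₀)
  filter_upwards [h1.eventually (extChartAt_target_mem_nhds (I := 𝓘(ℝ, E)) x₀)] with n hn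
  exact (extChartAt 𝓘(ℝ, E) x₀).right_inv hn

theorem tendsto_slope_extChart_symm {f : M → ℝ} {x₀ : M} {p : E →L[ℝ] ℝ}
    (hd : HasFDerivAt (fun a ↦ f ((extChartAt 𝓘(ℝ, E) x₀).symm a)) p (extChartAt 𝓘(ℝ, E) x₀ x₀))
    (q : E) {ι : Type*} {l : Filter ι} {h : ι → ℝ} (hh : Tendsto h l (𝓝[≠] 0)) :
    Tendsto (fun n ↦ (h n)⁻¹ * (f ((extChartAt 𝓘(ℝ, E) x₀).symm
      (extChartAt 𝓘(ℝ, E) x₀ x₀ + h n • q)) - f x₀)) l (𝓝 (p q)) := by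
  set e := extChartAt 𝓘(ℝ, E) x₀ with he
  have h1 : HasDerivAt (fun s : ℝ ↦ e x₀ + s • q) q 0 := by
    simpa using ((hasDerivAt_id (0 : ℝ)).smul_const q).const_add (e x₀)
  have h2 : HasDerivAt (fun s : ℝ ↦ f (e.symm (e x₀ + s • q))) (p q) 0 := by
    have hd' : HasFDerivAt (fun a ↦ f (e.symm a)) p (e x₀ + (0 : ℝ) • q) := by
      rw [zero_smul, add_zero]
      exact hd
    exact hd'.comp_hasDerivAt (0 : ℝ) h1
  refine ((hasDerivAt_iff_tendsto_slope_zero.1 h2).comp hh).congr fun n ↦ ?_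
  simp only [Function.comp_apply, zero_add, zero_smul, add_zero, smul_eq_mul]
  rw [he, extChartAt_to_inv]

/-- Limits of the velocities of almost optimal steps satisfy the subgradient inequality. -/
theorem IsTonelli.lagrangianAt_sub_le_of_tendsto (hH : IsTonelli H) (hc : Continuous φ) {σ : ℝ}
    {x₀ : M} {p : E →L[ℝ] ℝ}
    (hd : HasFDerivAt (fun a ↦ laxOleinikPos H φ σ ((extChartAt 𝓘(ℝ, E) x₀).symm a)) p
      (extChartAt 𝓘(ℝ, E) x₀ x₀)) {h : ℕ → ℝ} (h0 : ∀ n, 0 < h n) (hσ : ∀ n, h n < σ)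
    (hh : Tendsto h atTop (𝓝 0)) {y : ℕ → M} (hy : Tendsto y atTop (𝓝 x₀))
    (hopt : ∀ n, laxOleinikPos H φ σ x₀ < laxOleinikPos H φ (σ - h n) (y n) -
      fundamentalSolution H (h n) x₀ (y n) + h n ^ 2) {w : E}
    (hw : Tendsto (fun n ↦ (h n)⁻¹ •
      (extChartAt 𝓘(ℝ, E) x₀ (y n) - extChartAt 𝓘(ℝ, E) x₀ x₀)) atTop (𝓝 w)) (q : E) :
    lagrangianAt H x₀ w - p q ≤ lagrangianAt H x₀ (w - q) := by
  refine le_of_forall_pos_le_add fun ε hε ↦ ?_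
  set e := extChartAt 𝓘(ℝ, E) x₀ with he
  have hm := tendsto_extChart_symm_add_smul x₀ q hh
  have hem := eventually_extChart_symm_add_smul x₀ q hh
  rw [← he] at hm hem
  have hε' : 0 < ε / 4 := by positivity
  have hpos : ∀ᶠ n in atTop, 0 < h n := Eventually.of_forall h0
  have hlo := hH.eventually_le_fundamentalSolution hpos hh (tendsto_const_nhds (x := x₀)) hy hw hε'
  have hup := hH.eventually_fundamentalSolution_le hpos hm hy (w := w - q) (by
    refine (hw.sub_const q).congr' ?_
    filter_upwards [hem] with n hn
    rw [← he, hn, ← sub_sub, smul_sub _ (e (y n) - e x₀), inv_smul_smul₀ (h0 n).ne']) hε'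
  have hder : ∀ᶠ n in atTop, laxOleinikPos H φ σ (e.symm (e x₀ + h n • q)) -
      laxOleinikPos H φ σ x₀ < (p q + ε / 4) * h n := by
    have h3 : Tendsto h atTop (𝓝[≠] 0) := tendsto_nhdsWithin_iff.2
      ⟨hh, Eventually.of_forall fun n ↦ (h0 n).ne'⟩
    filter_upwards [(tendsto_slope_extChart_symm hd q h3).eventually_lt_const
      (show p q < p q + ε / 4 by linarith)] with n hn
    rwa [inv_mul_eq_div, div_lt_iff₀ (h0 n)] at hn
  obtain ⟨n, h1, h2, h3, h4⟩ := (hlo.and (hup.and (hder.and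
    (hh.eventually_lt_const hε')))).exists
  -- The base point is moved by h q while the end point y n is kept, so the step velocity changes
  -- from w to w - q. Differentiability of T⁺_σφ evaluates the left side to first order.
  have h5 := hH.laxOleinikPos_sub_le hc (sub_pos.2 (hσ n)) (h0 n)
    (e.symm (e x₀ + h n • q)) (y n)
  rw [add_sub_cancel] at h5
  have h6 := hopt n
  have h7 : h n ^ 2 ≤ ε / 4 * h n := by
    rw [pow_two]
    exact mul_le_mul_of_nonneg_right h4.le (h0 n).le
  have h8 : (lagrangianAt H x₀ w - p q) * h n ≤ (lagrangianAt H x₀ (w - q) + ε) * h n := by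
    linarith
  exact le_of_mul_le_mul_right h8 (h0 n)

theorem hasFDerivAt_extChart_symm_of_mdifferentiableAt {f : M → ℝ} {x₀ : M}
    (hf : MDifferentiableAt 𝓘(ℝ, E) 𝓘(ℝ, ℝ) f x₀) :
    HasFDerivAt (fun a ↦ f ((extChartAt 𝓘(ℝ, E) x₀).symm a))
      (show E →L[ℝ] ℝ from mfderiv 𝓘(ℝ, E) 𝓘(ℝ, ℝ) f x₀) (extChartAt 𝓘(ℝ, E) x₀ x₀) := by
  have h1 : HasFDerivWithinAt (fun a ↦ f ((extChartAt 𝓘(ℝ, E) x₀).symm a))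
      (show E →L[ℝ] ℝ from mfderiv 𝓘(ℝ, E) 𝓘(ℝ, ℝ) f x₀) (range id)
      (extChartAt 𝓘(ℝ, E) x₀ x₀) := hf.hasMFDerivAt.2
  rwa [range_id, hasFDerivWithinAt_univ] at h1

/-- The optimal velocity `H_p(x₀, DT⁺_σφ(x₀))`, in the chart at `x₀`. -/
noncomputable def optimalVelocity (φ : M → ℝ) (H : ∀ x : M, CotSpace E x → ℝ) (σ : ℝ) (x₀ : M) :
    E :=
  (fibreDeriv H x₀ (mfderiv 𝓘(ℝ, E) 𝓘(ℝ, ℝ) (laxOleinikPos H φ σ) x₀ : CotSpace E x₀) :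
    TangentSpace 𝓘(ℝ, E) x₀)

/-- No differentiability in time is used. Along a sequence of counterexamples, almost optimal first
steps y n have velocities subconverging to some w; the subgradient inequality and
`eq_of_subgradient` force w to be the optimal velocity. Then u and y n are o(h) apart, and the
Lipschitz bound on T⁺ transfers the estimate from y n to u. -/
theorem IsTonelli.eventually_le_laxOleinikPos (hH : IsTonelli H) {Λ : ℝ} (hΛ : 0 ≤ Λ)
    (hφ : ∀ y z, |φ y - φ z| ≤ Λ * dist y z) (hc : Continuous φ) {σ : ℝ} (hσ : 0 < σ) {x₀ : M}
    (hd : MDifferentiableAt 𝓘(ℝ, E) 𝓘(ℝ, ℝ) (laxOleinikPos H φ σ) x₀) {u : ℝ → M}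
    (hu : Tendsto u (𝓝[>] 0) (𝓝 x₀))
    (huv : Tendsto (fun h ↦ h⁻¹ • (extChartAt 𝓘(ℝ, E) x₀ (u h) - extChartAt 𝓘(ℝ, E) x₀ x₀))
      (𝓝[>] 0) (𝓝 (optimalVelocity φ H σ x₀))) {ε : ℝ} (hε : 0 < ε) :
    ∀ᶠ h in 𝓝[>] 0, laxOleinikPos H φ σ x₀ +
      (lagrangianAt H x₀ (optimalVelocity φ H σ x₀) - ε) * h ≤ laxOleinikPos H φ (σ - h) (u h) := by
  obtain ⟨K, hK, hKL⟩ := hH.exists_laxOleinikPos_lipschitz hΛ hφ hc σ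
  obtain ⟨C₁, hC₁, hC₁L⟩ := hH.exists_abs_laxOleinikPos_add_sub_le hΛ hφ hc
  obtain ⟨C₂, hC₂⟩ := hH.exists_fundamentalSolution_ge (K := K + 1) (by positivity)
  obtain ⟨ρ, C, hC⟩ := exists_chartBounds (E := E) x₀
  have hC0 : 0 < C := by linarith [hC.one_le]
  set v := optimalVelocity φ H σ x₀ with hv
  set e := extChartAt 𝓘(ℝ, E) x₀ with he
  by_contra hcon
  have hsmall : ∀ᶠ h : ℝ in 𝓝[>] 0, 0 < h ∧ h < min σ 1 := Ioo_mem_nhdsGT (by positivity)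
  obtain ⟨h, hlim, hh⟩ := exists_seq_forall_of_frequently
    ((not_eventually.1 hcon).and_eventually hsmall)
  have h0 : ∀ n, 0 < h n := fun n ↦ (hh n).2.1
  have hσn : ∀ n, h n < σ := fun n ↦ (hh n).2.2.trans_le (min_le_left _ _)
  have h1n : ∀ n, h n ≤ 1 := fun n ↦ ((hh n).2.2.trans_le (min_le_right _ _)).le
  have hlim0 : Tendsto h atTop (𝓝 0) := hlim.mono_right nhdsWithin_le_nhds
  -- A defect of h², being o(h), disappears from the first-order analysis and replaces the
  -- attainment of the supremum.
  have hy : ∀ n, ∃ y, laxOleinikPos H φ σ x₀ < laxOleinikPos H φ (σ - h n) y -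
      fundamentalSolution H (h n) x₀ y + h n ^ 2 := fun n ↦ by
    have := hH.exists_laxOleinikPos_add_lt hc (sub_pos.2 (hσn n)) (h0 n) x₀ (pow_pos (h0 n) 2)
    rwa [add_sub_cancel] at this
  choose y hy using hy
  set R := C₁ + |C₂| + 1
  have hR : 0 ≤ R := by positivity
  have hdist : ∀ n, dist x₀ (y n) ≤ R * h n := fun n ↦ by
    have e1 := (abs_le.1 (hKL (σ - h n) (sub_pos.2 (hσn n)) (by linarith [h0 n]) x₀ (y n))).1
    have e2 := (abs_le.1 (hC₁L (σ - h n) (sub_pos.2 (hσn n)) (h n) (h0 n) x₀)).1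
    rw [add_sub_cancel] at e2
    have e3 := hC₂ (h n) (h0 n) x₀ (y n)
    have e4 := hy n
    have e5 : C₂ * h n ≤ |C₂| * h n := by
      have := (h0 n).le
      gcongr
      exact le_abs_self C₂
    have e6 : h n ^ 2 ≤ 1 * h n := by
      rw [pow_two]
      exact mul_le_mul_of_nonneg_right (h1n n) (h0 n).le
    have e7 : R * h n = C₁ * h n + |C₂| * h n + 1 * h n := by ring
    linarith
  have hyx : Tendsto y atTop (𝓝 x₀) := by
    have hR0 : Tendsto (fun n ↦ R * h n) atTop (𝓝 0) := by simpa using hlim0.const_mul R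
    exact tendsto_iff_dist_tendsto_zero.2 (squeeze_zero (fun _ ↦ dist_nonneg)
      (fun n ↦ (dist_comm _ _).trans_le (hdist n)) hR0)
  have hymem := hyx.eventually (Metric.ball_mem_nhds x₀ hC.pos)
  have hbdd : ∃ᶠ n in atTop, (h n)⁻¹ • (e (y n) - e x₀) ∈ Metric.closedBall (0 : E) (C * R) := by
    refine Eventually.frequently ?_
    filter_upwards [hymem] with n hn
    have hn0 := h0 n
    rw [mem_closedBall_zero_iff, norm_smul, norm_inv, Real.norm_of_nonneg hn0.le]
    calc _ ≤ (h n)⁻¹ * (C * (R * h n)) := by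
          gcongr
          exact (hC.norm_sub_le x₀ (Metric.mem_ball_self hC.pos) (y n) hn).trans
            (by gcongr; exact hdist n)
      _ = C * R := by field_simp
  have : ProperSpace E := FiniteDimensional.proper ℝ E
  obtain ⟨w, -, k, hk, hw⟩ := (isCompact_closedBall (0 : E) (C * R)).tendsto_subseq' hbdd
  have hkt := hk.tendsto_atTop
  have hwv : w = v := by
    refine (hH.isTonelliFun x₀).eq_of_subgradient (apply_fibreDeriv H x₀ _) fun q ↦ ?_
    exact hH.lagrangianAt_sub_le_of_tendsto hc
      (hasFDerivAt_extChart_symm_of_mdifferentiableAt hd) (fun n ↦ h0 (k n)) (fun n ↦ hσn (k n))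
      (hlim0.comp hkt) (hyx.comp hkt) (fun n ↦ hy (k n)) hw q
  rw [hwv] at hw
  set η := ε / (4 * (K * C + 1)) with hη
  have hη0 : 0 < η := by positivity
  have hlo := hH.eventually_le_fundamentalSolution (Eventually.of_forall fun n ↦ h0 (k n))
    (hlim0.comp hkt) (tendsto_const_nhds (x := x₀)) (hyx.comp hkt) hw
    (show 0 < ε / 4 by positivity)
  have hdiff : Tendsto (fun n ↦ (h (k n))⁻¹ • (e (u (h (k n))) - e x₀) -
      (h (k n))⁻¹ • (e (y (k n)) - e x₀)) atTop (𝓝 (v - v)) :=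
    (huv.comp (hlim.comp hkt)).sub hw
  rw [sub_self] at hdiff
  obtain ⟨n, e1, e2, e3, e4, e5⟩ := (hlo.and ((hdiff.eventually (Metric.ball_mem_nhds 0 hη0)).and
    (((hyx.comp hkt).eventually (Metric.ball_mem_nhds x₀ hC.pos)).and
    (((hu.comp (hlim.comp hkt)).eventually (Metric.ball_mem_nhds x₀ hC.pos)).and
    ((hlim0.comp hkt).eventually_lt_const (show 0 < ε / 4 by positivity)))))).exists
  simp only [Function.comp_apply] at e1 e3 e4 e5
  refine (hh (k n)).1 ?_
  set t := h (k n)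
  have ht0 : 0 < t := h0 (k n)
  have f1 := hy (k n)
  have f2 := (abs_le.1 (hKL (σ - t) (sub_pos.2 (hσn (k n))) (by linarith) (u t) (y (k n)))).1
  have f3 : dist (u t) (y (k n)) ≤ C * (t * η) := by
    rw [dist_comm]
    refine (hC.dist_le (y (k n)) e3 (u t) e4).trans ?_
    gcongr
    rw [← smul_sub, sub_sub_sub_cancel_right, dist_zero_right, norm_smul, norm_inv,
      Real.norm_of_nonneg ht0.le, inv_mul_eq_div, div_lt_iff₀ ht0] at e2
    rw [← he, mul_comm t]
    exact e2.le
  have f4 : K * dist (u t) (y (k n)) ≤ ε / 4 * t := by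
    calc K * dist (u t) (y (k n)) ≤ K * (C * (t * η)) := by gcongr
      _ = K * C * η * t := by ring
      _ ≤ (K * C + 1) * η * t := by gcongr; linarith
      _ = ε / 4 * t := by rw [hη]; field_simp
  have f5 : t ^ 2 ≤ ε / 4 * t := by
    rw [pow_two]
    exact mul_le_mul_of_nonneg_right e5.le ht0.le
  nlinarith

/-- The function `T⁺_σφ` is calibrated, to first order, along the optimal velocity. -/
theorem IsTonelli.eventually_fundamentalSolution_le_laxOleinikPos (hH : IsTonelli H) {Λ : ℝ}
    (hΛ : 0 ≤ Λ) (hφ : ∀ y z, |φ y - φ z| ≤ Λ * dist y z) (hc : Continuous φ) {σ : ℝ} (hσ : 0 < σ)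
    {x₀ : M} (hd : MDifferentiableAt 𝓘(ℝ, E) 𝓘(ℝ, ℝ) (laxOleinikPos H φ σ) x₀) {u : ℝ → M}
    (hu : Tendsto u (𝓝[>] 0) (𝓝 x₀))
    (huv : Tendsto (fun h ↦ h⁻¹ • (extChartAt 𝓘(ℝ, E) x₀ (u h) - extChartAt 𝓘(ℝ, E) x₀ x₀))
      (𝓝[>] 0) (𝓝 (optimalVelocity φ H σ x₀))) {ε : ℝ} (hε : 0 < ε) :
    ∀ᶠ h in 𝓝[>] 0, fundamentalSolution H h x₀ (u h) ≤
      laxOleinikPos H φ (σ - h) (u h) - laxOleinikPos H φ σ x₀ + ε * h := by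
  filter_upwards [hH.eventually_le_laxOleinikPos hΛ hφ hc hσ hd hu huv (half_pos hε),
    hH.eventually_fundamentalSolution_le (l := 𝓝[>] (0 : ℝ)) (h := fun h ↦ h)
      eventually_mem_nhdsWithin (tendsto_const_nhds (x := x₀)) hu huv (half_pos hε)] with h h1 h2
  linarith

end Calibration

/-! ### Solutions of the periodic problem generate minimizing movements -/

/-- A subadditive function of intervals which is nonpositive on short intervals to the right of
each point, and at most linear on short intervals to the left of each point, is nonpositive. -/
theorem nonpos_of_subadditive_of_eventually {a b : ℝ} (hab : a < b) {G : ℝ → ℝ → ℝ}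
    (hadd : ∀ s t, a < s → s < t → t ≤ b → G a t ≤ G a s + G s t)
    (hright : ∀ s ∈ Ico a b, ∀ᶠ t in 𝓝[>] s, G s t ≤ 0)
    (hleft : ∀ t ∈ Ioc a b, ∃ D, ∀ᶠ s in 𝓝[<] t, G s t ≤ D * (t - s)) : G a b ≤ 0 := by
  set S := {t | t ∈ Ioc a b ∧ G a t ≤ 0} with hS
  have hne : S.Nonempty := by
    obtain ⟨t, h1, h2⟩ := ((hright a ⟨le_rfl, hab⟩).and (Ioc_mem_nhdsGT hab)).exists
    exact ⟨t, h2, h1⟩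
  have hbdd : BddAbove S := ⟨b, fun t ht ↦ ht.1.2⟩
  set c := sSup S with hc
  have hcb : c ≤ b := csSup_le hne fun t ht ↦ ht.1.2
  obtain ⟨t₀, ht₀⟩ := hne
  have hac : a < c := ht₀.1.1.trans_le (le_csSup hbdd ht₀)
  obtain ⟨u, -, hu, huS⟩ := exists_seq_tendsto_sSup ⟨t₀, ht₀⟩ hbdd
  -- Continuous induction: the left estimate shows that the supremum c belongs to S, and the right
  -- estimate would pass beyond c if c < b.
  have hcS : G a c ≤ 0 := by
    by_cases h : ∃ n, u n = c
    · obtain ⟨n, hn⟩ := h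
      exact hn ▸ (huS n).2
    · push Not at h
      have hlt : ∀ n, u n < c := fun n ↦ (le_csSup hbdd (huS n)).lt_of_ne (h n)
      obtain ⟨D, hD⟩ := hleft c ⟨hac, hcb⟩
      have hu' : Tendsto u atTop (𝓝[<] c) :=
        tendsto_nhdsWithin_iff.2 ⟨hu, Eventually.of_forall hlt⟩
      have hlim : Tendsto (fun n ↦ D * (c - u n)) atTop (𝓝 0) := by
        have : Tendsto (fun n ↦ D * (c - u n)) atTop (𝓝 (D * (c - c))) :=
          (hu.const_sub c).const_mul D
        rwa [sub_self, mul_zero] at this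
      refine ge_of_tendsto hlim ?_
      filter_upwards [hu'.eventually hD] with n hn
      linarith [hadd (u n) c (huS n).1.1 (hlt n) hcb, (huS n).2]
  rcases hcb.eq_or_lt with h | h
  · exact h ▸ hcS
  · obtain ⟨t, h1, h2⟩ := ((hright c ⟨hac.le, h⟩).and (Ioc_mem_nhdsGT h)).exists
    have h3 : t ∈ S := ⟨⟨hac.trans h2.1, h2.2⟩, by linarith [hadd c t hac h2.1 h2.2]⟩
    exact absurd (le_csSup hbdd h3) (not_le.2 h2.1)

theorem TendstoOnCompacts.continuousOn {X : Type*} [MetricSpace X] {u : ℕ → ℝ → X} {w : ℝ → X}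
    (h : TendstoOnCompacts u w) (hu : ∀ j, ContinuousOn (u j) (Ici 0)) (T : ℝ) :
    ContinuousOn w (Icc 0 T) :=
  (h (Icc 0 T) Icc_subset_Ici_self isCompact_Icc).continuousOn
    (Frequently.of_forall fun j ↦ (hu j).mono Icc_subset_Ici_self)

theorem TendstoOnCompacts.comp_floor {X : Type*} [MetricSpace X] {u : ℕ → ℝ → X} {w : ℝ → X}
    (h : TendstoOnCompacts u w) (hu : ∀ j, ContinuousOn (u j) (Ici 0)) {τ : ℕ → ℝ}
    (hτ0 : ∀ j, 0 < τ j) (hτ : Tendsto τ atTop (𝓝 0)) :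
    TendstoOnCompacts (fun j t ↦ u j (⌊t / τ j⌋₊ * τ j)) w := by
  intro K hK hKc
  obtain ⟨T, hT⟩ := hKc.bddAbove
  have huc := isCompact_Icc.uniformContinuousOn_of_continuous (h.continuousOn hu T)
  rw [Metric.uniformContinuousOn_iff] at huc
  rw [Metric.tendstoUniformlyOn_iff]
  intro ε hε
  obtain ⟨δ, hδ, hδw⟩ := huc (ε / 2) (half_pos hε)
  filter_upwards [Metric.tendstoUniformlyOn_iff.1
    (h (Icc 0 T) Icc_subset_Ici_self isCompact_Icc) (ε / 2) (half_pos hε),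
    hτ.eventually_lt_const hδ] with j h1 h2 t ht
  have ht0 : 0 ≤ t := hK ht
  have e1 := (Nat.lt_floor_add_one (t / τ j)).le
  rw [div_le_iff₀ (hτ0 j)] at e1
  have e2 := Nat.floor_le (div_nonneg ht0 (hτ0 j).le)
  rw [le_div_iff₀ (hτ0 j)] at e2
  set s := (⌊t / τ j⌋₊ : ℝ) * τ j with hs
  have hs0 : 0 ≤ s := mul_nonneg (Nat.cast_nonneg _) (hτ0 j).le
  have htT : t ≤ T := hT ht
  have hst : dist t s < δ := by
    rw [Real.dist_eq, abs_of_nonneg (by linarith)]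
    linarith
  have e3 := hδw t ⟨ht0, htT⟩ s ⟨hs0, by linarith⟩ hst
  have e4 := h1 s ⟨hs0, by linarith⟩
  linarith [dist_triangle (w t) (w s) (u j s)]

/-! ### Speed bounds and exact calibration of periodic solutions -/

section PeriodicField

set_option linter.unusedSectionVars false

variable {E : Type*} [NormedAddCommGroup E] [NormedSpace ℝ E] [FiniteDimensional ℝ E]
  {M : Type*} [MetricSpace M] [ChartedSpace E M] [IsManifold 𝓘(ℝ, E) ∞ M]
  [RiemannianBundle (fun x : M ↦ TangentSpace 𝓘(ℝ, E) x)]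
  [IsContMDiffRiemannianBundle 𝓘(ℝ, E) ∞ E (fun x : M ↦ TangentSpace 𝓘(ℝ, E) x)]
  [IsRiemannianManifold 𝓘(ℝ, E) M] [CompactSpace M] [ConnectedSpace M]
  {H : ∀ x : M, CotSpace E x → ℝ} {φ : M → ℝ}

/-- In the chart at x₀ the frozen metric at x₀ and the distance agree to first order, so the
constant is K itself rather than a chart-dependent multiple. This makes the speed bound uniform
along a solution. -/
theorem norm_le_of_lipschitz {f : M → ℝ} {x₀ : M} {K : ℝ} (hK : 0 ≤ K)
    (hf : ∀ y, |f y - f x₀| ≤ K * dist x₀ y) {p : CotSpace E x₀}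
    (hd : HasFDerivAt (fun a ↦ f ((extChartAt 𝓘(ℝ, E) x₀).symm a)) (show E →L[ℝ] ℝ from p)
      (extChartAt 𝓘(ℝ, E) x₀ x₀)) : ‖p‖ ≤ K := by
  refine ContinuousLinearMap.opNorm_le_bound _ hK fun v ↦ ?_
  obtain ⟨q, hq⟩ : ∃ q : E, chartDSymm x₀ x₀ q = v := ⟨v, chartDSymm_self (E := E) x₀ v⟩
  have hpq : (show E →L[ℝ] ℝ from p) q = p v := by
    rw [← hq, chartDSymm_self]
    rfl
  rw [← hpq, Real.norm_eq_abs]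
  obtain ⟨ρ, C, hC⟩ := exists_chartBounds (E := E) x₀
  have hC0 : 0 < C := by linarith [hC.one_le]
  have hid : Tendsto (fun h : ℝ ↦ h) (𝓝[>] 0) (𝓝 0) := nhdsWithin_le_nhds
  have hne : Tendsto (fun h : ℝ ↦ h) (𝓝[>] 0) (𝓝[≠] 0) := nhdsGT_le_nhdsNE 0
  have hy := tendsto_extChart_symm_add_smul (E := E) x₀ q hid
  have h1 := (tendsto_slope_extChart_symm hd q hne).abs
  set y : ℝ → M := fun h ↦ (extChartAt 𝓘(ℝ, E) x₀).symm (extChartAt 𝓘(ℝ, E) x₀ x₀ + h • q)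
  have h2 : Tendsto (fun h ↦ K * ((1 + C * dist x₀ (y h)) *
      ‖v‖)) (𝓝[>] 0)
      (𝓝 (K * ((1 + C * dist x₀ x₀) * ‖v‖))) :=
    ((((tendsto_const_nhds.dist hy).const_mul C).const_add 1).mul_const _).const_mul K
  rw [dist_self, mul_zero, add_zero, one_mul] at h2
  refine le_of_tendsto_of_tendsto h1 h2 ?_
  filter_upwards [eventually_mem_nhdsWithin, hy.eventually (Metric.ball_mem_nhds x₀ hC.pos),
    eventually_extChart_symm_add_smul (E := E) x₀ q hid] with h h0 h3 h4
  have h5 := hC.dist_le_norm_chartDSymm x₀ (Metric.mem_ball_self hC.pos) (y h) h3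
  have hh : 0 < h := h0
  have h6 : ‖chartDSymm x₀ x₀ (extChartAt 𝓘(ℝ, E) x₀ (y h) - extChartAt 𝓘(ℝ, E) x₀ x₀)‖ =
      h * ‖v‖ := by
    rw [h4, add_sub_cancel_left, map_smul, norm_smul, Real.norm_of_nonneg hh.le, hq]
  rw [h6] at h5
  rw [abs_mul, abs_of_pos (inv_pos.2 hh), inv_mul_le_iff₀ hh]
  refine (hf (y h)).trans ?_
  calc K * dist x₀ (y h) ≤ K * ((1 + C * dist x₀ (y h)) *
        (h * ‖v‖)) := by gcongr
    _ = _ := by ring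

/-- Velocities are known only within [a,b), so the growth of the distance is controlled through
right slopes, and continuity includes the end b. -/
theorem dist_le_of_norm_velocity_le {ξ : ℝ → M} {a b R : ℝ} (hc : ContinuousOn ξ (Icc a b))
    (hv : ∀ t ∈ Ico a b, ∃ v : TangentSpace 𝓘(ℝ, E) (ξ t), ‖v‖ ≤ R ∧
      HasMFDerivWithinAt 𝓘(ℝ, ℝ) 𝓘(ℝ, E) ξ (Ico a b) t ((1 : ℝ →L[ℝ] ℝ).smulRight v))
    {s t : ℝ} (hs : a ≤ s) (hst : s ≤ t) (ht : t ≤ b) : dist (ξ s) (ξ t) ≤ R * (t - s) := by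
  have hsub : Icc s b ⊆ Icc a b := Icc_subset_Icc_left hs
  refine image_le_of_liminf_slope_right_le_deriv_boundary (f := fun t ↦ dist (ξ s) (ξ t))
    (B := fun t ↦ R * (t - s)) (B' := fun _ ↦ R) (a := s) (b := b)
    (continuous_dist.comp_continuousOn (continuousOn_const.prodMk (hc.mono hsub))) (by simp) (by fun_prop) ?_ ?_ ⟨hst, ht⟩
  · intro x _
    simpa using ((hasDerivWithinAt_id x (Ici x)).sub_const s).const_mul R
  · intro x hx r hr
    obtain ⟨v, hvR, hv⟩ := hv x ⟨hs.trans hx.1, hx.2⟩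
    have hlt : Ico a b ∈ 𝓝[>] x :=
      mem_of_superset (Ioo_mem_nhdsGT hx.2) fun z hz ↦ ⟨(hs.trans hx.1).trans hz.1.le, hz.2⟩
    have h1 := (eventually_dist_le_of_velocity hv (half_pos (sub_pos.2 hr))).filter_mono
      (nhdsWithin_le_of_mem hlt)
    refine Eventually.frequently ?_
    filter_upwards [h1, self_mem_nhdsWithin] with z hz hxz
    have hxz' : 0 < z - x := sub_pos.2 hxz
    rw [abs_of_pos hxz'] at hz
    rw [slope_def_field, div_lt_iff₀ hxz']
    have h2 : (‖v‖ + (r - R) / 2) * (z - x) < r * (z - x) :=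
      mul_lt_mul_of_pos_right (by linarith) hxz'
    linarith [dist_triangle (ξ s) (ξ x) (ξ z)]

theorem IsTonelli.exists_norm_fibreDeriv_le (hH : IsTonelli H) (K : ℝ) :
    ∃ R ≥ 0, ∀ (x : M) (p : CotSpace E x), ‖p‖ ≤ K → ‖fibreDeriv H x p‖ ≤ R := by
  obtain ⟨B, hB⟩ := hH.exists_bound (K + 1)
  obtain ⟨C, hC⟩ := hH.superlinear 0
  refine ⟨|B + C|, abs_nonneg _, fun x p hp ↦ le_trans ?_ (le_abs_self _)⟩
  exact (hH.isTonelliFun x).norm_le_of_bound (p := p) (fun q hq ↦ hB x q (by linarith))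
    (fun q ↦ by linarith [hC x q]) (apply_fibreDeriv H x p)

/-- A solution of `γ'(t) = H_p(γ(t), DT⁺_{b-t}φ(γ(t)))` on `[a,b)` reaches, at time `b`, a point
where the supremum in the definition of `T⁺_{b-a}φ(γ(a))` is attained. -/
theorem IsTonelli.laxOleinikPos_le_of_solution (hH : IsTonelli H) {Λ : ℝ} (hΛ : 0 ≤ Λ)
    (hφ : ∀ y z, |φ y - φ z| ≤ Λ * dist y z) (hφc : Continuous φ) {a b : ℝ} (hab : a < b)
    {γ : ℝ → M} (hc : ContinuousOn γ (Icc a b))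
    (hd : ∀ t ∈ Ico a b, MDifferentiableAt 𝓘(ℝ, E) 𝓘(ℝ, ℝ) (laxOleinikPos H φ (b - t)) (γ t))
    (hode : ∀ t ∈ Ico a b, HasMFDerivWithinAt 𝓘(ℝ, ℝ) 𝓘(ℝ, E) γ (Ico a b) t
      ((1 : ℝ →L[ℝ] ℝ).smulRight (fibreDeriv H (γ t)
        (mfderiv 𝓘(ℝ, E) 𝓘(ℝ, ℝ) (laxOleinikPos H φ (b - t)) (γ t) : CotSpace E (γ t))))) :
    laxOleinikPos H φ (b - a) (γ a) ≤ φ (γ b) - fundamentalSolution H (b - a) (γ a) (γ b) := by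
  obtain ⟨K, hK, hKL⟩ := hH.exists_laxOleinikPos_lipschitz hΛ hφ hφc (b - a)
  obtain ⟨C₁, hC₁, hC₁L⟩ := hH.exists_abs_laxOleinikPos_sub_le hΛ hφ hφc
  obtain ⟨C₂, hC₂, hC₂L⟩ := hH.exists_abs_laxOleinikPos_add_sub_le hΛ hφ hφc
  obtain ⟨R, hR, hRv⟩ := hH.exists_norm_fibreDeriv_le K
  obtain ⟨r, hr, B, hB⟩ := hH.exists_fundamentalSolution_le R
  have hlip : ∀ {s t : ℝ}, a ≤ s → s ≤ t → t ≤ b → dist (γ s) (γ t) ≤ R * (t - s) := by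
    refine dist_le_of_norm_velocity_le hc fun t ht ↦ ⟨_, hRv _ _ ?_, hode t ht⟩
    refine norm_le_of_lipschitz hK (fun y ↦ ?_)
      (hasFDerivAt_extChart_symm_of_mdifferentiableAt (hd t ht))
    rw [dist_comm]
    exact hKL (b - t) (sub_pos.2 ht.2) (by linarith [ht.1]) y (γ t)
  -- The value at b is assigned separately as φ (γ b), because `laxOleinikPos` is meant for positive
  -- times only; the estimate `hgL` shows that the one-sided Lipschitz bound persists up to b.
  set g : ℝ → ℝ := fun t ↦ if t < b then laxOleinikPos H φ (b - t) (γ t) else φ (γ t) with hg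
  have hga : ∀ t, t < b → g t = laxOleinikPos H φ (b - t) (γ t) := fun t ht ↦ if_pos ht
  have hgb : g b = φ (γ b) := if_neg (lt_irrefl b)
  have hgL : ∀ s t, a ≤ s → s < t → t ≤ b →
      g s - g t ≤ ((K + Λ) * R + (C₁ + C₂)) * (t - s) := by
    intro s t hs hst ht
    have h1 := hlip hs hst.le ht
    have h0 : 0 < t - s := sub_pos.2 hst
    have hKd : K * dist (γ s) (γ t) ≤ K * (R * (t - s)) := by gcongr
    have hΛd : Λ * dist (γ s) (γ t) ≤ Λ * (R * (t - s)) := by gcongr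
    have hK0 : 0 ≤ K * (R * (t - s)) := by positivity
    have hΛ0 : 0 ≤ Λ * (R * (t - s)) := by positivity
    have h10 : 0 ≤ C₁ * (t - s) := by positivity
    have h20 : 0 ≤ C₂ * (t - s) := by positivity
    have hexp : ((K + Λ) * R + (C₁ + C₂)) * (t - s) = K * (R * (t - s)) + Λ * (R * (t - s)) +
      C₁ * (t - s) + C₂ * (t - s) := by ring
    rw [hexp]
    rcases ht.eq_or_lt with rfl | ht'
    · rw [hgb, hga s hst]
      have h2 := (abs_le.1 (hC₁L (t - s) h0 (γ s))).2
      have h3 := (abs_le.1 (hφ (γ s) (γ t))).2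
      linarith
    · rw [hga s (hst.trans ht'), hga t ht']
      have h2 := (abs_le.1 (hC₂L (b - t) (sub_pos.2 ht') (t - s) h0 (γ s))).2
      have h3 := (abs_le.1 (hKL (b - t) (sub_pos.2 ht') (by linarith) (γ s) (γ t))).2
      rw [show t - s + (b - t) = b - s by ring] at h2
      linarith
  rw [← hga a hab, ← hgb]
  refine le_of_forall_pos_le_add fun ε hε ↦ ?_
  have hba : 0 < b - a := sub_pos.2 hab
  -- G is the calibration defect with a tolerance ε spread evenly over [a,b]. First-order
  -- calibration with rate ε / (b - a) makes it nonpositive to the right of each time; to the left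
  -- only a linear bound is available.
  have key := nonpos_of_subadditive_of_eventually hab (G := fun s t ↦
    fundamentalSolution H (t - s) (γ s) (γ t) + g s - g t - ε / (b - a) * (t - s)) ?_ ?_ ?_
  · simp only [div_mul_cancel₀ ε hba.ne'] at key
    linarith
  · intro s t has hst _
    have h1 := hH.fundamentalSolution_add_le (sub_pos.2 has) (sub_pos.2 hst) (γ a) (γ s) (γ t)
    rw [show s - a + (t - s) = t - a by ring] at h1
    linarith
  · intro s hs
    have hmem : Ico a b ∈ 𝓝[>] s :=
      mem_of_superset (Ioo_mem_nhdsGT hs.2) fun z hz ↦ ⟨hs.1.trans hz.1.le, hz.2⟩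
    have hadd : Tendsto (fun h : ℝ ↦ s + h) (𝓝[>] 0) (𝓝[>] s) := by
      refine tendsto_nhdsWithin_iff.2 ⟨?_, ?_⟩
      · have : Tendsto (fun h : ℝ ↦ s + h) (𝓝 0) (𝓝 (s + 0)) := tendsto_const_nhds.add tendsto_id
        rw [add_zero] at this
        exact this.mono_left nhdsWithin_le_nhds
      · filter_upwards [self_mem_nhdsWithin] with h hh
        exact lt_add_of_pos_right s hh
    have hsub : Tendsto (fun t : ℝ ↦ t - s) (𝓝[>] s) (𝓝[>] 0) := by
      refine tendsto_nhdsWithin_iff.2 ⟨?_, ?_⟩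
      · have : Tendsto (fun t : ℝ ↦ t - s) (𝓝 s) (𝓝 (s - s)) := tendsto_id.sub_const s
        rw [sub_self] at this
        exact this.mono_left nhdsWithin_le_nhds
      · filter_upwards [self_mem_nhdsWithin] with t ht
        exact sub_pos.2 (mem_Ioi.1 ht)
    have hcs : Tendsto (fun h ↦ γ (s + h)) (𝓝[>] 0) (𝓝 (γ s)) :=
      ((hode s hs).continuousWithinAt.mono_of_mem_nhdsWithin hmem).tendsto.comp hadd
    have hder := ((hasDerivWithinAt_extChart_of_hasMFDerivWithinAt (hode s hs)
      ).mono_of_mem_nhdsWithin hmem)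
    have huv := ((hasDerivWithinAt_iff_tendsto_slope' self_notMem_Ioi).1 hder).comp hadd
    have hcal := hH.eventually_fundamentalSolution_le_laxOleinikPos hΛ hφ hφc (sub_pos.2 hs.2)
      (hd s hs) hcs (huv.congr fun h ↦ by simp [slope_def_module]) (div_pos hε hba)
    filter_upwards [hsub.eventually hcal, Ioo_mem_nhdsGT hs.2] with t ht hst
    rw [add_sub_cancel, show b - s - (t - s) = b - t by ring] at ht
    rw [hga s hs.2, hga t hst.2]
    linarith
  · intro t ht
    refine ⟨B + ((K + Λ) * R + (C₁ + C₂)), ?_⟩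
    have hlim : Tendsto (fun s ↦ R * (t - s)) (𝓝[<] t) (𝓝 0) := by
      have : Tendsto (fun s ↦ R * (t - s)) (𝓝 t) (𝓝 (R * (t - t))) :=
        (tendsto_id.const_sub t).const_mul R
      rw [sub_self, mul_zero] at this
      exact this.mono_left nhdsWithin_le_nhds
    filter_upwards [Ioo_mem_nhdsLT ht.1, hlim.eventually_lt_const hr] with s hs hs'
    have h1 := hlip hs.1.le hs.2.le ht.2
    have h2 := hB (γ s) (γ t) (h1.trans hs'.le) (t - s) (sub_pos.2 hs.2) h1
    have h3 := hgL s t hs.1.le hs.2 ht.2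
    have h4 : 0 ≤ ε / (b - a) * (t - s) :=
      mul_nonneg (div_pos hε hba).le (sub_pos.2 hs.2).le
    rw [add_mul]
    linarith

theorem mul_fract_div_eq_sub {τ t : ℝ} (hτ : 0 < τ) {k : ℕ} (ht : t ∈ Ico (k * τ) ((k + 1) * τ)) :
    τ * Int.fract (t / τ) = t - k * τ := by
  have h1 : ⌊t / τ⌋ = (k : ℤ) := by
    rw [Int.floor_eq_iff]
    refine ⟨(le_div_iff₀ hτ).2 (by simpa using ht.1), (div_lt_iff₀ hτ).2 (by simpa using ht.2)⟩
  rw [Int.fract, h1]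
  field_simp
  push_cast
  ring

theorem IsPeriodicFieldSolution.isArgmaxScheme (hH : IsTonelli H) {Λ : ℝ} (hΛ : 0 ≤ Λ)
    (hφ : ∀ y z, |φ y - φ z| ≤ Λ * dist y z) (hφc : Continuous φ) {τ : ℝ} (hτ : 0 < τ) {x : M}
    {γ : ℝ → M} (h : IsPeriodicFieldSolution φ H τ x γ) :
    IsArgmaxScheme φ H τ x (fun k ↦ γ (k * τ)) := by
  refine ⟨by simpa using h.2, fun k y _ ↦ ?_⟩
  have hk0 : 0 ≤ (k : ℝ) * τ := by positivity
  -- On the k-th period the remaining time is (k + 1) τ - t, so the field is the one of the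
  -- preceding calibration result with b = (k + 1) τ.
  have heq : ∀ t ∈ Ico (k * τ) ((k + 1) * τ), τ - τ * Int.fract (t / τ) = (k + 1) * τ - t :=
    fun t ht ↦ by rw [mul_fract_div_eq_sub hτ ht]; ring
  have key := hH.laxOleinikPos_le_of_solution hΛ hφ hφc
    (show (k : ℝ) * τ < (k + 1) * τ by linarith) (γ := γ)
    (h.continuousOn.mono fun t ht ↦ hk0.trans ht.1) (fun t ht ↦ ?_) fun t ht ↦ ?_
  · rw [show ((k : ℝ) + 1) * τ - k * τ = τ by ring] at key
    have h1 := hH.le_laxOleinikPos hφc hτ (γ (k * τ)) y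
    simp only [mem_ofPred_eq, Nat.cast_add, Nat.cast_one]
    exact h1.trans key
  · rw [← heq t ht]
    exact h.mdifferentiableAt t (hk0.trans ht.1)
  · rw [← heq t ht]
    exact h.ode k t ht

/-- Limits of solutions of the periodic problem are minimizing movements. -/
theorem IsPeriodicFieldLimit.isMinimizingMovement (hH : IsTonelli H) (hφ : IsSemiconcave φ) {x : M}
    {γ : ℝ → M} (h : IsPeriodicFieldLimit φ H x γ) : IsMinimizingMovement φ H x γ := by
  obtain ⟨τ, u, hτ0, hτ, hu, hlim⟩ := h
  obtain ⟨Λ, hΛ, hΛφ⟩ := hφ.exists_abs_sub_le E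
  exact ⟨τ, fun j k ↦ u j (k * τ j), hτ0, hτ,
    fun j ↦ (hu j).isArgmaxScheme hH hΛ hΛφ hφ.1 (hτ0 j),
    hlim.comp_floor (fun j ↦ (hu j).continuousOn) hτ0 hτ⟩

end PeriodicField

theorem mainTheorem4
    {E : Type*} [NormedAddCommGroup E] [NormedSpace ℝ E] [FiniteDimensional ℝ E]
    {M : Type*} [MetricSpace M] [CompactSpace M] [ConnectedSpace M]
    [ChartedSpace E M] [IsManifold 𝓘(ℝ, E) ∞ M]
    [RiemannianBundle (fun x : M ↦ TangentSpace 𝓘(ℝ, E) x)]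
    [IsContMDiffRiemannianBundle 𝓘(ℝ, E) ∞ E (fun x : M ↦ TangentSpace 𝓘(ℝ, E) x)]
    [IsRiemannianManifold 𝓘(ℝ, E) M]
    (H : ∀ x : M, CotSpace E x → ℝ) (hH : IsTonelli H)
    (φ : M → ℝ) (hφ : IsSemiconcave φ) (x : M) :
    (∀ γ : ℝ → M, IsPeriodicFieldLimit φ H x γ → IsMinimizingMovement φ H x γ) ∧
      (∀ γ : ℝ → M, IsMinimizingMovement φ H x γ → IsGeneralizedCharacteristic φ H x γ) := by
  exact ⟨fun _ h ↦ h.isMinimizingMovement hH hφ, fun _ h ↦ h.isGeneralizedCharacteristic hH hφ⟩
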